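/- **Conventions.** All Gaussian fields are real-valued, centred and have a.s. continuous sample paths. A Gaussian field on $\mathbb{R}^d$ is *isotropic* if $\mathbb{E}[f(x)f(y)]=K(|x-y|)$ for some $K:[0,\infty)\to\mathbb{R}$; $K$ is called its covariance. A function $\ell:(0,\infty)\to(0,\infty)$ is *slowly varying* if it is continuous and $\ell(ax)/\ell(x)\to1$ as $x\to\infty$ for every $a>0$. The *spectral measure* of $f$ is the finite measure $\nu$ on $\mathbb{R}^d$ with $K(|x|)=\int e^{2\pi i\langle x,\lambda\rangle}\,d\nu(\lambda)$, and $\mathcal F$ denotes the Fourier transform with kernel $e^{2\pi i\langle x,\lambda\rangle}$ (in the $L^2$ sense when applied to $L^2$ functions). The notation $a\sim b$ means $a/b\to1$. **Standing assumption.** Let $d\ge2$ and let $f$ be an isotropic Gaussian field on $\mathbb{R}^d$ that is a.s. $C^2$, whose spectral measure has a nonempty open set in its support, and whose covariance satisfies $K(r)\sim r^{-\alpha}\ell(r)$ as $r\to\infty$ with $\alpha\in[0,d)$ and $\ell$ slowly varying. If $\alpha\in\{0,1\}$, suppose moreover that $\ell(r)\sim(\log r)^{-\gamma}$ as $r\to\infty$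 for some $\gamma\in\mathbb{R}$, with $\gamma>0$ if $\alpha=0$ and $\gamma<1$ if $\alpha=1$. **Proposition 3.4.** Suppose in addition that at least one of the following holds. (A) There is a nonnegative continuous $v$ on $(0,\infty)$ with $K(r)=\int_0^\infty e^{-sr^2}v(s)\,ds$ for all $r\ge0$, such that $v(s)s^{d/2+3}$ is bounded and, for some $c>0$, as $s\to0^+$, $$v(s)\sim\begin{cases}c\,s^{\alpha/2-1}\ell(1/\sqrt s)&\text{if }\alpha\in(0,d),\\ c\,s^{-1}(\log(1/s))^{-\gamma-1}&\text{if }\alpha=0.\end{cases}$$ (B) The spectral measure has a density $\rho$; the function $q=\mathcal F[\sqrt\rho]$ is in $C^3(\mathbb{R}^d)$ (that is, has a $C^3$ representative); $\partial^kq\in L^2(\mathbb{R}^d)$ for every multi-index $|k|\le3$; for some $c>0$, as $|x|\to\infty$, $$q(x)\sim\begin{cases}c\,|x|^{-(d+\alpha)/2}\sqrt{\ell(|x|)}&\text{if }\alpha\in(0,d),\\ c\,|x|^{-d/2}(\log|x|)^{-(\gamma+1)/2}&\text{if }\alpha=0;\end{cases}$$ and, if $\alpha=0$, also $\sup_{|k|=1}|\partial^kq(x)|=O(|x|^{-1}q(x))$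 as $|x|\to\infty$. Then $f$ has a local–global decomposition: there is a collection of pairs $(f_L,g_L)_{L\ge1}$ of isotropic Gaussian fields on $\mathbb{R}^d$ such that, for every $L\ge1$, 1. $f\stackrel{d}{=}f_L+g_L$; 2. $f_L$ is $L$-range dependent: $\mathbb{E}[f_L(0)f_L(x)]=0$ whenever $|x|\ge L$; 3. $g_L$ is a.s. $C^1$; and moreover $$\lim_{M\to\infty}\limsup_{L\to\infty}\sup_{|x|\ge ML}\left|\frac{\mathbb{E}[g_L(0)g_L(x)]}{K(|x|)}-1\right|=0,$$ and, as $L\to\infty$, $$\mathbb{E}[g_L(0)^2]=O(K(L)),\qquad \sup_{|k|=1}\mathbb{E}[(\partial^kg_L(0))^2]=o(1);$$ and if $|1/K(L)|=L^{o(1)}$ as $L\to\infty$, then in addition $$\sup_{|k|=1}\mathbb{E}[(\partial^kg_L(0))^2]=O(L^{-2}K(L)).$$ -/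

import Mathlib

open MeasureTheory ProbabilityTheory Filter Topology Asymptotics Set
open scoped ENNReal FourierTransform RealInnerProductSpace

noncomputable section

/-- `f` is a centred Gaussian field on `ℝ^d` (under the probability measure `P`) whose covariance is
isotropic: `E[f(x) f(y)] = K(|x - y|)`. Only the values of `K` on `[0, ∞)` matter. -/
structure IsIsotropicGaussianField {d : ℕ} {Ω : Type*} [MeasurableSpace Ω]
    (f : EuclideanSpace ℝ (Fin d) → Ω → ℝ) (K : ℝ → ℝ) (P : Measure Ω) : Prop where
  gaussian : IsGaussianProcess f P
  centred : ∀ x, ∫ ω, f x ω ∂P = 0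
  covariance : ∀ x y, ∫ ω, f x ω * f y ω ∂P = K ‖x - y‖

/-- Almost every sample path of `f` is of class `C^n` on `ℝ^d`. -/
def HasSmoothPaths {d : ℕ} {Ω : Type*} [MeasurableSpace Ω] (n : ℕ)
    (f : EuclideanSpace ℝ (Fin d) → Ω → ℝ) (P : Measure Ω) : Prop :=
  ∀ᵐ ω ∂P, ContDiff ℝ n (fun x => f x ω)

/-- Equality in law of two random fields: all their finite-dimensional distributions coincide. -/
def SameLaw {T : Type*} {Ω Ω' : Type*} [MeasurableSpace Ω] [MeasurableSpace Ω']
    (f : T → Ω → ℝ) (g : T → Ω' → ℝ) (P : Measure Ω) (P' : Measure Ω') : Prop :=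
  ∀ I : Finset T,
    IdentDistrib (fun ω => I.restrict (fun x => f x ω)) (fun ω => I.restrict (fun x => g x ω)) P P'

/-- A slowly varying function: continuous and strictly positive on `(0, ∞)`, with
`ℓ(ax) / ℓ(x) → 1` as `x → ∞` for every `a > 0`. -/
structure IsSlowlyVarying (ℓ : ℝ → ℝ) : Prop where
  continuousOn : ContinuousOn ℓ (Ioi 0)
  pos : ∀ x, 0 < x → 0 < ℓ x
  tendsto_ratio : ∀ a, 0 < a → Tendsto (fun x => ℓ (a * x) / ℓ x) atTop (𝓝 1)

/-- The finite measure `ν` on `ℝ^d` is the spectral measure of the isotropic kernel `K`: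
`K(|x|) = ∫ e^{2πi ⟨x, λ⟩} dν(λ)`. -/
structure IsSpectralMeasure {d : ℕ} (K : ℝ → ℝ) (ν : Measure (EuclideanSpace ℝ (Fin d))) :
    Prop where
  finite : IsFiniteMeasure ν
  fourier : ∀ x : EuclideanSpace ℝ (Fin d),
    (K ‖x‖ : ℂ) = ∫ ξ, Complex.exp (2 * Real.pi * Complex.I * (⟪x, ξ⟫ : ℝ)) ∂ν

/-- The standing hypothesis on the field: `d ≥ 2`, `f` is an isotropic Gaussian field on `ℝ^d` which
is regular (almost surely `C²`, and the support of its spectral measure contains a nonempty open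
set), with regularly varying covariance `K(r) ∼ r^{-α} ℓ(r)`, `α ∈ [0, d)`. If `α = 0` or `α = 1`
then moreover `ℓ(r) ∼ (log r)^{-γ}`, with `γ > 0` if `α = 0` and `γ < 1` if `α = 1`
(`γ` plays no role for the other values of `α`). -/
structure RegularlyVaryingField {d : ℕ} {Ω : Type*} [MeasurableSpace Ω]
    (f : EuclideanSpace ℝ (Fin d) → Ω → ℝ) (K : ℝ → ℝ) (P : Measure Ω)
    (α γ : ℝ) (ℓ : ℝ → ℝ) : Prop where
  two_le_dim : 2 ≤ d
  field : IsIsotropicGaussianField f K P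
  smooth : HasSmoothPaths 2 f P
  spectral_support : ∃ ν : Measure (EuclideanSpace ℝ (Fin d)),
    IsSpectralMeasure K ν ∧ (interior ν.support).Nonempty
  index_nonneg : 0 ≤ α
  index_lt_dim : α < d
  slowlyVarying : IsSlowlyVarying ℓ
  covariance_equiv : K ~[atTop] fun r => r ^ (-α) * ℓ r
  log_equiv : α = 0 ∨ α = 1 → ℓ ~[atTop] fun r => (Real.log r) ^ (-γ)
  gamma_pos : α = 0 → 0 < γ
  gamma_lt_one : α = 1 → γ < 1

/-- The additional Laplace transform hypothesis on the covariance: `K(r) = ∫_0^∞ e^{-s r²} v(s) ds`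
for a nonnegative continuous `v` on `(0, ∞)` such that `v(s) s^{d/2+3}` is bounded and `v` has the
prescribed asymptotics at `0`. -/
def LaplaceCondition (d : ℕ) (K : ℝ → ℝ) (α γ : ℝ) (ℓ : ℝ → ℝ) : Prop :=
  ∃ v : ℝ → ℝ,
    ContinuousOn v (Ioi 0) ∧ (∀ s, 0 < s → 0 ≤ v s) ∧
    (∀ r, 0 ≤ r → K r = ∫ s in Ioi (0 : ℝ), Real.exp (-s * r ^ 2) * v s) ∧
    (∃ C : ℝ, ∀ s, 0 < s → v s * s ^ ((d : ℝ) / 2 + 3) ≤ C) ∧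
    ∃ c : ℝ, 0 < c ∧
      (0 < α → v ~[𝓝[>] 0] fun s => c * s ^ (α / 2 - 1) * ℓ (1 / √s)) ∧
      (α = 0 → v ~[𝓝[>] 0] fun s => c * s⁻¹ * (Real.log (1 / s)) ^ (-γ - 1))

/-- The partial derivative `∂_{i_1} ⋯ ∂_{i_n} q (x)` of a function on `ℝ^d`. -/
def partialDeriv {d n : ℕ} (q : EuclideanSpace ℝ (Fin d) → ℝ) (i : Fin n → Fin d)
    (x : EuclideanSpace ℝ (Fin d)) : ℝ :=
  iteratedFDeriv ℝ n q x (fun j => EuclideanSpace.single (i j) 1)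

/-- The additional white noise kernel hypothesis: the spectral measure has a density `ρ`, and the
function `q = F[√ρ]` (the `L²` Fourier transform with kernel `e^{2πi ⟨x, λ⟩}`, which is Mathlib's
`𝓕⁻`) is `C³`, with all partial derivatives of order at most three in `L²`, and with the prescribed
asymptotics at infinity. -/
def WhiteNoiseKernelCondition (d : ℕ) (K : ℝ → ℝ) (α γ : ℝ) (ℓ : ℝ → ℝ) : Prop :=
  ∃ (ρ q : EuclideanSpace ℝ (Fin d) → ℝ),
    Measurable ρ ∧ (∀ ξ, 0 ≤ ρ ξ) ∧
    IsSpectralMeasure K (volume.withDensity fun ξ => ENNReal.ofReal (ρ ξ)) ∧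
    (∃ h : MemLp (fun ξ => (√(ρ ξ) : ℂ)) 2 volume,
      (fun x => (q x : ℂ)) =ᵐ[volume] (𝓕⁻ (h.toLp : Lp ℂ 2 volume) : Lp ℂ 2 volume)) ∧
    ContDiff ℝ 3 q ∧
    (∀ n : ℕ, n ≤ 3 → ∀ i : Fin n → Fin d, MemLp (partialDeriv q i) 2 volume) ∧
    (∃ c : ℝ, 0 < c ∧
      (0 < α → q ~[cocompact _] fun x => c * ‖x‖ ^ (-((d + α) / 2)) * √(ℓ ‖x‖)) ∧
      (α = 0 → q ~[cocompact _] fun x =>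
        c * ‖x‖ ^ (-((d : ℝ) / 2)) * (Real.log ‖x‖) ^ (-((γ + 1) / 2)))) ∧
    (α = 0 → (fun x => ⨆ k : Fin d, |fderiv ℝ q x (EuclideanSpace.single k 1)|)
      =O[cocompact _] fun x => ‖x‖⁻¹ * q x)

/-- `sup_{|k| = 1} E[(∂^k g(0))²]`. -/
def maxDerivVariance {d : ℕ} {Ω : Type*} [MeasurableSpace Ω]
    (g : EuclideanSpace ℝ (Fin d) → Ω → ℝ) (P : Measure Ω) : ℝ :=
  ⨆ k : Fin d, ∫ ω, (fderiv ℝ (fun x => g x ω) 0 (EuclideanSpace.single k 1)) ^ 2 ∂P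

/-- A local-global decomposition of the isotropic Gaussian field `f` with covariance `K`: a
collection of pairs of isotropic Gaussian fields `(f_L, g_L)`, `L ≥ 1`, with `f = f_L + g_L` in law,
`f_L` `L`-range dependent, and `g_L` a `C¹` field with covariance asymptotic to `K` on scales `≫ L`.
Continuity of `f_L` makes the equality in law one between random continuous functions. -/
def HasLocalGlobalDecomposition {d : ℕ} {Ω : Type*} [MeasurableSpace Ω]
    (f : EuclideanSpace ℝ (Fin d) → Ω → ℝ) (K : ℝ → ℝ) (P : Measure Ω) : Prop :=
  ∃ (Ω' : Type) (_ : MeasurableSpace Ω') (P' : Measure Ω')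
    (fL gL : ℝ → EuclideanSpace ℝ (Fin d) → Ω' → ℝ),
    IsProbabilityMeasure P' ∧
    (∀ L : ℝ, 1 ≤ L →
      (∃ k : ℝ → ℝ, IsIsotropicGaussianField (fL L) k P') ∧
      (∃ k : ℝ → ℝ, IsIsotropicGaussianField (gL L) k P') ∧
      HasSmoothPaths 0 (fL L) P' ∧
      HasSmoothPaths 1 (gL L) P' ∧
      SameLaw f (fun x ω => fL L x ω + gL L x ω) P P' ∧
      (∀ x, L ≤ ‖x‖ → ∫ ω, fL L 0 ω * fL L x ω ∂P' = 0)) ∧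
    Tendsto (fun M : ℝ => limsup (fun L : ℝ =>
        ⨆ (x : EuclideanSpace ℝ (Fin d)) (_ : M * L ≤ ‖x‖),
          ENNReal.ofReal |(∫ ω, gL L 0 ω * gL L x ω ∂P') / K ‖x‖ - 1|) atTop)
      atTop (𝓝 0) ∧
    (fun L => ∫ ω, (gL L 0 ω) ^ 2 ∂P') =O[atTop] K ∧
    (fun L => maxDerivVariance (gL L) P') =o[atTop] (fun _ => (1 : ℝ)) ∧
    ((∃ u : ℝ → ℝ, Tendsto u atTop (𝓝 0) ∧ ∀ᶠ L in atTop, |1 / K L| = L ^ (u L)) →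
      (fun L => maxDerivVariance (gL L) P') =O[atTop] fun L => L ^ (-2 : ℝ) * K L)

end

/-!
The field is realised as a moving average of white noise. Let `W` be white noise on `ℝ × ℝ^d` with
intensity `μ ⊗ volume`, and let `p` be a smooth kernel, radial in the second variable. The covariance
of the field `x ↦ W (p (·, · + x))` is the autocorrelation `∫∫ p (s, y) p (s, y + x)`, and equals `K`
for the following choices of kernel.

* If `K` is the Laplace transform of `v`, take the Gaussian kernels `p (s, y) = exp (-2 s |y|²)`,
  with `μ` the measure with density proportional to `s ^ (d / 2) v s`: the autocorrelation of a
  Gaussian is a Gaussian (`integral_gaussKernel_mul_shift`).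
* If the spectral measure has density `ρ`, take `p = q = 𝓕⁻ √ρ` and `μ` a point mass, and use
  Plancherel's theorem (`integral_mul_shift_of_fourierInv`).

Multiplying the kernel by a smooth radial function which is `0` near the origin and `1` at distance
at least `L / 2` splits it into a tail and a head supported in a ball of radius `L / 2`. Integrating
both against the same white noise defines `g_L` and `f_L`; the kernels of `f_L 0` and `f_L x` are never
both nonzero at the same point when `|x| ≥ L`. The translates of a smooth kernel
are differentiable in `L²` with Lipschitz derivative, so that `g_L` has `C¹` sample paths by a
continuity criterion of Kolmogorov type applied to the field of derivatives
(`exists_contDiff_field`). This is summed up in `hasLocalGlobalDecomposition_of_kernel`, which leaves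
three estimates on the kernel.

* The covariance of `g_L` differs from `K` by the contribution of the points `y` with `|y| ≤ L / 2`
  or `|y + x| ≤ L / 2` (`abs_integral_sub_integral_tailKernel_le`).
* The variance of `g_L` is at most the integral of `p²` over `|y| ≥ L / 4`.
* The variance of its derivative is controlled by the integral of `|Dp|²` over the same set.

For Gaussian kernels, all three are bounded for each `s` by multiples of `exp (-s r²)`, and
integrating over `s` yields values of `K` at comparable arguments. For `q`, the estimates follow from
Potter's bounds for slowly varying functions (`potter_bounds`): the profile `Q` of `q` is such that
`r ^ d * Q r` grows at least like a power of `r`, whence `∫_{|y| ≤ L} |q| ≲ L ^ d * Q L`. The square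
integral of `q` far away is compared with the autocorrelation of `q` itself
(`HasRegularTail.exists_integral_sq_far_le`). When `α > 0` the condition `1 / K = L ^ o(1)` fails
(`not_subpolynomial`), so the stronger bound on derivatives only has to be derived for `α = 0`.
-/

noncomputable section

/-! ### Slow variation -/

/-- A continuous function whose increments `h (t + u) - h t` tend to `0` for every fixed `u` has
increments tending to `0` uniformly for `u ∈ [0, 1]`. By Baire's theorem the convergence is uniform
on some interval, and increments over any other interval are differences of such. -/
theorem uniform_of_tendsto_increments {h : ℝ → ℝ} (hc : Continuous h)
    (hs : ∀ u, Tendsto (fun t => h (t + u) - h t) atTop (𝓝 0)) {ε : ℝ} (hε : 0 < ε) :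
    ∃ T, ∀ t ≥ T, ∀ u ∈ Icc (0 : ℝ) 1, |h (t + u) - h t| ≤ ε := by
  have hε3 : 0 < ε / 3 := by positivity
  have hs' : ∀ u, ∀ᶠ t in atTop, |h (t + u) - h t| ≤ ε / 3 := fun u => by
    have := (hs u).abs
    rw [abs_zero] at this
    exact (this.eventually (gt_mem_nhds hε3)).mono fun t ht => ht.le
  let F : ℕ → Set ℝ := fun n => {u | ∀ t : ℝ, (n : ℝ) ≤ t → |h (t + u) - h t| ≤ ε / 3}
  have hF : ∀ n, IsClosed (F n) := fun n => by
    simp only [F, ofPred_forall]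
    refine isClosed_iInter fun t => isClosed_iInter fun _ => ?_
    exact isClosed_le (by fun_prop) continuous_const
  have hU : ⋃ n, F n = univ := by
    refine eq_univ_of_forall fun u => ?_
    obtain ⟨T, hT⟩ := eventually_atTop.1 (hs' u)
    obtain ⟨n, hn⟩ := exists_nat_ge T
    exact mem_iUnion.2 ⟨n, fun t ht => hT t (hn.trans ht)⟩
  obtain ⟨n, a, ha⟩ := nonempty_interior_of_iUnion_of_closed hF hU
  obtain ⟨δ, hδ, hball⟩ := Metric.mem_nhds_iff.1 (mem_interior_iff_mem_nhds.1 ha)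
  have haF : a ∈ F n := interior_subset ha
  have key : ∀ u₀ : ℝ, ∃ T, ∀ t ≥ T, ∀ u ∈ Metric.ball u₀ δ, |h (t + u) - h t| ≤ ε := fun u₀ => by
    obtain ⟨T, hT⟩ := eventually_atTop.1 (hs' u₀)
    refine ⟨max T (n + a - u₀), fun t ht u hu => ?_⟩
    have h1 : |h (t + u₀) - h t| ≤ ε / 3 := hT t ((le_max_left _ _).trans ht)
    have ht2 : (n : ℝ) ≤ t + u₀ - a := by linarith [(le_max_right _ _).trans ht]
    have h2 := haF _ ht2
    have h3 : |h (t + u₀ - a + (a + (u - u₀))) - h (t + u₀ - a)| ≤ ε / 3 := by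
      refine hball ?_ _ ht2
      simpa [Real.dist_eq] using hu
    have e1 : t + u₀ - a + (a + (u - u₀)) = t + u := by ring
    have e2 : t + u₀ - a + a = t + u₀ := by ring
    rw [e1] at h3
    rw [e2] at h2
    rw [abs_le] at *
    constructor <;> linarith [h1.1, h1.2, h2.1, h2.2, h3.1, h3.2]
  choose T hT using key
  obtain ⟨s, hs⟩ := (isCompact_Icc (a := (0 : ℝ)) (b := 1)).elim_finite_subcover
    (fun u₀ : ℝ => Metric.ball u₀ δ) (fun _ => Metric.isOpen_ball)
    (fun u _ => mem_iUnion.2 ⟨u, Metric.mem_ball_self hδ⟩)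
  refine ⟨∑ u₀ ∈ s, |T u₀|, fun t ht u hu => ?_⟩
  obtain ⟨u₀, hu₀, hu'⟩ := mem_iUnion₂.1 (hs hu)
  refine hT u₀ t ?_ u hu'
  exact (le_abs_self _).trans
    ((Finset.single_le_sum (f := fun u => |T u|) (fun _ _ => abs_nonneg _) hu₀).trans ht)

/-- An increment over `[t, t + u]` is a sum of at most `1 + u` increments over intervals of length at
most `1`. -/
theorem increments_le_of_uniform {h : ℝ → ℝ} {ε T : ℝ} (hε : 0 ≤ ε)
    (hT : ∀ t ≥ T, ∀ u ∈ Icc (0 : ℝ) 1, |h (t + u) - h t| ≤ ε) :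
    ∀ t ≥ T, ∀ u, 0 ≤ u → |h (t + u) - h t| ≤ ε * (1 + u) := by
  intro t ht u hu
  have hn : ∀ n : ℕ, |h (t + n) - h t| ≤ ε * n := fun n => by
    induction n with
    | zero => simp
    | succ k ih =>
      have h1 := hT (t + k) (by linarith [(Nat.cast_nonneg k : (0 : ℝ) ≤ k)]) 1 ⟨zero_le_one, le_rfl⟩
      have e : t + ((k + 1 : ℕ) : ℝ) = t + k + 1 := by push_cast; ring
      rw [e]
      have := abs_add_le (h (t + k + 1) - h (t + k)) (h (t + k) - h t)
      rw [sub_add_sub_cancel] at this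
      push_cast
      linarith
  have h1 := hn ⌊u⌋₊
  have h2 := hT (t + ⌊u⌋₊) (by linarith [(Nat.cast_nonneg ⌊u⌋₊ : (0 : ℝ) ≤ _)]) (u - ⌊u⌋₊)
    ⟨by linarith [Nat.floor_le hu], by linarith [Nat.lt_floor_add_one u]⟩
  have e : t + (⌊u⌋₊ : ℝ) + (u - ⌊u⌋₊) = t + u := by ring
  rw [e] at h2
  have := abs_add_le (h (t + u) - h (t + ⌊u⌋₊)) (h (t + ⌊u⌋₊) - h t)
  rw [sub_add_sub_cancel] at this
  have := mul_le_mul_of_nonneg_left (Nat.floor_le hu) hε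
  linarith

/-- Potter's bounds for a slowly varying function. -/
theorem potter_bounds {m : ℝ → ℝ} {R₀ : ℝ} (hc : ContinuousOn m (Ici R₀)) (hR₀ : 0 < R₀)
    (hpos : ∀ r ≥ R₀, 0 < m r)
    (hm : ∀ a, 0 < a → Tendsto (fun r => m (a * r) / m r) atTop (𝓝 1)) {δ : ℝ} (hδ : 0 < δ) :
    ∃ R ≥ R₀, ∀ r ≥ R, ∀ a, 1 ≤ a →
      m (a * r) ≤ Real.exp δ * a ^ δ * m r ∧ m r ≤ Real.exp δ * a ^ δ * m (a * r) := by
  let h : ℝ → ℝ := fun t => Real.log (m (max (Real.exp t) R₀))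
  have hcont : Continuous h := by
    refine continuous_iff_continuousAt.2 fun t => ?_
    have h1 : Continuous fun t => m (max (Real.exp t) R₀) :=
      hc.comp_continuous (by fun_prop) fun t => mem_Ici.2 (le_max_right _ _)
    exact h1.continuousAt.log (hpos _ (le_max_right _ _)).ne'
  have hval : ∀ r ≥ R₀, h (Real.log r) = Real.log (m r) := fun r hr => by
    simp only [h]
    rw [Real.exp_log (hR₀.trans_le hr), max_eq_left hr]
  have hlim : ∀ u, Tendsto (fun t => h (t + u) - h t) atTop (𝓝 0) := fun u => by
    have h1 := ((hm (Real.exp u) (Real.exp_pos u)).comp Real.tendsto_exp_atTop).log one_ne_zero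
    rw [Real.log_one] at h1
    refine h1.congr' ?_
    filter_upwards [eventually_ge_atTop (Real.log R₀), eventually_ge_atTop (Real.log R₀ - u)]
      with t ht ht'
    have e1 : R₀ ≤ Real.exp t := (Real.log_le_iff_le_exp hR₀).1 ht
    have e2 : R₀ ≤ Real.exp (t + u) := (Real.log_le_iff_le_exp hR₀).1 (by linarith)
    simp only [Function.comp, h]
    rw [max_eq_left e1, max_eq_left e2, ← Real.exp_add, add_comm u t,
      Real.log_div (hpos _ e2).ne' (hpos _ e1).ne']
  obtain ⟨T, hT⟩ := uniform_of_tendsto_increments hcont hlim hδ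
  have hT' := increments_le_of_uniform hδ.le hT
  refine ⟨max R₀ (Real.exp T), le_max_left _ _, fun r hr a ha => ?_⟩
  have hr0 : R₀ ≤ r := (le_max_left _ _).trans hr
  have hrp : 0 < r := hR₀.trans_le hr0
  have hap : 0 < a := zero_lt_one.trans_le ha
  have har : R₀ ≤ a * r := hr0.trans (le_mul_of_one_le_left hrp.le ha)
  have h1 := hT' (Real.log r) ((Real.le_log_iff_exp_le hrp).2 ((le_max_right _ _).trans hr))
    (Real.log a) (Real.log_nonneg ha)
  rw [add_comm (Real.log r), ← Real.log_mul hap.ne' hrp.ne', hval _ har, hval _ hr0, abs_le] at h1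
  have ea : Real.exp δ * a ^ δ = Real.exp (δ * (1 + Real.log a)) := by
    rw [Real.rpow_def_of_pos hap, ← Real.exp_add]
    ring_nf
  have p1 := hpos _ har
  have p2 := hpos _ hr0
  rw [ea]
  constructor
  · rw [← Real.log_le_log_iff p1 (by positivity), Real.log_mul (Real.exp_pos _).ne' p2.ne',
      Real.log_exp]
    linarith
  · rw [← Real.log_le_log_iff p2 (by positivity), Real.log_mul (Real.exp_pos _).ne' p1.ne',
      Real.log_exp]
    linarith

/-! ### A continuity criterion of Kolmogorov type -/

/-- The hat function `t ↦ (1 - |t|)₊`. -/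
def hat (t : ℝ) : ℝ := max 0 (1 - |t|)

theorem continuous_hat : Continuous hat := by unfold hat; fun_prop

theorem hat_nonneg (t : ℝ) : 0 ≤ hat t := le_max_left _ _

theorem abs_lt_one_of_hat_ne_zero {t : ℝ} (h : hat t ≠ 0) : |t| < 1 := by
  by_contra hc
  exact h (max_eq_left (by linarith))

/-- The integer translates of the hat function form a partition of unity. -/
theorem sum_hat {t : ℝ} {N : ℕ} (ht : |t| ≤ N) :
    ∑ k ∈ Finset.Icc (-(N : ℤ)) N, hat (t - k) = 1 := by
  have hfl := Int.floor_le t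
  have hlt := Int.lt_floor_add_one t
  rw [abs_le] at ht
  have hfl1 : -(N : ℤ) ≤ ⌊t⌋ := Int.le_floor.2 (by push_cast; exact ht.1)
  have hfl2 : ⌊t⌋ ≤ (N : ℤ) := by
    have : (⌊t⌋ : ℝ) ≤ ((N : ℤ) : ℝ) := by push_cast; linarith
    exact_mod_cast this
  have h0 : hat (t - ⌊t⌋) = 1 - (t - ⌊t⌋) := by
    rw [hat, abs_of_nonneg (by linarith), max_eq_right (by linarith)]
  have h1 : hat (t - (⌊t⌋ + 1 : ℤ)) = t - ⌊t⌋ := by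
    push_cast
    rw [hat, abs_of_nonpos (by linarith), max_eq_right (by linarith)]
    ring
  have hz : ∀ k : ℤ, k ≠ ⌊t⌋ → k ≠ ⌊t⌋ + 1 → hat (t - k) = 0 := fun k hk hk' => by
    by_contra hne
    have := abs_lt.1 (abs_lt_one_of_hat_ne_zero hne)
    have a1 : (k : ℝ) < ((⌊t⌋ + 2 : ℤ) : ℝ) := by push_cast; linarith [this.1]
    have a2 : ((⌊t⌋ - 1 : ℤ) : ℝ) < (k : ℝ) := by push_cast; linarith [this.2]
    have b1 : k < ⌊t⌋ + 2 := by exact_mod_cast a1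
    have b2 : ⌊t⌋ - 1 < k := by exact_mod_cast a2
    omega
  by_cases hN : ⌊t⌋ + 1 ≤ (N : ℤ)
  · rw [Finset.sum_eq_add_of_mem ⌊t⌋ (⌊t⌋ + 1) (Finset.mem_Icc.2 ⟨hfl1, hfl2⟩)
      (Finset.mem_Icc.2 ⟨by omega, hN⟩) (by omega) (fun k _ hk => hz k hk.1 hk.2), h0, h1]
    ring
  · have e : ⌊t⌋ = (N : ℤ) := by omega
    have e' : (⌊t⌋ : ℝ) = N := by rw [e]; simp
    rw [Finset.sum_eq_single_of_mem ⌊t⌋ (Finset.mem_Icc.2 ⟨hfl1, hfl2⟩)]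
    · rw [h0]; linarith
    · intro k hk hk'
      refine hz k hk' ?_
      have := (Finset.mem_Icc.1 hk).2
      omega

/-- Indices of the grid points of mesh `4⁻ⁿ` in the cube of side `2 n` around the origin. -/
def gridIndex (d n : ℕ) : Finset (Fin d → ℤ) :=
  Fintype.piFinset fun _ => Finset.Icc (-((n * 4 ^ n : ℕ) : ℤ)) ((n * 4 ^ n : ℕ) : ℤ)

/-- The grid point of mesh `4⁻ⁿ` with index `k`. -/
def gridPoint {d : ℕ} (n : ℕ) (k : Fin d → ℤ) : EuclideanSpace ℝ (Fin d) :=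
  WithLp.toLp 2 fun j => (k j : ℝ) / 4 ^ n

/-- The tensor product of hat functions centred at the grid point with index `k`. -/
def gridWeight {d : ℕ} (n : ℕ) (k : Fin d → ℤ) (x : EuclideanSpace ℝ (Fin d)) : ℝ :=
  ∏ j, hat (4 ^ n * x j - k j)

theorem continuous_gridWeight {d : ℕ} (n : ℕ) (k : Fin d → ℤ) :
    Continuous (gridWeight n k) := by
  unfold gridWeight
  refine continuous_finsetProd _ fun j _ => continuous_hat.comp ?_
  fun_prop

theorem gridWeight_nonneg {d : ℕ} (n : ℕ) (k : Fin d → ℤ) (x : EuclideanSpace ℝ (Fin d)) :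
    0 ≤ gridWeight n k x := Finset.prod_nonneg fun _ _ => hat_nonneg _

theorem abs_coord_le_norm {d : ℕ} (x : EuclideanSpace ℝ (Fin d)) (j : Fin d) : |x j| ≤ ‖x‖ :=
  PiLp.norm_apply_le x j

theorem norm_le_card_mul {d : ℕ} {x : EuclideanSpace ℝ (Fin d)} {c : ℝ} (h : ∀ j, |x j| ≤ c) :
    ‖x‖ ≤ d * c := by
  have hx : x = ∑ j, x j • EuclideanSpace.single j (1 : ℝ) := by
    ext i
    simp [Finset.sum_apply, Pi.single_apply]
  rw [hx]
  refine (norm_sum_le _ _).trans ?_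
  calc ∑ j, ‖x j • EuclideanSpace.single j (1 : ℝ)‖ ≤ ∑ _j : Fin d, c :=
        Finset.sum_le_sum fun j _ => by rw [norm_smul]; simpa using h j
    _ = d * c := by simp

theorem sum_gridWeight {d n : ℕ} {x : EuclideanSpace ℝ (Fin d)} (hx : ‖x‖ ≤ n) :
    ∑ k ∈ gridIndex d n, gridWeight n k x = 1 := by
  unfold gridIndex gridWeight
  rw [← Finset.prod_univ_sum (fun _ : Fin d => Finset.Icc (-((n * 4 ^ n : ℕ) : ℤ))
    ((n * 4 ^ n : ℕ) : ℤ)) (fun j (k : ℤ) => hat (4 ^ n * x j - k))]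
  refine Finset.prod_eq_one fun j _ => sum_hat ?_
  rw [abs_mul, abs_of_nonneg (by positivity : (0 : ℝ) ≤ 4 ^ n)]
  push_cast
  rw [mul_comm]
  exact mul_le_mul_of_nonneg_right ((abs_coord_le_norm x j).trans hx) (by positivity)

theorem norm_sub_gridPoint_le {d n : ℕ} {k : Fin d → ℤ} {x : EuclideanSpace ℝ (Fin d)}
    (h : gridWeight n k x ≠ 0) : ‖x - gridPoint n k‖ ≤ d * (1 / 4) ^ n := by
  refine norm_le_card_mul fun j => ?_
  have h1 := abs_lt_one_of_hat_ne_zero (Finset.prod_ne_zero_iff.1 h j (Finset.mem_univ j))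
  have e : (x - gridPoint n k) j = (4 ^ n * x j - k j) * (1 / 4) ^ n := by
    have h4 : (4 : ℝ) ^ n * (1 / 4) ^ n = 1 := by rw [← mul_pow]; norm_num
    have h5 : (k j : ℝ) / 4 ^ n = k j * (1 / 4) ^ n := by rw [one_div, inv_pow, div_eq_mul_inv]
    simp only [gridPoint, PiLp.sub_apply]
    rw [h5]
    linear_combination (-x j) * h4
  rw [e, abs_mul, abs_of_nonneg (by positivity : (0 : ℝ) ≤ (1 / 4) ^ n)]
  exact mul_le_of_le_one_left (by positivity) h1.le

theorem card_gridIndex_le (d n : ℕ) : (gridIndex d n).card ≤ (3 * 8 ^ n) ^ d := by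
  unfold gridIndex
  rw [Fintype.card_piFinset]
  simp only [Int.card_Icc, Finset.prod_const, Finset.card_univ, Fintype.card_fin]
  refine Nat.pow_le_pow_left ?_ d
  have h1 : n * 4 ^ n ≤ 8 ^ n := by
    calc n * 4 ^ n ≤ 2 ^ n * 4 ^ n := Nat.mul_le_mul_right _ Nat.lt_two_pow_self.le
      _ = 8 ^ n := by rw [← mul_pow]; norm_num
  have h2 : 1 ≤ 8 ^ n := Nat.one_le_pow _ _ (by norm_num)
  omega

/-- If the increments of a process have moments of order `6 d + 1` dominated by the distance, then
along families of `O(64 ^ (d n))` pairs at distance `O(4⁻ⁿ)` they are almost surely `O(2⁻ⁿ)`. -/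
theorem ae_increments_le {d : ℕ} {T Ω : Type*} [PseudoMetricSpace T] [MeasurableSpace Ω]
    {P : Measure Ω} {X : T → Ω → ℝ} (hX : ∀ x, Measurable (X x)) {C : ℝ}
    (hmom : ∀ x y, ∫⁻ ω, ‖X x ω - X y ω‖ₑ ^ (6 * d + 1) ∂P
      ≤ ENNReal.ofReal (C * dist x y ^ (6 * d + 1)))
    (A : ℕ → Finset (T × T)) {B D : ℝ} (hB : 0 ≤ B)
    (hcard : ∀ n, ((A n).card : ℝ) ≤ B * 64 ^ (d * n))
    (hclose : ∀ n, ∀ z ∈ A n, dist z.1 z.2 ≤ D * (1 / 4) ^ n) :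
    ∀ᵐ ω ∂P, ∃ c : ℝ, 0 ≤ c ∧ ∀ n, ∀ z ∈ A n, |X z.1 ω - X z.2 ω| ≤ c * (1 / 2) ^ n := by
  set p := 6 * d + 1 with hp
  let S : Ω → ℝ≥0∞ := fun ω => ∑' n, ∑ z ∈ A n, (2 ^ n) ^ p * ‖X z.1 ω - X z.2 ω‖ₑ ^ p
  have hmeas : ∀ z : T × T, Measurable fun ω => ‖X z.1 ω - X z.2 ω‖ₑ ^ p := fun z =>
    ((hX z.1).sub (hX z.2)).enorm.pow_const p
  have hS : Measurable S := Measurable.tsum fun n =>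
    Finset.measurable_sum _ fun z _ => (hmeas z).const_mul _
  have hint : ∫⁻ ω, S ω ∂P ≤ ∑' n : ℕ, ENNReal.ofReal (B * |C| * |D| ^ p * (1 / 2) ^ n) := by
    rw [lintegral_tsum fun n => (Finset.measurable_sum _ fun z _ =>
      (hmeas z).const_mul _).aemeasurable]
    refine ENNReal.tsum_le_tsum fun n => ?_
    rw [lintegral_finsetSum _ fun z _ => (hmeas z).const_mul _]
    have hterm : ∀ z ∈ A n, ∫⁻ ω, (2 ^ n) ^ p * ‖X z.1 ω - X z.2 ω‖ₑ ^ p ∂P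
        ≤ ENNReal.ofReal ((2 ^ n) ^ p * (|C| * (|D| * (1 / 4) ^ n) ^ p)) := fun z hz => by
      rw [lintegral_const_mul _ (hmeas z), ENNReal.ofReal_mul (by positivity)]
      have e : ((2 : ℝ≥0∞) ^ n) ^ p = ENNReal.ofReal ((2 ^ n) ^ p) := by
        rw [ENNReal.ofReal_pow (by positivity), ENNReal.ofReal_pow (by positivity)]
        simp
      rw [e]
      refine mul_le_mul_right ((hmom z.1 z.2).trans (ENNReal.ofReal_le_ofReal ?_)) _
      have h1 : dist z.1 z.2 ≤ |D| * (1 / 4) ^ n :=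
        (hclose n z hz).trans (mul_le_mul_of_nonneg_right (le_abs_self D) (by positivity))
      calc C * dist z.1 z.2 ^ p ≤ |C| * dist z.1 z.2 ^ p :=
            mul_le_mul_of_nonneg_right (le_abs_self C) (by positivity)
        _ ≤ _ := by gcongr
    refine (Finset.sum_le_sum hterm).trans ?_
    rw [Finset.sum_const, nsmul_eq_mul, ← ENNReal.ofReal_natCast, ← ENNReal.ofReal_mul (by positivity)]
    refine ENNReal.ofReal_le_ofReal ?_
    calc ((A n).card : ℝ) * ((2 ^ n) ^ p * (|C| * (|D| * (1 / 4) ^ n) ^ p))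
        ≤ (B * 64 ^ (d * n)) * ((2 ^ n) ^ p * (|C| * (|D| * (1 / 4) ^ n) ^ p)) :=
          mul_le_mul_of_nonneg_right (hcard n) (by positivity)
      _ = B * |C| * |D| ^ p * (64 ^ (d * n) * ((2 ^ n) ^ p * ((1 / 4) ^ n) ^ p)) := by ring
      _ = B * |C| * |D| ^ p * (1 / 2) ^ n := by
          congr 1
          have e1 : ((2 : ℝ) ^ n) ^ p * ((1 / 4) ^ n) ^ p = (1 / 2) ^ (n * p) := by
            rw [← mul_pow, ← mul_pow, ← pow_mul]; norm_num
          have e2 : (64 : ℝ) ^ (d * n) = 2 ^ (6 * (d * n)) := by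
            rw [pow_mul 2 6]; norm_num
          rw [e1, e2, hp, mul_add, mul_one, pow_add, ← mul_assoc,
            show n * (6 * d) = 6 * (d * n) by ring, ← mul_pow]
          norm_num
  have hfin : ∫⁻ ω, S ω ∂P ≠ ⊤ := by
    refine ne_top_of_le_ne_top ?_ hint
    have hsum : Summable fun n : ℕ => B * |C| * |D| ^ p * (1 / 2 : ℝ) ^ n :=
      summable_geometric_two.mul_left _
    rw [← ENNReal.ofReal_tsum_of_nonneg (fun n => by positivity) hsum]
    exact ENNReal.ofReal_ne_top
  filter_upwards [ae_lt_top hS hfin] with ω hω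
  have hroot : S ω ^ ((p : ℝ)⁻¹) ≠ ⊤ := ENNReal.rpow_ne_top_of_nonneg (by positivity) hω.ne
  refine ⟨(S ω ^ ((p : ℝ)⁻¹)).toReal, ENNReal.toReal_nonneg, fun n z hz => ?_⟩
  have h1 : (2 ^ n) ^ p * ‖X z.1 ω - X z.2 ω‖ₑ ^ p ≤ S ω :=
    (Finset.single_le_sum (f := fun z => (2 ^ n) ^ p * ‖X z.1 ω - X z.2 ω‖ₑ ^ p)
      (fun _ _ => zero_le) hz).trans
      (ENNReal.le_tsum (f := fun n => ∑ z ∈ A n, (2 ^ n) ^ p * ‖X z.1 ω - X z.2 ω‖ₑ ^ p) n)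
  rw [← mul_pow, ← ENNReal.rpow_natCast] at h1
  have hp0 : 0 < (p : ℝ) := by rw [hp]; positivity
  have h2 := (ENNReal.le_rpow_inv_iff hp0).2 h1
  have h3 := ENNReal.toReal_mono hroot h2
  rw [ENNReal.toReal_mul, ENNReal.toReal_pow, toReal_enorm, Real.norm_eq_abs] at h3
  have h4 : (0 : ℝ) < 2 ^ n := by positivity
  rw [one_div, inv_pow, ← div_eq_mul_inv, le_div_iff₀ h4, mul_comm]
  simpa using h3

theorem abs_sum_mul_le {ι : Type*} {s : Finset ι} {w a : ι → ℝ} {c : ℝ} (hw : ∀ i ∈ s, 0 ≤ w i)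
    (hsum : ∑ i ∈ s, w i = 1) (ha : ∀ i ∈ s, w i ≠ 0 → |a i| ≤ c) :
    |∑ i ∈ s, w i * a i| ≤ c := by
  calc |∑ i ∈ s, w i * a i| ≤ ∑ i ∈ s, |w i * a i| := Finset.abs_sum_le_sum_abs _ _
    _ ≤ ∑ i ∈ s, w i * c := Finset.sum_le_sum fun i hi => by
        rw [abs_mul, abs_of_nonneg (hw i hi)]
        by_cases h : w i = 0
        · simp [h]
        · exact mul_le_mul_of_nonneg_left (ha i hi h) (hw i hi)
    _ = c := by rw [← Finset.sum_mul, hsum, one_mul]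

/-- A version of Kolmogorov's continuity theorem. The continuous modification is the limit of the
multilinear interpolations of the process on grids of mesh `4⁻ⁿ`. -/
theorem exists_continuous_modification {d : ℕ} {Ω : Type*} [MeasurableSpace Ω] {P : Measure Ω}
    {X : EuclideanSpace ℝ (Fin d) → Ω → ℝ} (hX : ∀ x, Measurable (X x)) {C : ℝ}
    (hmom : ∀ x y, ∫⁻ ω, ‖X x ω - X y ω‖ₑ ^ (6 * d + 1) ∂P
      ≤ ENNReal.ofReal (C * dist x y ^ (6 * d + 1))) :
    ∃ Y : EuclideanSpace ℝ (Fin d) → Ω → ℝ, (∀ x, Y x =ᵐ[P] X x) ∧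
      ∀ᵐ ω ∂P, Continuous fun x => Y x ω := by
  let Z : ℕ → EuclideanSpace ℝ (Fin d) → Ω → ℝ := fun n x ω =>
    ∑ k ∈ gridIndex d n, gridWeight n k x * X (gridPoint n k) ω
  have hZcont : ∀ n ω, Continuous fun x => Z n x ω := fun n ω =>
    continuous_finsetSum _ fun k _ => (continuous_gridWeight n k).mul continuous_const
  let Y : EuclideanSpace ℝ (Fin d) → Ω → ℝ := fun x ω => limUnder atTop fun n => Z n x ω
  refine ⟨Y, fun x => ?_, ?_⟩
  · -- The interpolations at `x` also converge to `X x` itself.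
    let A : ℕ → Finset (EuclideanSpace ℝ (Fin d) × EuclideanSpace ℝ (Fin d)) := fun n =>
      ((gridIndex d n).filter fun k => dist (gridPoint n k) x ≤ d * (1 / 4) ^ n).image
        fun k => (gridPoint n k, x)
    have hcard : ∀ n, ((A n).card : ℝ) ≤ 3 ^ d * 64 ^ (d * n) := fun n => by
      have h1 : (A n).card ≤ (3 * 8 ^ n) ^ d :=
        Finset.card_image_le.trans ((Finset.card_filter_le _ _).trans (card_gridIndex_le d n))
      have h2 : (3 * 8 ^ n) ^ d ≤ 3 ^ d * 64 ^ (d * n) := by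
        rw [mul_pow, ← pow_mul, mul_comm n d]
        exact Nat.mul_le_mul_left _ (Nat.pow_le_pow_left (by norm_num) _)
      exact_mod_cast h1.trans h2
    have hclose : ∀ n, ∀ z ∈ A n, dist z.1 z.2 ≤ d * (1 / 4) ^ n := fun n z hz => by
      obtain ⟨k, hk, rfl⟩ := Finset.mem_image.1 hz
      exact (Finset.mem_filter.1 hk).2
    filter_upwards [ae_increments_le (d := d) hX hmom A (by positivity) hcard hclose]
      with ω ⟨c, hc, hω⟩
    refine Tendsto.limUnder_eq ?_
    obtain ⟨N, hN⟩ := exists_nat_ge ‖x‖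
    refine tendsto_iff_dist_tendsto_zero.2 (squeeze_zero' (Eventually.of_forall fun _ => dist_nonneg)
      ?_ (g := fun n => c * (1 / 2) ^ n) ?_)
    · filter_upwards [eventually_ge_atTop N] with n hn
      have hs := sum_gridWeight (n := n) (hN.trans (by exact_mod_cast hn))
      have e : Z n x ω - X x ω
          = ∑ k ∈ gridIndex d n, gridWeight n k x * (X (gridPoint n k) ω - X x ω) := by
        simp only [Z, mul_sub, Finset.sum_sub_distrib]
        rw [← Finset.sum_mul, hs, one_mul]
      rw [Real.dist_eq, e]
      refine abs_sum_mul_le (fun k _ => gridWeight_nonneg n k x) hs fun k hk hne => ?_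
      refine hω n (gridPoint n k, x) (Finset.mem_image.2 ⟨k, Finset.mem_filter.2 ⟨hk, ?_⟩, rfl⟩)
      rw [dist_comm, dist_eq_norm]
      exact norm_sub_gridPoint_le hne
    · simpa using (tendsto_pow_atTop_nhds_zero_of_lt_one (by norm_num : (0 : ℝ) ≤ 1 / 2)
        (by norm_num)).const_mul c
  · let A : ℕ → Finset (EuclideanSpace ℝ (Fin d) × EuclideanSpace ℝ (Fin d)) := fun n =>
      ((gridIndex d n ×ˢ gridIndex d (n + 1)).filter fun k =>
        dist (gridPoint n k.1) (gridPoint (n + 1) k.2) ≤ 2 * d * (1 / 4) ^ n).image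
        fun k => (gridPoint n k.1, gridPoint (n + 1) k.2)
    have hcard : ∀ n, ((A n).card : ℝ) ≤ 72 ^ d * 64 ^ (d * n) := fun n => by
      have h1 : (A n).card ≤ (3 * 8 ^ n) ^ d * (3 * 8 ^ (n + 1)) ^ d := by
        refine Finset.card_image_le.trans ((Finset.card_filter_le _ _).trans ?_)
        rw [Finset.card_product]
        exact Nat.mul_le_mul (card_gridIndex_le d n) (card_gridIndex_le d (n + 1))
      have h2 : (3 * 8 ^ n) ^ d * (3 * 8 ^ (n + 1)) ^ d = 72 ^ d * 64 ^ (d * n) := by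
        rw [← mul_pow, mul_comm d n, pow_mul 64 n d, ← mul_pow,
          show (64 : ℕ) = 8 * 8 by norm_num, mul_pow 8 8 n]
        ring
      exact_mod_cast h1.trans h2.le
    have hclose : ∀ n, ∀ z ∈ A n, dist z.1 z.2 ≤ 2 * d * (1 / 4) ^ n := fun n z hz => by
      obtain ⟨k, hk, rfl⟩ := Finset.mem_image.1 hz
      exact (Finset.mem_filter.1 hk).2
    filter_upwards [ae_increments_le (d := d) hX hmom A (by positivity) hcard hclose]
      with ω ⟨c, hc, hω⟩
    have hstep : ∀ x : EuclideanSpace ℝ (Fin d), ∀ n : ℕ, ‖x‖ ≤ n →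
        dist (Z n x ω) (Z (n + 1) x ω) ≤ c * (1 / 2) ^ n := fun x n hx => by
      have hs := sum_gridWeight (n := n) hx
      have hs' := sum_gridWeight (n := n + 1) (hx.trans (by push_cast; linarith))
      have e : Z n x ω - Z (n + 1) x ω = ∑ k ∈ gridIndex d n ×ˢ gridIndex d (n + 1),
          (gridWeight n k.1 x * gridWeight (n + 1) k.2 x) *
            (X (gridPoint n k.1) ω - X (gridPoint (n + 1) k.2) ω) := by
        simp only [Z, mul_sub, Finset.sum_sub_distrib]
        congr 1
        · rw [Finset.sum_product]
          refine Finset.sum_congr rfl fun k _ => ?_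
          simp only [← Finset.sum_mul, ← Finset.mul_sum, hs', mul_one]
        · rw [Finset.sum_product_right]
          refine Finset.sum_congr rfl fun k _ => ?_
          simp only [← Finset.sum_mul, hs, one_mul]
      rw [Real.dist_eq, e]
      refine abs_sum_mul_le (fun k _ => mul_nonneg (gridWeight_nonneg _ _ x)
        (gridWeight_nonneg _ _ x)) ?_ fun k hk hne => ?_
      · rw [Finset.sum_product]
        simp only [← Finset.mul_sum, hs', mul_one, hs]
      · refine hω n (gridPoint n k.1, gridPoint (n + 1) k.2)
          (Finset.mem_image.2 ⟨k, Finset.mem_filter.2 ⟨hk, ?_⟩, rfl⟩)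
        have h1 := norm_sub_gridPoint_le (left_ne_zero_of_mul hne)
        have h2 := norm_sub_gridPoint_le (right_ne_zero_of_mul hne)
        have h3 : (1 / 4 : ℝ) ^ (n + 1) ≤ (1 / 4) ^ n :=
          pow_le_pow_of_le_one (by norm_num) (by norm_num) (Nat.le_succ n)
        have h4 := dist_triangle (gridPoint n k.1) x (gridPoint (n + 1) k.2)
        rw [dist_comm _ x, dist_eq_norm x, dist_eq_norm x] at h4
        have h5 := mul_le_mul_of_nonneg_left h3 (Nat.cast_nonneg d : (0 : ℝ) ≤ d)
        linarith
    have hgeo : ∀ (N : ℕ) (x : EuclideanSpace ℝ (Fin d)), ‖x‖ ≤ N → ∀ n : ℕ,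
        dist (Z (n + N) x ω) (Z (n + 1 + N) x ω) ≤ c * (1 / 2) ^ n := fun N x hx n => by
      rw [show n + 1 + N = n + N + 1 by ring]
      refine (hstep x (n + N) (hx.trans (by push_cast; linarith [(Nat.cast_nonneg n : (0 : ℝ) ≤ n)]))).trans ?_
      exact mul_le_mul_of_nonneg_left
        (pow_le_pow_of_le_one (by norm_num) (by norm_num) (Nat.le_add_right n N)) hc
    have hlim : ∀ (N : ℕ) (x : EuclideanSpace ℝ (Fin d)), ‖x‖ ≤ N →
        Tendsto (fun n => Z (n + N) x ω) atTop (𝓝 (Y x ω)) := fun N x hx => by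
      have hcs := cauchySeq_of_le_geometric (1 / 2) c (by norm_num) (hgeo N x hx)
      obtain ⟨y, hy⟩ := cauchySeq_tendsto_of_complete hcs
      have hy' : Tendsto (fun n => Z n x ω) atTop (𝓝 y) := (tendsto_add_atTop_iff_nat N).1 hy
      have : Y x ω = y := hy'.limUnder_eq
      rwa [this]
    have hunif : ∀ N : ℕ, TendstoUniformlyOn (fun n x => Z (n + N) x ω) (fun x => Y x ω) atTop
        (Metric.closedBall 0 (N : ℝ)) := fun N => by
      refine Metric.tendstoUniformlyOn_iff.2 fun ε hε => ?_
      have hg : Tendsto (fun n : ℕ => c * (1 / 2 : ℝ) ^ n / (1 - 1 / 2)) atTop (𝓝 0) := by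
        simpa using ((tendsto_pow_atTop_nhds_zero_of_lt_one (by norm_num : (0 : ℝ) ≤ 1 / 2)
          (by norm_num)).const_mul c).div_const (1 - 1 / 2)
      filter_upwards [hg.eventually (gt_mem_nhds hε)] with n hn x hx
      rw [mem_closedBall_zero_iff] at hx
      rw [dist_comm]
      exact (dist_le_of_le_geometric_of_tendsto (1 / 2) c (by norm_num) (hgeo N x hx)
        (hlim N x hx) n).trans_lt hn
    refine continuous_iff_continuousAt.2 fun x => ?_
    obtain ⟨N, hN⟩ := exists_nat_gt ‖x‖
    have hco := (hunif N).continuousOn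
      (Frequently.of_forall fun n => (hZcont (n + N) ω).continuousOn)
    exact hco.continuousAt (Metric.closedBall_mem_nhds_of_mem (by simpa using hN))

/-! ### The isonormal Gaussian process -/

section Isonormal

variable {Ω : Type*} [MeasurableSpace Ω] {P : Measure Ω} [IsProbabilityMeasure P]

theorem norm_integral_exp_sub_le (X Y : Lp ℝ 2 P) (t : ℝ) :
    ‖(∫ ω, Complex.exp (t * X ω * Complex.I) ∂P) - ∫ ω, Complex.exp (t * Y ω * Complex.I) ∂P‖
      ≤ |t| * ‖X - Y‖ := by
  have hm : ∀ Z : Lp ℝ 2 P, Integrable (fun ω => Complex.exp (t * Z ω * Complex.I)) P := fun Z => by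
    refine (integrable_const (1 : ℝ)).mono ?_ (ae_of_all _ fun ω => ?_)
    · have := (Lp.aestronglyMeasurable Z).aemeasurable
      exact AEMeasurable.aestronglyMeasurable (by fun_prop)
    · rw [← Complex.ofReal_mul, Complex.norm_exp_ofReal_mul_I]; simp
  rw [← integral_sub (hm X) (hm Y)]
  have hle : ∀ a b : ℝ, ‖Complex.exp (t * a * Complex.I) - Complex.exp (t * b * Complex.I)‖
      ≤ |t| * |a - b| := fun a b => by
    have e : Complex.exp (t * a * Complex.I) - Complex.exp (t * b * Complex.I)
        = Complex.exp ((t * b : ℝ) * Complex.I)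
          * (Complex.exp (Complex.I * (t * (a - b) : ℝ)) - 1) := by
      rw [mul_sub, ← Complex.exp_add, mul_one]
      push_cast
      ring_nf
    rw [e, norm_mul, Complex.norm_exp_ofReal_mul_I, one_mul]
    refine Real.norm_exp_I_mul_ofReal_sub_one_le.trans ?_
    rw [Real.norm_eq_abs, abs_mul]
  have hXY : MemLp (fun ω => X ω - Y ω) 2 P := (Lp.memLp X).sub (Lp.memLp Y)
  have hint : Integrable (fun ω => X ω - Y ω) P := hXY.integrable (by norm_num)
  calc _ ≤ ∫ ω, |t| * |X ω - Y ω| ∂P :=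
        norm_integral_le_of_norm_le (hint.abs.const_mul _) (ae_of_all _ fun ω => hle _ _)
    _ = |t| * ∫ ω, |X ω - Y ω| ∂P := integral_const_mul _ _
    _ ≤ |t| * ‖X - Y‖ := by
        refine mul_le_mul_of_nonneg_left ?_ (abs_nonneg t)
        have e1 : ∫ ω, |X ω - Y ω| ∂P = (eLpNorm (fun ω => X ω - Y ω) 1 P).toReal := by
          rw [eLpNorm_one_eq_lintegral_enorm, ← integral_norm_eq_lintegral_enorm hint.1]
          rfl
        have e2 : ‖X - Y‖ = (eLpNorm (fun ω => X ω - Y ω) 2 P).toReal := by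
          rw [Lp.norm_def, eLpNorm_congr_ae (Lp.coeFn_sub X Y)]
          rfl
        rw [e1, e2]
        refine ENNReal.toReal_mono hXY.2.ne ?_
        exact eLpNorm_le_eLpNorm_of_exponent_le (by norm_num) hXY.1

/-- The centred Gaussian variables form a closed subset of `L²`. -/
theorem isClosed_setOf_map_eq_gaussianReal :
    IsClosed {X : Lp ℝ 2 P | P.map X = gaussianReal 0 (‖X‖₊ ^ 2)} := by
  have e : {X : Lp ℝ 2 P | P.map X = gaussianReal 0 (‖X‖₊ ^ 2)}
      = {X : Lp ℝ 2 P | ∀ t : ℝ, ∫ ω, Complex.exp (t * X ω * Complex.I) ∂P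
          = Complex.exp (-((‖X‖ : ℂ) ^ 2 * t ^ 2 / 2))} := by
    ext X
    have hX : AEMeasurable X P := (Lp.aestronglyMeasurable X).aemeasurable
    have : IsProbabilityMeasure (P.map X) := Measure.isProbabilityMeasure_map hX
    have hc : ∀ t : ℝ, charFun (P.map X) t = ∫ ω, Complex.exp (t * X ω * Complex.I) ∂P :=
      fun t => by
        rw [charFun_apply_real, integral_map hX (by fun_prop)]
    have hg : ∀ t : ℝ, charFun (gaussianReal 0 (‖X‖₊ ^ 2)) t
        = Complex.exp (-((‖X‖ : ℂ) ^ 2 * t ^ 2 / 2)) := fun t => by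
      rw [charFun_gaussianReal]
      congr 1
      push_cast
      ring
    constructor
    · intro h t
      rw [← hc, h, hg]
    · intro h
      refine Measure.ext_of_charFun (funext fun t => ?_)
      rw [hc, hg, h]
  rw [e, ofPred_forall]
  refine isClosed_iInter fun t => isClosed_eq ?_ (by fun_prop)
  refine (LipschitzWith.of_dist_le_mul (K := ‖t‖₊) fun X Y => ?_).continuous
  rw [dist_eq_norm, dist_eq_norm]
  exact norm_integral_exp_sub_le X Y t

end Isonormal

theorem hasGaussianLaw_map_eq {Ω : Type*} [MeasurableSpace Ω] {P : Measure Ω}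
    {X : Lp ℝ 2 P} (h : HasGaussianLaw X P) (h0 : ∫ ω, X ω ∂P = 0) :
    P.map X = gaussianReal 0 (‖X‖₊ ^ 2) := by
  rw [h.map_eq_gaussianReal, h0]
  congr 1
  rw [variance_of_integral_eq_zero h.aemeasurable h0]
  have e : ∫ ω, (X ω) ^ 2 ∂P = ‖X‖ ^ 2 := by
    rw [← real_inner_self_eq_norm_sq, L2.inner_def]
    refine integral_congr_ae (ae_of_all _ fun ω => ?_)
    simp [sq]
  rw [e]
  ext
  simp

/-- Every real Hilbert space `H` carries an isonormal process: a linear isometry from `H` into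
the centred Gaussian variables of some probability space. -/
theorem exists_isonormal (H : Type) [NormedAddCommGroup H] [InnerProductSpace ℝ H]
    [CompleteSpace H] :
    ∃ (Ω : Type) (_ : MeasurableSpace Ω) (P : Measure Ω) (_ : IsProbabilityMeasure P)
      (V : H →ₗᵢ[ℝ] Lp ℝ 2 P), ∀ h, P.map (V h) = gaussianReal 0 (‖h‖₊ ^ 2) := by
  obtain ⟨w, b, -⟩ := exists_hilbertBasis ℝ H
  let P : Measure (w → ℝ) := Measure.infinitePi fun _ : w => gaussianReal 0 1
  have hmp : ∀ i : w, MeasurePreserving (fun ω : w → ℝ => ω i) P (gaussianReal 0 1) := fun i =>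
    measurePreserving_eval_infinitePi _ i
  have hlp : ∀ i : w, MemLp (fun ω : w → ℝ => ω i) 2 P := fun i =>
    (memLp_id_gaussianReal' 2 (by simp)).comp_measurePreserving (hmp i)
  have hmean : ∀ i : w, ∫ ω, ω i ∂P = 0 := fun i => by
    have h1 := integral_map (hmp i).aemeasurable (f := fun x : ℝ => x) (by fun_prop)
    rw [(hmp i).map_eq, integral_id_gaussianReal] at h1
    exact h1.symm
  have hind : iIndepFun (fun (i : w) (ω : w → ℝ) => ω i) P :=
    iIndepFun_infinitePi (X := fun _ ω => ω) (by fun_prop)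
  let ξ : w → Lp ℝ 2 P := fun i => (hlp i).toLp
  have hξ : ∀ i, ξ i =ᵐ[P] fun ω => ω i := fun i => (hlp i).coeFn_toLp
  have hortho : Orthonormal ℝ ξ := by
    classical
    rw [orthonormal_iff_ite]
    intro i j
    have e : ⟪ξ i, ξ j⟫ = ∫ ω, ω i * ω j ∂P := by
      rw [L2.inner_def]
      refine integral_congr_ae ?_
      filter_upwards [hξ i, hξ j] with ω h1 h2
      simp [h1, h2, mul_comm]
    rw [e]
    split_ifs with hij
    · subst hij
      have h1 : ∫ ω, ω i * ω i ∂P = ∫ x, x * x ∂(gaussianReal 0 1) := by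
        rw [← (hmp i).map_eq, integral_map (hmp i).aemeasurable (by fun_prop)]
      have h2 := variance_of_integral_eq_zero (μ := gaussianReal 0 1) (X := fun x => x)
        aemeasurable_id (by rw [integral_id_gaussianReal])
      rw [variance_fun_id_gaussianReal] at h2
      rw [h1]
      simp only [← sq]
      exact_mod_cast h2.symm
    · rw [(hind.indepFun hij).integral_fun_mul_eq_mul_integral
        (hlp i).1 (hlp j).1, hmean i,
        zero_mul]
  obtain ⟨V, hVb⟩ : ∃ V : H →ₗᵢ[ℝ] Lp ℝ 2 P, ∀ i, V (b i) = ξ i := by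
    classical
    refine ⟨hortho.orthogonalFamily.linearIsometry.comp b.repr.toLinearIsometry, fun i => ?_⟩
    have h1 := hortho.orthogonalFamily.linearIsometry_apply_single (i := i) (1 : ℝ)
    exact ((congrArg hortho.orthogonalFamily.linearIsometry (b.repr_self i)).trans h1).trans
      (by simp)
  refine ⟨w → ℝ, inferInstance, P, inferInstance, V, ?_⟩
  have hclosed : IsClosed {h : H | P.map (V h) = gaussianReal 0 (‖h‖₊ ^ 2)} := by
    convert! (isClosed_setOf_map_eq_gaussianReal (P := P)).preimage V.continuous using 1
    ext h
    simp
  have hspan : (Submodule.span ℝ (Set.range b) : Set H)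
      ⊆ {h : H | P.map (V h) = gaussianReal 0 (‖h‖₊ ^ 2)} := by
    intro h hh
    obtain ⟨c, rfl⟩ := (Finsupp.mem_span_range_iff_exists_finsupp).1 hh
    rw [mem_ofPred_eq, ← V.nnnorm_map]
    have hae : V (c.sum fun i a => a • b i) =ᵐ[P] fun ω => ∑ i ∈ c.support, c i * ω i := by
      rw [Finsupp.sum, map_sum]
      simp only [map_smul, hVb]
      refine (Lp.coeFn_finsetSum _ _).trans ?_
      have : ∀ i ∈ c.support, (c i • ξ i : Lp ℝ 2 P) =ᵐ[P] fun ω => c i * ω i := fun i _ => by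
        filter_upwards [Lp.coeFn_smul (c i) (ξ i), hξ i] with ω h1 h2
        rw [h1, Pi.smul_apply, h2, smul_eq_mul]
      filter_upwards [(Finset.eventually_all c.support).2 this] with ω hω
      rw [Finset.sum_apply]
      exact Finset.sum_congr rfl hω
    refine hasGaussianLaw_map_eq ?_ ?_
    · have hg : HasGaussianLaw (fun (ω : w → ℝ) (i : c.support) => ω i) P :=
        (hind.precomp Subtype.val_injective).hasGaussianLaw fun i => by
          refine ⟨?_⟩
          rw [(hmp i).map_eq]
          infer_instance
      refine HasGaussianLaw.congr ?_ hae.symm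
      convert! hg.map (∑ i : c.support, c i • ContinuousLinearMap.proj (R := ℝ)
        (φ := fun _ : c.support => ℝ) i) using 1
      ext ω
      simp [← Finset.sum_coe_sort c.support]
    · rw [integral_congr_ae hae, integral_finsetSum _ fun i _ => ?_]
      · simp [integral_const_mul, hmean]
      · exact ((hlp i).integrable (by norm_num)).const_mul _
  have hd : Dense (Submodule.span ℝ (Set.range b) : Set H) :=
    Submodule.dense_iff_topologicalClosure_eq_top.2 b.dense_span
  intro h
  exact hclosed.closure_subset_iff.2 hspan (hd h)

/-! ### Gaussian fields with continuous and `C¹` sample paths -/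

theorem charFunDual_map_restrict {T Ω : Type*} [MeasurableSpace Ω] {h : T → Ω → ℝ} {P : Measure Ω}
    (hh : IsGaussianProcess h P) (h0 : ∀ x, ∫ ω, h x ω ∂P = 0) (I : Finset T) [DecidableEq I]
    (L : StrongDual ℝ (I → ℝ)) :
    charFunDual (P.map fun ω => I.restrict (fun x => h x ω)) L = Complex.exp
      (-((∑ i : I, ∑ j : I, L (Pi.single i 1) * L (Pi.single j 1) * ∫ ω, h i ω * h j ω ∂P : ℝ)
        : ℂ) / 2) := by
  have hL : ∀ ω, L (I.restrict fun x => h x ω) = ∑ i : I, L (Pi.single i 1) * h i ω := fun ω => by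
    have e : (I.restrict fun x => h x ω) = ∑ i : I, h i ω • (Pi.single i (1 : ℝ) : I → ℝ) := by
      ext j
      simp [Finset.sum_apply, Pi.single_apply]
    rw [e, map_sum]
    simp [mul_comm]
  have hm : ∀ x, MemLp (h x) 2 P := fun x => (hh.hasGaussianLaw_eval x).memLp_two
  have hprob := hh.isProbabilityMeasure
  have hmean : ∫ ω, L (I.restrict fun x => h x ω) ∂P = 0 := by
    simp only [hL]
    rw [integral_finsetSum _ fun i _ => ((hm i.1).integrable (by norm_num)).const_mul _]
    simp [integral_const_mul, h0]
  have hvar : ∫ ω, (L (I.restrict fun x => h x ω)) ^ 2 ∂P = ∑ i : I, ∑ j : I,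
      L (Pi.single i 1) * L (Pi.single j 1) * ∫ ω, h i ω * h j ω ∂P := by
    have hi : ∀ i j : I, Integrable (fun ω => L (Pi.single i 1) * h i ω *
        (L (Pi.single j 1) * h j ω)) P := fun i j =>
      ((hm i).const_mul _).integrable_mul ((hm j).const_mul _)
    simp only [hL, sq, Finset.sum_mul_sum]
    rw [integral_finsetSum _ fun i _ => integrable_finsetSum _ fun j _ => hi i j]
    refine Finset.sum_congr rfl fun i _ => ?_
    rw [integral_finsetSum _ fun j _ => hi i j]
    refine Finset.sum_congr rfl fun j _ => ?_
    rw [← integral_const_mul]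
    congr 1
    ext ω
    ring
  rw [(hh.hasGaussianLaw I).charFunDual_map_eq_fun L, hmean,
    variance_of_integral_eq_zero ((hh.hasGaussianLaw I).map_fun L).aemeasurable hmean]
  congr 1
  rw [hvar]
  simp only [Complex.ofReal_zero, zero_mul, zero_sub, neg_div]

/-- Two centred Gaussian processes with the same covariance have the same finite-dimensional
distributions. -/
theorem sameLaw_of_covariance_eq {T Ω Ω' : Type*} [MeasurableSpace Ω] [MeasurableSpace Ω']
    {f : T → Ω → ℝ} {g : T → Ω' → ℝ} {P : Measure Ω} {P' : Measure Ω'}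
    (hf : IsGaussianProcess f P) (hg : IsGaussianProcess g P')
    (hf0 : ∀ x, ∫ ω, f x ω ∂P = 0) (hg0 : ∀ x, ∫ ω, g x ω ∂P' = 0)
    (hcov : ∀ x y, ∫ ω, f x ω * f y ω ∂P = ∫ ω, g x ω * g y ω ∂P') : SameLaw f g P P' := by
  classical
  intro I
  have hfI := hf.hasGaussianLaw I
  have hgI := hg.hasGaussianLaw I
  refine ⟨hfI.aemeasurable, hgI.aemeasurable, ?_⟩
  have := hfI.isGaussian_map
  have := hgI.isGaussian_map
  refine Measure.ext_of_charFunDual (funext fun L => ?_)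
  rw [charFunDual_map_restrict hf hf0, charFunDual_map_restrict hg hg0]
  simp only [hcov]

section Field

variable {H Ω : Type*} [NormedAddCommGroup H] [InnerProductSpace ℝ H] [MeasurableSpace Ω]
  {P : Measure Ω} {V : H →ₗᵢ[ℝ] Lp ℝ 2 P}

/-- A family of values of an isonormal process, up to null sets, is a Gaussian process. -/
theorem isGaussianProcess_of_ae_eq (hV : ∀ h, P.map (V h) = gaussianReal 0 (‖h‖₊ ^ 2)) {T : Type*}
    {X : T → Ω → ℝ} {ψ : T → H} (hX : ∀ t, X t =ᵐ[P] V (ψ t)) : IsGaussianProcess X P := by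
  classical
  refine IsGaussianProcess.congr (X := fun t => V (ψ t)) ⟨fun I => ⟨?_⟩⟩ fun t => (hX t).symm
  have hmeas : Measurable fun ω => I.restrict fun t => V (ψ t) ω :=
    measurable_pi_lambda _ fun i => (Lp.stronglyMeasurable (V (ψ i))).measurable
  refine isGaussian_of_map_eq_gaussianReal fun L =>
    ⟨0, ‖∑ i : I, L (Pi.single i 1) • ψ i‖₊ ^ 2, ?_⟩
  rw [Measure.map_map (by fun_prop) hmeas, ← hV]
  refine Measure.map_congr ?_
  rw [map_sum]
  have h1 : ∀ᵐ ω ∂P, ∀ i : I, V (L (Pi.single i 1) • ψ i) ω = L (Pi.single i 1) * V (ψ i) ω := by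
    refine ae_all_iff.2 fun i => ?_
    rw [map_smul]
    filter_upwards [Lp.coeFn_smul (L (Pi.single i 1)) (V (ψ i))] with ω hω
    rw [hω, Pi.smul_apply, smul_eq_mul]
  filter_upwards [h1, Lp.coeFn_finsetSum Finset.univ fun i : I => V (L (Pi.single i 1) • ψ i)]
    with ω hω hs
  have e : (I.restrict fun x => V (ψ x) ω)
      = ∑ i : I, V (ψ i) ω • (Pi.single i (1 : ℝ) : I → ℝ) := by
    ext j
    simp [Finset.sum_apply, Pi.single_apply]
  rw [hs, Function.comp_apply, e, map_sum, Finset.sum_apply]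
  refine Finset.sum_congr rfl fun i _ => ?_
  rw [hω, map_smul, smul_eq_mul, mul_comm]

theorem integral_mul_of_ae_eq {X Y : Ω → ℝ} {g h : H} (hX : X =ᵐ[P] V g) (hY : Y =ᵐ[P] V h) :
    ∫ ω, X ω * Y ω ∂P = ⟪g, h⟫ := by
  rw [← V.inner_map_map, L2.inner_def]
  refine integral_congr_ae ?_
  filter_upwards [hX, hY] with ω h1 h2
  simp [h1, h2, mul_comm]

theorem integral_of_ae_eq (hV : ∀ h, P.map (V h) = gaussianReal 0 (‖h‖₊ ^ 2)) {X : Ω → ℝ} {h : H}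
    (hX : X =ᵐ[P] V h) : ∫ ω, X ω ∂P = 0 := by
  rw [integral_congr_ae hX]
  have h1 := integral_map (Lp.aestronglyMeasurable (V h)).aemeasurable (f := fun x : ℝ => x)
    (by fun_prop)
  rw [hV, integral_id_gaussianReal] at h1
  exact h1.symm

/-- All moments of the increments of an isonormal process are controlled by the distance. -/
theorem exists_moment_bound (hV : ∀ h, P.map (V h) = gaussianReal 0 (‖h‖₊ ^ 2)) (p : ℕ) :
    ∃ M : ℝ, 0 ≤ M ∧ ∀ g h : H, ∫⁻ ω, ‖V g ω - V h ω‖ₑ ^ p ∂P ≤ ENNReal.ofReal (M * ‖g - h‖ ^ p) := by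
  have hfin : ∫⁻ x, ‖x‖ₑ ^ p ∂(gaussianReal 0 1) ≠ ⊤ := by
    rcases eq_or_ne p 0 with rfl | hp
    · simp
    · have := (memLp_id_gaussianReal' (μ := 0) (v := 1) p (by simp)).eLpNorm_lt_top
      have h2 := lintegral_rpow_enorm_lt_top_of_eLpNorm_lt_top (by simpa using hp) (by simp) this
      simpa using h2.ne
  refine ⟨(∫⁻ x, ‖x‖ₑ ^ p ∂(gaussianReal 0 1)).toReal, ENNReal.toReal_nonneg, fun g h => ?_⟩
  have h1 : ∫⁻ ω, ‖V g ω - V h ω‖ₑ ^ p ∂P = ∫⁻ ω, ‖V (g - h) ω‖ₑ ^ p ∂P := by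
    refine lintegral_congr_ae ?_
    rw [map_sub]
    filter_upwards [Lp.coeFn_sub (V g) (V h)] with ω hω
    rw [hω, Pi.sub_apply]
  have h2 : gaussianReal 0 (‖g - h‖₊ ^ 2) = (gaussianReal 0 1).map (‖g - h‖ * ·) := by
    rw [gaussianReal_map_const_mul, mul_zero, mul_one]
    congr 1
  rw [h1, ← lintegral_map (f := fun x : ℝ => ‖x‖ₑ ^ p) (by fun_prop)
    (Lp.stronglyMeasurable (V (g - h))).measurable, hV, h2,
    lintegral_map (by fun_prop) (by fun_prop)]
  simp only [enorm_mul, mul_pow]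
  rw [lintegral_const_mul _ (by fun_prop), mul_comm, ENNReal.ofReal_mul ENNReal.toReal_nonneg,
    ENNReal.ofReal_toReal hfin, enorm_norm, ENNReal.ofReal_pow (norm_nonneg _), ofReal_norm]

/-- A Lipschitz family of values of an isonormal process has a continuous modification. -/
theorem exists_continuous_field (hV : ∀ h, P.map (V h) = gaussianReal 0 (‖h‖₊ ^ 2)) {d : ℕ}
    {ψ : EuclideanSpace ℝ (Fin d) → H} {C : ℝ} (hψ : ∀ x y, ‖ψ x - ψ y‖ ≤ C * ‖x - y‖) :
    ∃ X : EuclideanSpace ℝ (Fin d) → Ω → ℝ, (∀ x, X x =ᵐ[P] V (ψ x)) ∧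
      ∀ᵐ ω ∂P, Continuous fun x => X x ω := by
  obtain ⟨M, hM, hbound⟩ := exists_moment_bound hV (6 * d + 1)
  refine exists_continuous_modification (X := fun x => V (ψ x)) (C := M * C ^ (6 * d + 1))
    (fun x => (Lp.stronglyMeasurable (V (ψ x))).measurable) fun x y => ?_
  refine (hbound (ψ x) (ψ y)).trans (ENNReal.ofReal_le_ofReal ?_)
  rw [mul_assoc, ← mul_pow, dist_eq_norm]
  exact mul_le_mul_of_nonneg_left (pow_le_pow_left₀ (norm_nonneg _) (hψ x y) _) hM

end Field

/-- Riemann sums of a continuous function on `[0, 1]` converge to its integral. -/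
theorem tendsto_riemannSum {f : ℝ → ℝ} (hf : Continuous f) :
    Tendsto (fun n : ℕ => ∑ i ∈ Finset.range (n + 1), ((n : ℝ) + 1)⁻¹ * f (i / ((n : ℝ) + 1))) atTop
      (𝓝 (∫ t in (0 : ℝ)..1, f t)) := by
  have huc := isCompact_Icc.uniformContinuousOn_of_continuous (s := Icc (0 : ℝ) 1) hf.continuousOn
  refine Metric.tendsto_atTop.2 fun ε hε => ?_
  obtain ⟨δ, hδ, hmod⟩ := Metric.uniformContinuousOn_iff.1 huc (ε / 2) (by positivity)
  obtain ⟨N, hN⟩ := exists_nat_gt (1 / δ)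
  refine ⟨N, fun n hn => ?_⟩
  have hn0 : (0 : ℝ) < n + 1 := by positivity
  have hstep : ((n : ℝ) + 1)⁻¹ < δ := by
    rw [inv_lt_comm₀ hn0 hδ, ← one_div]
    have : (N : ℝ) ≤ n := by exact_mod_cast hn
    linarith
  have hsum : ∑ i ∈ Finset.range (n + 1), ∫ t in ((i : ℕ) / ((n : ℝ) + 1))..((i + 1 : ℕ) / ((n : ℝ) + 1)), f t
      = ∫ t in (0 : ℝ)..1, f t := by
    rw [intervalIntegral.sum_integral_adjacent_intervals (a := fun i : ℕ => (i : ℝ) / ((n : ℝ) + 1))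
      fun k _ => hf.intervalIntegrable _ _]
    congr 1
    · simp
    · push_cast; exact div_self hn0.ne'
  rw [← hsum, Real.dist_eq, ← Finset.sum_sub_distrib]
  calc _ ≤ ∑ i ∈ Finset.range (n + 1), ε / 2 * ((n : ℝ) + 1)⁻¹ := by
        refine (Finset.abs_sum_le_sum_abs _ _).trans (Finset.sum_le_sum fun i hi => ?_)
        set a : ℝ := (i : ℕ) / ((n : ℝ) + 1) with ha
        set b : ℝ := ((i + 1 : ℕ) : ℝ) / ((n : ℝ) + 1) with hb
        have hab : b - a = ((n : ℝ) + 1)⁻¹ := by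
          rw [ha, hb, ← sub_div]; push_cast; rw [add_sub_cancel_left, one_div]
        have hle : a ≤ b := by have := inv_pos.2 hn0; linarith
        have ha0 : 0 ≤ a := by positivity
        have hb1 : b ≤ 1 := by
          rw [hb, div_le_one hn0]
          have : i + 1 ≤ n + 1 := Nat.succ_le_of_lt (Finset.mem_range.1 hi)
          exact_mod_cast this
        have e : ((n : ℝ) + 1)⁻¹ * f a - ∫ t in a..b, f t = ∫ t in a..b, (f a - f t) := by
          rw [intervalIntegral.integral_sub (by simp) (hf.intervalIntegrable _ _),
            intervalIntegral.integral_const, hab, smul_eq_mul]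
        rw [e, ← Real.norm_eq_abs]
        have := intervalIntegral.norm_integral_le_of_norm_le_const (f := fun t => f a - f t)
          (a := a) (b := b) (C := ε / 2) fun t ht => by
            rw [uIoc_of_le hle] at ht
            have h1 := hmod a ⟨ha0, hle.trans hb1⟩ t ⟨ha0.trans ht.1.le, ht.2.trans hb1⟩ (by
              rw [Real.dist_eq, abs_sub_comm, abs_of_nonneg (by linarith [ht.1])]
              linarith [ht.2])
            rw [Real.dist_eq] at h1
            exact h1.le
        rwa [hab, abs_of_nonneg (inv_nonneg.2 hn0.le)] at this
    _ = ε / 2 := by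
        rw [Finset.sum_const, Finset.card_range, nsmul_eq_mul]
        push_cast
        field_simp
    _ < ε := by linarith

theorem hasFDerivAt_of_eq_integral {E : Type*} [NormedAddCommGroup E] [NormedSpace ℝ E]
    {X : E → ℝ} {L : E → E →L[ℝ] ℝ} (hL : Continuous L)
    (h : ∀ x y, X y - X x = ∫ t in (0 : ℝ)..1, L (x + t • (y - x)) (y - x)) (x : E) :
    HasFDerivAt X (L x) x := by
  refine HasFDerivAt.of_isLittleO ((isLittleO_iff).2 fun ε hε => ?_)
  obtain ⟨δ, hδ, hball⟩ := Metric.continuousAt_iff.1 (hL.continuousAt (x := x)) ε hε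
  filter_upwards [Metric.ball_mem_nhds x hδ] with y hy
  have hcont : Continuous fun t : ℝ => L (x + t • (y - x)) (y - x) :=
    (hL.comp (by fun_prop)).clm_apply continuous_const
  have e : X y - X x - L x (y - x)
      = ∫ t in (0 : ℝ)..1, (L (x + t • (y - x)) (y - x) - L x (y - x)) := by
    rw [intervalIntegral.integral_sub (hcont.intervalIntegrable _ _) (by simp), h x y]
    simp
  rw [e]
  have := intervalIntegral.norm_integral_le_of_norm_le_const (C := ε * ‖y - x‖)
    (f := fun t : ℝ => L (x + t • (y - x)) (y - x) - L x (y - x)) (a := 0) (b := 1) fun t ht => by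
      rw [uIoc_of_le zero_le_one] at ht
      rw [← sub_apply]
      refine (ContinuousLinearMap.le_opNorm _ _).trans (mul_le_mul_of_nonneg_right ?_ (norm_nonneg _))
      rw [← dist_eq_norm]
      refine (hball ?_).le
      rw [dist_eq_norm, add_sub_cancel_left, norm_smul, Real.norm_eq_abs, abs_of_pos ht.1]
      rw [Metric.mem_ball, dist_eq_norm] at hy
      exact (mul_le_of_le_one_left (norm_nonneg _) ht.2).trans_lt hy
  simpa using this

/-- Let `ψ` be a family of vectors with first order Taylor expansions
`ψ (x + v) = ψ x + ∑ v_k ψ'_k x + O(|v|²)`, with `ψ` and `ψ'_k` Lipschitz. Then the values of an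
isonormal process along `ψ` have a `C¹` modification, whose derivative is given by `ψ'`. -/
theorem exists_contDiff_field {H Ω : Type*} [NormedAddCommGroup H] [InnerProductSpace ℝ H]
    [MeasurableSpace Ω] {P : Measure Ω} {V : H →ₗᵢ[ℝ] Lp ℝ 2 P}
    (hV : ∀ h, P.map (V h) = gaussianReal 0 (‖h‖₊ ^ 2)) {d : ℕ}
    {ψ : EuclideanSpace ℝ (Fin d) → H} {ψ' : Fin d → EuclideanSpace ℝ (Fin d) → H} {C : ℝ}
    (hψ : ∀ x y, ‖ψ x - ψ y‖ ≤ C * ‖x - y‖)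
    (hψ' : ∀ k x y, ‖ψ' k x - ψ' k y‖ ≤ C * ‖x - y‖)
    (htaylor : ∀ x v, ‖ψ (x + v) - ψ x - ∑ k, v k • ψ' k x‖ ≤ C * ‖v‖ ^ 2) :
    ∃ X : EuclideanSpace ℝ (Fin d) → Ω → ℝ, (∀ x, X x =ᵐ[P] V (ψ x)) ∧
      (∀ᵐ ω ∂P, ContDiff ℝ 1 fun x => X x ω) ∧
      ∀ k x, (fun ω => fderiv ℝ (fun x => X x ω) x (EuclideanSpace.single k 1)) =ᵐ[P] V (ψ' k x) := by
  obtain ⟨X, hX, hXc⟩ := exists_continuous_field hV hψ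
  have hY := fun k => exists_continuous_field hV (hψ' k)
  choose Y hY hYc using hY
  let A : Ω → EuclideanSpace ℝ (Fin d) → EuclideanSpace ℝ (Fin d) →L[ℝ] ℝ := fun ω x =>
    ∑ k, Y k x ω • EuclideanSpace.proj k
  have hA : ∀ ω x v, A ω x v = ∑ k, v k * Y k x ω := fun ω x v => by
    simp [A, mul_comm]
  have hAc : ∀ᵐ ω ∂P, Continuous (A ω) := by
    filter_upwards [ae_all_iff.2 hYc] with ω hω
    exact continuous_finsetSum _ fun k _ => (hω k).smul continuous_const
  -- The fundamental theorem of calculus along a fixed segment, from the `L²` Riemann sums.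
  have hseg : ∀ x y, ∀ᵐ ω ∂P, X y ω - X x ω = ∫ t in (0 : ℝ)..1, A ω (x + t • (y - x)) (y - x) := by
    intro x y
    set v := y - x with hv
    let S : ℕ → H := fun n => ∑ i ∈ Finset.range (n + 1),
      ((n : ℝ) + 1)⁻¹ • ∑ k, v k • ψ' k (x + ((i : ℝ) / (n + 1)) • v)
    have hS : Tendsto S atTop (𝓝 (ψ y - ψ x)) := by
      refine tendsto_iff_norm_sub_tendsto_zero.2 (squeeze_zero (fun _ => norm_nonneg _)
        (g := fun n : ℕ => C * ‖v‖ ^ 2 * (1 / ((n : ℝ) + 1))) (fun n => ?_) ?_)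
      · have hn0 : (0 : ℝ) < n + 1 := by positivity
        have htel : ψ y - ψ x = ∑ i ∈ Finset.range (n + 1),
            (ψ (x + (((i + 1 : ℕ) : ℝ) / (n + 1)) • v) - ψ (x + ((i : ℝ) / (n + 1)) • v)) := by
          rw [Finset.sum_range_sub (fun i : ℕ => ψ (x + ((i : ℝ) / (n + 1)) • v))]
          push_cast
          rw [div_self hn0.ne', one_smul, hv]
          simp
        rw [htel, norm_sub_rev, ← Finset.sum_sub_distrib]
        refine (norm_sum_le _ _).trans ?_
        calc _ ≤ ∑ i ∈ Finset.range (n + 1), C * ‖v‖ ^ 2 * (((n : ℝ) + 1)⁻¹) ^ 2 := by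
              refine Finset.sum_le_sum fun i _ => ?_
              have h1 := htaylor (x + ((i : ℝ) / (n + 1)) • v) (((n : ℝ) + 1)⁻¹ • v)
              have e1 : x + ((i : ℝ) / (n + 1)) • v + ((n : ℝ) + 1)⁻¹ • v
                  = x + (((i + 1 : ℕ) : ℝ) / (n + 1)) • v := by
                rw [add_assoc, ← add_smul]
                push_cast
                rw [add_div, one_div]
              have e2 : ∑ k, (((n : ℝ) + 1)⁻¹ • v) k • ψ' k (x + ((i : ℝ) / (n + 1)) • v)
                  = ((n : ℝ) + 1)⁻¹ • ∑ k, v k • ψ' k (x + ((i : ℝ) / (n + 1)) • v) := by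
                rw [Finset.smul_sum]
                refine Finset.sum_congr rfl fun k _ => ?_
                rw [PiLp.smul_apply, smul_eq_mul, mul_smul]
              rw [e1, e2, norm_smul, mul_pow, Real.norm_eq_abs, sq_abs] at h1
              linarith
          _ = C * ‖v‖ ^ 2 * (1 / ((n : ℝ) + 1)) := by
              rw [Finset.sum_const, Finset.card_range, nsmul_eq_mul]
              push_cast
              field_simp
      · simpa using tendsto_one_div_add_atTop_nhds_zero_nat.const_mul (C * ‖v‖ ^ 2)
    have hVS : Tendsto (fun n => V (S n)) atTop (𝓝 (V (ψ y - ψ x))) :=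
      (V.continuous.tendsto _).comp hS
    obtain ⟨ns, hns, hlim⟩ := (tendstoInMeasure_of_tendsto_Lp hVS).exists_seq_tendsto_ae
    have hdiff : ∀ᵐ ω ∂P, V (ψ y - ψ x) ω = X y ω - X x ω := by
      rw [map_sub]
      filter_upwards [Lp.coeFn_sub (V (ψ y)) (V (ψ x)), hX x, hX y] with ω h1 h2 h3
      rw [h1, Pi.sub_apply, h2, h3]
    have hrs : ∀ᵐ ω ∂P, ∀ n : ℕ, V (S n) ω = ∑ i ∈ Finset.range (n + 1),
        ((n : ℝ) + 1)⁻¹ * A ω (x + ((i : ℝ) / (n + 1)) • v) v := by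
      refine ae_all_iff.2 fun n => ?_
      have hterm : ∀ᵐ ω ∂P, ∀ i : ℕ, V (((n : ℝ) + 1)⁻¹ • ∑ k, v k • ψ' k (x + ((i : ℝ) / (n + 1)) • v)) ω
          = ((n : ℝ) + 1)⁻¹ * A ω (x + ((i : ℝ) / (n + 1)) • v) v := by
        refine ae_all_iff.2 fun i => ?_
        rw [map_smul, map_sum]
        have hk : ∀ᵐ ω ∂P, ∀ k, V (v k • ψ' k (x + ((i : ℝ) / (n + 1)) • v)) ω
            = v k * Y k (x + ((i : ℝ) / (n + 1)) • v) ω := by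
          refine ae_all_iff.2 fun k => ?_
          rw [map_smul]
          filter_upwards [Lp.coeFn_smul (v k) (V (ψ' k (x + ((i : ℝ) / (n + 1)) • v))),
            hY k (x + ((i : ℝ) / (n + 1)) • v)] with ω h1 h2
          rw [h1, Pi.smul_apply, h2, smul_eq_mul]
        filter_upwards [hk, Lp.coeFn_smul (((n : ℝ) + 1)⁻¹)
          (∑ k, V (v k • ψ' k (x + ((i : ℝ) / (n + 1)) • v))),
          Lp.coeFn_finsetSum Finset.univ fun k => V (v k • ψ' k (x + ((i : ℝ) / (n + 1)) • v))]
          with ω h1 h2 h3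
        rw [h2, Pi.smul_apply, h3, Finset.sum_apply, hA, smul_eq_mul]
        simp only [h1]
      rw [show V (S n) = ∑ i ∈ Finset.range (n + 1), V (((n : ℝ) + 1)⁻¹ •
        ∑ k, v k • ψ' k (x + ((i : ℝ) / (n + 1)) • v)) from map_sum V _ _]
      filter_upwards [hterm, Lp.coeFn_finsetSum (Finset.range (n + 1)) fun i : ℕ =>
        V (((n : ℝ) + 1)⁻¹ • ∑ k, v k • ψ' k (x + ((i : ℝ) / (n + 1)) • v))] with ω h1 h2
      rw [h2, Finset.sum_apply]
      exact Finset.sum_congr rfl fun i _ => h1 i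
    filter_upwards [hlim, hdiff, hrs, hAc] with ω h1 h2 h3 h4
    have hc : Continuous fun t : ℝ => A ω (x + t • v) v :=
      (h4.comp (by fun_prop)).clm_apply continuous_const
    have h5 := (tendsto_riemannSum hc).comp hns.tendsto_atTop
    rw [← h2]
    refine tendsto_nhds_unique h1 (h5.congr fun n => ?_)
    exact (h3 (ns n)).symm
  obtain ⟨D, hDc, hDd⟩ := TopologicalSpace.exists_countable_dense (EuclideanSpace ℝ (Fin d))
  have hsegD : ∀ᵐ ω ∂P, ∀ x ∈ D, ∀ y ∈ D,
      X y ω - X x ω = ∫ t in (0 : ℝ)..1, A ω (x + t • (y - x)) (y - x) :=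
    (ae_ball_iff hDc).2 fun x _ => (ae_ball_iff hDc).2 fun y _ => hseg x y
  have hder : ∀ᵐ ω ∂P, Continuous (A ω) ∧ ∀ x, HasFDerivAt (fun x => X x ω) (A ω x) x := by
    filter_upwards [hsegD, hXc, hAc] with ω h1 h2 h3
    refine ⟨h3, hasFDerivAt_of_eq_integral h3 ?_⟩
    have hcl : IsClosed {z : EuclideanSpace ℝ (Fin d) × EuclideanSpace ℝ (Fin d) |
        X z.2 ω - X z.1 ω = ∫ t in (0 : ℝ)..1, A ω (z.1 + t • (z.2 - z.1)) (z.2 - z.1)} := by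
      refine isClosed_eq ((h2.comp continuous_snd).sub (h2.comp continuous_fst)) ?_
      refine intervalIntegral.continuous_parametric_intervalIntegral_of_continuous' ?_ 0 1
      exact (h3.comp (by fun_prop)).clm_apply (by fun_prop)
    have hall : ∀ z : EuclideanSpace ℝ (Fin d) × EuclideanSpace ℝ (Fin d),
        X z.2 ω - X z.1 ω = ∫ t in (0 : ℝ)..1, A ω (z.1 + t • (z.2 - z.1)) (z.2 - z.1) := fun z =>
      hcl.closure_subset_iff.2 (fun z (hz : z ∈ D ×ˢ D) => h1 z.1 hz.1 z.2 hz.2)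
        ((hDd.prod hDd) z)
    exact fun x y => hall (x, y)
  refine ⟨X, hX, ?_, fun k x => ?_⟩
  · filter_upwards [hder] with ω hω
    exact contDiff_one_iff_hasFDerivAt.2 ⟨A ω, hω.1, hω.2⟩
  · filter_upwards [hder, hY k x] with ω h1 h2
    rw [(h1.2 x).fderiv, hA, ← h2]
    simp

/-! ### Kernels and their translates in `L²` -/

/-- Taylor's formula of order zero. -/
theorem norm_sub_le_integral_fderiv {E F : Type*} [NormedAddCommGroup E] [NormedSpace ℝ E]
    [NormedAddCommGroup F] [NormedSpace ℝ F] [CompleteSpace F] {w : E → F} (hw : ContDiff ℝ 1 w)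
    (y h : E) : ‖w (y + h) - w y‖ ≤ ‖h‖ * ∫ t in (0 : ℝ)..1, ‖fderiv ℝ w (y + t • h)‖ := by
  have hd : ∀ t : ℝ, HasDerivAt (fun t : ℝ => w (y + t • h)) (fderiv ℝ w (y + t • h) h) t := fun t => by
    have h1 : HasDerivAt (fun t : ℝ => y + t • h) h t := by
      simpa using ((hasDerivAt_id t).smul_const h).const_add y
    exact ((hw.differentiable (by norm_num)) _).hasFDerivAt.comp_hasDerivAt t h1
  have hc : Continuous fun t : ℝ => fderiv ℝ w (y + t • h) :=
    (hw.continuous_fderiv (by norm_num)).comp (by fun_prop)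
  have h2 := intervalIntegral.integral_eq_sub_of_hasDerivAt (a := 0) (b := 1) (fun t _ => hd t)
    ((hc.clm_apply continuous_const).intervalIntegrable _ _)
  simp only [one_smul, zero_smul, add_zero] at h2
  rw [← h2, ← intervalIntegral.integral_const_mul]
  refine (intervalIntegral.norm_integral_le_integral_norm zero_le_one).trans ?_
  refine intervalIntegral.integral_mono_on zero_le_one
    ((hc.clm_apply continuous_const).norm.intervalIntegrable _ _)
    ((hc.norm.const_mul _).intervalIntegrable _ _) fun t _ => ?_
  rw [mul_comm]
  exact ContinuousLinearMap.le_opNorm _ _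

/-- Taylor's formula of order one. -/
theorem norm_sub_sub_le_integral_fderiv {E : Type*} [NormedAddCommGroup E] [NormedSpace ℝ E]
    {u : E → ℝ} (hu : ContDiff ℝ 2 u) (y h : E) :
    ‖u (y + h) - u y - fderiv ℝ u y h‖
      ≤ ‖h‖ ^ 2 * ∫ t in (0 : ℝ)..1, ‖fderiv ℝ (fderiv ℝ u) (y + t • h)‖ := by
  have hDu : ContDiff ℝ 1 (fderiv ℝ u) := hu.fderiv_right (by norm_num)
  have hcu : Continuous fun t : ℝ => fderiv ℝ u (y + t • h) :=
    hDu.continuous.comp (by fun_prop)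
  have hcc : Continuous fun t : ℝ => ‖fderiv ℝ (fderiv ℝ u) (y + t • h)‖ :=
    ((hDu.continuous_fderiv (by norm_num)).comp (by fun_prop)).norm
  set K := ∫ t in (0 : ℝ)..1, ‖fderiv ℝ (fderiv ℝ u) (y + t • h)‖ with hK
  have hd : ∀ t : ℝ, HasDerivAt (fun t : ℝ => u (y + t • h)) (fderiv ℝ u (y + t • h) h) t := fun t => by
    have h1 : HasDerivAt (fun t : ℝ => y + t • h) h t := by
      simpa using ((hasDerivAt_id t).smul_const h).const_add y
    exact ((hu.differentiable (by norm_num)) _).hasFDerivAt.comp_hasDerivAt t h1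
  have h2 := intervalIntegral.integral_eq_sub_of_hasDerivAt (a := 0) (b := 1) (fun t _ => hd t)
    ((hcu.clm_apply continuous_const).intervalIntegrable _ _)
  simp only [one_smul, zero_smul, add_zero] at h2
  have h3 : u (y + h) - u y - fderiv ℝ u y h
      = ∫ t in (0 : ℝ)..1, (fderiv ℝ u (y + t • h) h - fderiv ℝ u y h) := by
    rw [intervalIntegral.integral_sub ((hcu.clm_apply continuous_const).intervalIntegrable _ _)
      (by simp), h2]
    simp
  rw [h3]
  have := intervalIntegral.norm_integral_le_of_norm_le_const (C := ‖h‖ ^ 2 * K)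
    (f := fun t : ℝ => fderiv ℝ u (y + t • h) h - fderiv ℝ u y h) (a := 0) (b := 1) fun t ht => by
      rw [uIoc_of_le zero_le_one] at ht
      rw [← sub_apply]
      refine (ContinuousLinearMap.le_opNorm _ _).trans ?_
      rw [sq, mul_assoc, mul_comm]
      refine mul_le_mul_of_nonneg_left ?_ (norm_nonneg h)
      refine (norm_sub_le_integral_fderiv hDu y (t • h)).trans ?_
      rw [norm_smul, Real.norm_eq_abs, abs_of_pos ht.1, mul_comm t, mul_assoc]
      refine mul_le_mul_of_nonneg_left ?_ (norm_nonneg h)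
      have h4 := intervalIntegral.mul_integral_comp_mul_right (a := 0) (b := 1)
        (f := fun t : ℝ => ‖fderiv ℝ (fderiv ℝ u) (y + t • h)‖) t
      simp only [zero_mul, one_mul] at h4
      simp only [smul_smul]
      rw [h4, hK]
      exact intervalIntegral.integral_mono_interval le_rfl ht.1.le ht.2
        (Eventually.of_forall fun t => norm_nonneg (fderiv ℝ (fderiv ℝ u) (y + t • h))) (hcc.intervalIntegrable _ _)
  simpa using this

section Kernel

variable {d : ℕ}

theorem measurePreserving_shift (μ : Measure ℝ) [SFinite μ] (x : EuclideanSpace ℝ (Fin d)) :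
    MeasurePreserving (fun z : ℝ × EuclideanSpace ℝ (Fin d) => (z.1, z.2 + x))
      (μ.prod volume) (μ.prod volume) :=
  (MeasurePreserving.id μ).prod (measurePreserving_add_right volume x)

/-- Minkowski's inequality for averages of a function over translates. -/
theorem eLpNorm_le_of_le_integral_shift {μ : Measure ℝ} [SFinite μ]
    {D : ℝ × EuclideanSpace ℝ (Fin d) → ℝ} {F : Type*} [NormedAddCommGroup F]
    {G : ℝ × EuclideanSpace ℝ (Fin d) → F} (hG : Continuous G) {c : ℝ} (hc : 0 ≤ c)
    (h : EuclideanSpace ℝ (Fin d))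
    (hD : ∀ z, ‖D z‖ ≤ c * ∫ t in (0 : ℝ)..1, ‖G (z.1, z.2 + t • h)‖) :
    eLpNorm D 2 (μ.prod volume) ≤ ENNReal.ofReal c * eLpNorm G 2 (μ.prod volume) := by
  have hcont : Continuous fun w : (ℝ × EuclideanSpace ℝ (Fin d)) × ℝ =>
      ‖G (w.1.1, w.1.2 + w.2 • h)‖ := (hG.comp (by fun_prop)).norm
  have hsq : ∀ z, ‖D z‖ₑ ^ 2 ≤ ENNReal.ofReal c ^ 2 *
      ∫⁻ t in Ioc (0 : ℝ) 1, ‖G (z.1, z.2 + t • h)‖ₑ ^ 2 := fun z => by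
    have hcz : Continuous fun t : ℝ => ‖G (z.1, z.2 + t • h)‖ :=
      hcont.comp (by fun_prop : Continuous fun t : ℝ => (z, t))
    have h1 : ‖D z‖ₑ ≤ ENNReal.ofReal c * ∫⁻ t in Ioc (0 : ℝ) 1, ‖G (z.1, z.2 + t • h)‖ₑ := by
      rw [← ofReal_norm]
      refine (ENNReal.ofReal_le_ofReal (hD z)).trans ?_
      rw [ENNReal.ofReal_mul hc, intervalIntegral.integral_of_le zero_le_one,
        ofReal_integral_eq_lintegral_ofReal
          ((hcz.intervalIntegrable 0 1).1) (ae_of_all _ fun _ => norm_nonneg _)]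
      simp only [ofReal_norm, le_refl]
    have : IsProbabilityMeasure (volume.restrict (Ioc (0 : ℝ) 1)) := ⟨by simp⟩
    have h2 := eLpNorm_le_eLpNorm_of_exponent_le (p := 1) (q := 2) (by norm_num)
      (f := fun t : ℝ => ‖G (z.1, z.2 + t • h)‖) (μ := volume.restrict (Ioc (0 : ℝ) 1))
      hcz.aestronglyMeasurable
    rw [eLpNorm_one_eq_lintegral_enorm] at h2
    simp only [enorm_norm] at h2
    have h3 : (eLpNorm (fun t : ℝ => ‖G (z.1, z.2 + t • h)‖) 2 (volume.restrict (Ioc (0 : ℝ) 1))) ^ 2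
        = ∫⁻ t in Ioc (0 : ℝ) 1, ‖G (z.1, z.2 + t • h)‖ₑ ^ 2 := by
      have := eLpNorm_nnreal_pow_eq_lintegral (p := 2) (by norm_num)
        (f := fun t : ℝ => ‖G (z.1, z.2 + t • h)‖) (μ := volume.restrict (Ioc (0 : ℝ) 1))
      simpa using this
    calc ‖D z‖ₑ ^ 2 ≤ (ENNReal.ofReal c * ∫⁻ t in Ioc (0 : ℝ) 1, ‖G (z.1, z.2 + t • h)‖ₑ) ^ 2 := by
          gcongr
      _ ≤ ENNReal.ofReal c ^ 2 * (eLpNorm (fun t : ℝ => ‖G (z.1, z.2 + t • h)‖) 2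
            (volume.restrict (Ioc (0 : ℝ) 1))) ^ 2 := by rw [mul_pow]; gcongr
      _ = _ := by rw [h3]
  have e : ∀ {F' : Type _} [NormedAddCommGroup F'] (f : ℝ × EuclideanSpace ℝ (Fin d) → F'),
      eLpNorm f 2 (μ.prod volume) ^ 2 = ∫⁻ z, ‖f z‖ₑ ^ 2 ∂(μ.prod volume) := fun f => by
    simpa using eLpNorm_nnreal_pow_eq_lintegral (p := 2) (by norm_num) (f := f)
      (μ := μ.prod (volume : Measure (EuclideanSpace ℝ (Fin d))))
  have e2 : eLpNorm G 2 (μ.prod volume) ^ 2 = ∫⁻ z, ‖G z‖ₑ ^ 2 ∂(μ.prod volume) := by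
    simpa using eLpNorm_nnreal_pow_eq_lintegral (p := 2) (by norm_num) (f := G)
      (μ := μ.prod (volume : Measure (EuclideanSpace ℝ (Fin d))))
  have hmain : eLpNorm D 2 (μ.prod volume) ^ 2
      ≤ (ENNReal.ofReal c * eLpNorm G 2 (μ.prod volume)) ^ 2 := by
    rw [e, mul_pow, e2]
    have hm : Measurable fun w : (ℝ × EuclideanSpace ℝ (Fin d)) × ℝ =>
        ‖G (w.1.1, w.1.2 + w.2 • h)‖ₑ ^ 2 := by
      have : (fun w : (ℝ × EuclideanSpace ℝ (Fin d)) × ℝ => ‖G (w.1.1, w.1.2 + w.2 • h)‖ₑ ^ 2)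
          = fun w => ‖‖G (w.1.1, w.1.2 + w.2 • h)‖‖ₑ ^ 2 := by simp only [enorm_norm]
      rw [this]
      exact hcont.measurable.enorm.pow_const 2
    calc ∫⁻ z, ‖D z‖ₑ ^ 2 ∂(μ.prod volume)
        ≤ ∫⁻ z, ENNReal.ofReal c ^ 2 *
            ∫⁻ t in Ioc (0 : ℝ) 1, ‖G (z.1, z.2 + t • h)‖ₑ ^ 2 ∂volume ∂(μ.prod volume) :=
          lintegral_mono hsq
      _ = ENNReal.ofReal c ^ 2 * ∫⁻ t in Ioc (0 : ℝ) 1,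
            ∫⁻ z, ‖G (z.1, z.2 + t • h)‖ₑ ^ 2 ∂(μ.prod volume) := by
          rw [lintegral_const_mul _ hm.lintegral_prod_right', lintegral_lintegral_swap
            (f := fun (z : ℝ × EuclideanSpace ℝ (Fin d)) (t : ℝ) =>
              ‖G (z.1, z.2 + t • h)‖ₑ ^ 2) hm.aemeasurable]
      _ = ENNReal.ofReal c ^ 2 * ∫⁻ _t in Ioc (0 : ℝ) 1, ∫⁻ z, ‖G z‖ₑ ^ 2 ∂(μ.prod volume) := by
          congr 1
          refine lintegral_congr fun t => ?_
          have hmG : Measurable fun z => ‖G z‖ₑ ^ 2 := by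
            have : (fun z => ‖G z‖ₑ ^ 2) = fun z => ‖‖G z‖‖ₑ ^ 2 := by simp only [enorm_norm]
            rw [this]
            exact hG.norm.measurable.enorm.pow_const 2
          exact (measurePreserving_shift μ (t • h)).lintegral_comp hmG
      _ = _ := by simp
  exact (ENNReal.pow_le_pow_left_iff (by norm_num)).1 hmain

/-- A kernel `p : ℝ × ℝ^d → ℝ` of class `C²` which together with its first two derivatives in the
second variable is square integrable with respect to `μ ⊗ volume`. -/
structure IsSmoothKernel (μ : Measure ℝ) (p : ℝ → EuclideanSpace ℝ (Fin d) → ℝ) : Prop where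
  contDiff : ContDiff ℝ 2 (Function.uncurry p)
  memLp : MemLp (fun z : ℝ × EuclideanSpace ℝ (Fin d) => p z.1 z.2) 2 (μ.prod volume)
  memLp_fderiv : MemLp (fun z : ℝ × EuclideanSpace ℝ (Fin d) => ‖fderiv ℝ (p z.1) z.2‖) 2
    (μ.prod volume)
  memLp_fderiv_fderiv : MemLp (fun z : ℝ × EuclideanSpace ℝ (Fin d) =>
    ‖fderiv ℝ (fderiv ℝ (p z.1)) z.2‖) 2 (μ.prod volume)

theorem contDiff_fderiv_uncurry {p : ℝ → EuclideanSpace ℝ (Fin d) → ℝ}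
    (hp : ContDiff ℝ 2 (Function.uncurry p)) :
    ContDiff ℝ 1 fun z : ℝ × EuclideanSpace ℝ (Fin d) => fderiv ℝ (p z.1) z.2 :=
  ContDiff.fderiv (f := fun (z : ℝ × EuclideanSpace ℝ (Fin d)) y => p z.1 y) (g := fun z => z.2)
    (n := 1) (m := 2) (hp.comp (by fun_prop : ContDiff ℝ 2
      fun w : (ℝ × EuclideanSpace ℝ (Fin d)) × EuclideanSpace ℝ (Fin d) => (w.1.1, w.2)))
    contDiff_snd (by norm_num)

theorem continuous_fderiv_fderiv_uncurry {p : ℝ → EuclideanSpace ℝ (Fin d) → ℝ}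
    (hp : ContDiff ℝ 2 (Function.uncurry p)) :
    Continuous fun z : ℝ × EuclideanSpace ℝ (Fin d) => fderiv ℝ (fderiv ℝ (p z.1)) z.2 :=
  (ContDiff.fderiv (f := fun (z : ℝ × EuclideanSpace ℝ (Fin d)) y => fderiv ℝ (p z.1) y)
    (g := fun z => z.2) (n := 0) (m := 1) ((contDiff_fderiv_uncurry hp).comp (by fun_prop : ContDiff ℝ 1
      fun w : (ℝ × EuclideanSpace ℝ (Fin d)) × EuclideanSpace ℝ (Fin d) => (w.1.1, w.2)))
    contDiff_snd (by norm_num)).continuous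

theorem contDiff_slice {p : ℝ → EuclideanSpace ℝ (Fin d) → ℝ}
    (hp : ContDiff ℝ 2 (Function.uncurry p)) (s : ℝ) : ContDiff ℝ 2 (p s) :=
  hp.comp (by fun_prop : ContDiff ℝ 2 fun y : EuclideanSpace ℝ (Fin d) => (s, y))

/-- The translates `(s, y) ↦ F (s, y + x)` of a square integrable function, as elements
of `L²`. -/
def shiftLp {μ : Measure ℝ} [SFinite μ] {F : ℝ × EuclideanSpace ℝ (Fin d) → ℝ}
    (hF : MemLp F 2 (μ.prod volume)) (x : EuclideanSpace ℝ (Fin d)) :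
    Lp ℝ 2 (μ.prod (volume : Measure (EuclideanSpace ℝ (Fin d)))) :=
  (hF.comp_measurePreserving (measurePreserving_shift μ x)).toLp

theorem coeFn_shiftLp {μ : Measure ℝ} [SFinite μ] {F : ℝ × EuclideanSpace ℝ (Fin d) → ℝ}
    (hF : MemLp F 2 (μ.prod volume)) (x : EuclideanSpace ℝ (Fin d)) :
    shiftLp hF x =ᵐ[μ.prod volume] fun z => F (z.1, z.2 + x) :=
  MemLp.coeFn_toLp _

theorem inner_shiftLp {μ : Measure ℝ} [SFinite μ] {F G : ℝ × EuclideanSpace ℝ (Fin d) → ℝ}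
    (hF : MemLp F 2 (μ.prod volume)) (hG : MemLp G 2 (μ.prod volume))
    (x y : EuclideanSpace ℝ (Fin d)) :
    ⟪shiftLp hF x, shiftLp hG y⟫
      = ∫ z, F (z.1, z.2 + x) * G (z.1, z.2 + y) ∂(μ.prod volume) := by
  rw [L2.inner_def]
  refine integral_congr_ae ?_
  filter_upwards [coeFn_shiftLp hF x, coeFn_shiftLp hG y] with z h1 h2
  simp [h1, h2, mul_comm]

/-- Transfer of a pointwise bound at the origin to all translates, in `L²`. -/
theorem norm_le_of_ae_eq_shift {μ : Measure ℝ} [SFinite μ]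
    {φ : Lp ℝ 2 (μ.prod (volume : Measure (EuclideanSpace ℝ (Fin d))))}
    {D G : ℝ × EuclideanSpace ℝ (Fin d) → ℝ} (hGc : Continuous G) (hG0 : ∀ z, 0 ≤ G z) (hG : MemLp G 2 (μ.prod volume))
    {c : ℝ} (hc : 0 ≤ c) (x h : EuclideanSpace ℝ (Fin d)) (hDm : Continuous D)
    (hφ : φ =ᵐ[μ.prod volume] fun z => D (z.1, z.2 + x))
    (hD : ∀ z, ‖D z‖ ≤ c * ∫ t in (0 : ℝ)..1, G (z.1, z.2 + t • h)) :
    ‖φ‖ ≤ c * (eLpNorm G 2 (μ.prod volume)).toReal := by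
  rw [Lp.norm_def, eLpNorm_congr_ae hφ]
  have e : eLpNorm (fun z : ℝ × EuclideanSpace ℝ (Fin d) => D (z.1, z.2 + x)) 2 (μ.prod volume)
      = eLpNorm D 2 (μ.prod volume) :=
    eLpNorm_comp_measurePreserving hDm.aestronglyMeasurable (measurePreserving_shift μ x)
  rw [e]
  have h1 := ENNReal.toReal_mono (ENNReal.mul_ne_top ENNReal.ofReal_ne_top hG.2.ne)
    (eLpNorm_le_of_le_integral_shift (μ := μ) hGc hc h fun z => by
      simpa only [Real.norm_of_nonneg (hG0 _)] using hD z)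
  rwa [ENNReal.toReal_mul, ENNReal.toReal_ofReal hc] at h1

theorem IsSmoothKernel.memLp_partial {μ : Measure ℝ} {p : ℝ → EuclideanSpace ℝ (Fin d) → ℝ}
    (hp : IsSmoothKernel μ p) (k : Fin d) :
    MemLp (fun z : ℝ × EuclideanSpace ℝ (Fin d) =>
      fderiv ℝ (p z.1) z.2 (EuclideanSpace.single k 1)) 2 (μ.prod volume) :=
  hp.memLp_fderiv.of_le (((contDiff_fderiv_uncurry hp.contDiff).continuous.clm_apply
    continuous_const).aestronglyMeasurable) (ae_of_all _ fun z =>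
      by
        rw [norm_norm]
        exact (ContinuousLinearMap.le_opNorm _ _).trans (by simp))

/-- The translates of a smooth kernel satisfy the bounds of `exists_contDiff_field`. -/
theorem IsSmoothKernel.exists_bounds {μ : Measure ℝ} [SFinite μ]
    {p : ℝ → EuclideanSpace ℝ (Fin d) → ℝ} (hp : IsSmoothKernel μ p) :
    ∃ C : ℝ, (∀ x y, ‖shiftLp hp.memLp x - shiftLp hp.memLp y‖ ≤ C * ‖x - y‖) ∧
      (∀ k x y, ‖shiftLp (hp.memLp_partial k) x - shiftLp (hp.memLp_partial k) y‖
        ≤ C * ‖x - y‖) ∧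
      ∀ x v, ‖shiftLp hp.memLp (x + v) - shiftLp hp.memLp x
        - ∑ k, v k • shiftLp (hp.memLp_partial k) x‖ ≤ C * ‖v‖ ^ 2 := by
  let G₁ : ℝ × EuclideanSpace ℝ (Fin d) → ℝ := fun z => ‖fderiv ℝ (p z.1) z.2‖
  let G₂ : ℝ × EuclideanSpace ℝ (Fin d) → ℝ := fun z => ‖fderiv ℝ (fderiv ℝ (p z.1)) z.2‖
  have hG₁ : MemLp G₁ 2 (μ.prod volume) := hp.memLp_fderiv
  have hG₂ : MemLp G₂ 2 (μ.prod volume) := hp.memLp_fderiv_fderiv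
  set a := (eLpNorm G₁ 2 (μ.prod volume)).toReal
  set b := (eLpNorm G₂ 2 (μ.prod volume)).toReal
  have hcp : Continuous fun z : ℝ × EuclideanSpace ℝ (Fin d) => p z.1 z.2 := hp.contDiff.continuous
  have hc1 := (contDiff_fderiv_uncurry hp.contDiff).continuous
  have hG₁c : Continuous G₁ := hc1.norm
  have hc2 := continuous_fderiv_fderiv_uncurry hp.contDiff
  have hG₂c : Continuous fun z : ℝ × EuclideanSpace ℝ (Fin d) =>
    ‖fderiv ℝ (fderiv ℝ (p z.1)) z.2‖ := by
    have := (continuous_norm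
      (E := EuclideanSpace ℝ (Fin d) →L[ℝ] EuclideanSpace ℝ (Fin d) →L[ℝ] ℝ)).comp hc2
    exact this
  have hG₁0 : ∀ z, 0 ≤ G₁ z := fun z => norm_nonneg _
  have hG₂0 : ∀ z, 0 ≤ G₂ z := fun z => norm_nonneg
    (E := EuclideanSpace ℝ (Fin d) →L[ℝ] EuclideanSpace ℝ (Fin d) →L[ℝ] ℝ) _
  have hsl := contDiff_slice hp.contDiff
  have hsl' : ∀ s, ContDiff ℝ 1 (fderiv ℝ (p s)) := fun s => (hsl s).fderiv_right (by norm_num)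
  have ha : a ≤ max a b := le_max_left _ _
  have hb : b ≤ max a b := le_max_right _ _
  refine ⟨max a b, fun x y => ?_, fun k x y => ?_, fun x v => ?_⟩
  · have h1 := norm_le_of_ae_eq_shift (φ := shiftLp hp.memLp x - shiftLp hp.memLp y)
      (D := fun z => p z.1 (z.2 + (x - y)) - p z.1 z.2) hG₁c hG₁0 hG₁ (norm_nonneg (x - y)) y
      (x - y) (by
        refine Continuous.sub ?_ hcp
        exact hcp.comp (by fun_prop : Continuous fun z : ℝ × EuclideanSpace ℝ (Fin d) =>
          (z.1, z.2 + (x - y)))) ?_ (fun z =>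
        norm_sub_le_integral_fderiv ((hsl z.1).of_le (by norm_num)) z.2 (x - y))
    · rw [mul_comm] at h1
      exact h1.trans (mul_le_mul_of_nonneg_right ha (norm_nonneg _))
    · filter_upwards [Lp.coeFn_sub (shiftLp hp.memLp x) (shiftLp hp.memLp y),
        coeFn_shiftLp hp.memLp x, coeFn_shiftLp hp.memLp y] with z e1 e2 e3
      rw [e1, Pi.sub_apply, e2, e3]
      simp
  · have h1 := norm_le_of_ae_eq_shift
      (φ := shiftLp (hp.memLp_partial k) x - shiftLp (hp.memLp_partial k) y)
      (D := fun z => fderiv ℝ (p z.1) (z.2 + (x - y)) (EuclideanSpace.single k 1)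
        - fderiv ℝ (p z.1) z.2 (EuclideanSpace.single k 1)) hG₂c hG₂0 hG₂
      (norm_nonneg (x - y)) y (x - y) (by
        refine Continuous.sub ?_ (hc1.clm_apply continuous_const)
        exact (hc1.comp (by fun_prop : Continuous fun z : ℝ × EuclideanSpace ℝ (Fin d) =>
          (z.1, z.2 + (x - y)))).clm_apply continuous_const) ?_ (fun z => ?_)
    · rw [mul_comm] at h1
      exact h1.trans (mul_le_mul_of_nonneg_right hb (norm_nonneg _))
    · filter_upwards [Lp.coeFn_sub (shiftLp (hp.memLp_partial k) x)
        (shiftLp (hp.memLp_partial k) y), coeFn_shiftLp (hp.memLp_partial k) x,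
        coeFn_shiftLp (hp.memLp_partial k) y] with z e1 e2 e3
      rw [e1, Pi.sub_apply, e2, e3]
      simp
    · refine le_trans ?_ (norm_sub_le_integral_fderiv (hsl' z.1) z.2 (x - y))
      rw [← sub_apply]
      exact (ContinuousLinearMap.le_opNorm _ _).trans (by simp)
  · have h1 := norm_le_of_ae_eq_shift (φ := shiftLp hp.memLp (x + v) - shiftLp hp.memLp x
        - ∑ k, v k • shiftLp (hp.memLp_partial k) x)
      (D := fun z => p z.1 (z.2 + v) - p z.1 z.2 - fderiv ℝ (p z.1) z.2 v) hG₂c hG₂0 hG₂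
      (sq_nonneg ‖v‖) x v (by
        refine Continuous.sub (Continuous.sub ?_ hcp) (hc1.clm_apply continuous_const)
        exact hcp.comp (by fun_prop : Continuous fun z : ℝ × EuclideanSpace ℝ (Fin d) =>
          (z.1, z.2 + v))) ?_ (fun z => norm_sub_sub_le_integral_fderiv (hsl z.1) z.2 v)
    · rw [mul_comm] at h1
      exact h1.trans (mul_le_mul_of_nonneg_right hb (sq_nonneg _))
    · have hk : ∀ᵐ z ∂(μ.prod volume), ∀ k, (v k • shiftLp (hp.memLp_partial k) x :
          Lp ℝ 2 (μ.prod (volume : Measure (EuclideanSpace ℝ (Fin d))))) z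
            = v k * fderiv ℝ (p z.1) (z.2 + x) (EuclideanSpace.single k 1) := by
        refine ae_all_iff.2 fun k => ?_
        filter_upwards [Lp.coeFn_smul (v k) (shiftLp (hp.memLp_partial k) x),
          coeFn_shiftLp (hp.memLp_partial k) x] with z e1 e2
        rw [e1, Pi.smul_apply, e2, smul_eq_mul]
      filter_upwards [Lp.coeFn_sub (shiftLp hp.memLp (x + v) - shiftLp hp.memLp x)
          (∑ k, v k • shiftLp (hp.memLp_partial k) x),
        Lp.coeFn_sub (shiftLp hp.memLp (x + v)) (shiftLp hp.memLp x),
        Lp.coeFn_finsetSum Finset.univ fun k => v k • shiftLp (hp.memLp_partial k) x,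
        coeFn_shiftLp hp.memLp (x + v), coeFn_shiftLp hp.memLp x, hk] with z e1 e2 e3 e4 e5 e6
      rw [e1, Pi.sub_apply, e2, Pi.sub_apply, e3, e4, e5, Finset.sum_apply,
        Finset.sum_congr rfl fun k _ => e6 k]
      have hv : v = ∑ k, v k • EuclideanSpace.single k (1 : ℝ) := by
        ext i
        simp [Finset.sum_apply, Pi.single_apply]
      conv_rhs => rw [hv]
      simp only [map_sum, map_smul, smul_eq_mul]
      rw [← hv, add_assoc]

end Kernel

/-! ### Cutting off a kernel -/

section Cutoff

variable {E : Type*} [NormedAddCommGroup E]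

/-- A smooth radial function which vanishes for `‖y‖ ≤ 1 / 4` and equals `1` for `1 / 2 ≤ ‖y‖`. -/
def cutoff (y : E) : ℝ := Real.smoothTransition ((16 * ‖y‖ ^ 2 - 1) / 3)

theorem cutoff_nonneg (y : E) : 0 ≤ cutoff y := Real.smoothTransition.nonneg _

theorem cutoff_le_one (y : E) : cutoff y ≤ 1 := Real.smoothTransition.le_one _

theorem cutoff_eq_zero {y : E} (hy : ‖y‖ ≤ 1 / 4) : cutoff y = 0 := by
  refine Real.smoothTransition.zero_of_nonpos ?_
  have : ‖y‖ ^ 2 ≤ (1 / 4) ^ 2 := pow_le_pow_left₀ (norm_nonneg _) hy 2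
  linarith

theorem cutoff_eq_one {y : E} (hy : 1 / 2 ≤ ‖y‖) : cutoff y = 1 := by
  refine Real.smoothTransition.one_of_one_le ?_
  have : (1 / 2) ^ 2 ≤ ‖y‖ ^ 2 := pow_le_pow_left₀ (by norm_num) hy 2
  linarith

variable [InnerProductSpace ℝ E]

theorem contDiff_cutoff : ContDiff ℝ 2 (cutoff : E → ℝ) := by
  refine Real.smoothTransition.contDiff.comp ?_
  exact ((contDiff_const.mul (contDiff_norm_sq ℝ)).sub contDiff_const).div_const _

theorem hasCompactSupport_fderiv_cutoff [FiniteDimensional ℝ E] :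
    HasCompactSupport (fderiv ℝ (cutoff : E → ℝ)) := by
  have hc : HasCompactSupport fun y : E => 1 - cutoff y := by
    refine HasCompactSupport.intro (isCompact_closedBall (0 : E) (1 / 2)) fun y hy => ?_
    rw [mem_closedBall_zero_iff, not_le] at hy
    rw [cutoff_eq_one hy.le, sub_self]
  have h1 := hc.fderiv (𝕜 := ℝ)
  have e : fderiv ℝ (fun y : E => 1 - cutoff y) = -fderiv ℝ (cutoff : E → ℝ) := by
    ext1 y
    rw [fderiv_const_sub, Pi.neg_apply]
  rw [e] at h1
  simpa using h1.neg

theorem fderiv_cutoff_smul (c : ℝ) : fderiv ℝ (fun y : E => cutoff (c • y))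
    = fun y => c • fderiv ℝ (cutoff : E → ℝ) (c • y) := by
  ext1 y
  exact fderiv_comp_smul c

theorem fderiv_fderiv_cutoff_smul (c : ℝ) (y : E) :
    fderiv ℝ (fderiv ℝ (fun y : E => cutoff (c • y))) y
      = c • c • fderiv ℝ (fderiv ℝ (cutoff : E → ℝ)) (c • y) := by
  have hD : ContDiff ℝ 1 (fderiv ℝ (cutoff : E → ℝ)) := contDiff_cutoff.fderiv_right (by norm_num)
  have hdiff : DifferentiableAt ℝ (fun y : E => fderiv ℝ (cutoff : E → ℝ) (c • y)) y :=
    (hD.differentiable (by norm_num)).comp (by fun_prop : Differentiable ℝ fun y : E => c • y) y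
  rw [fderiv_cutoff_smul, fderiv_fun_const_smul hdiff]
  congr 1
  exact fderiv_comp_smul c

theorem exists_bound_fderiv_of_hasCompactSupport [FiniteDimensional ℝ E] {F : Type*}
    [NormedAddCommGroup F] [NormedSpace ℝ F] {g : E → F} (hg : ContDiff ℝ 1 g)
    (hs : HasCompactSupport g) : ∃ B, ∀ y, ‖fderiv ℝ g y‖ ≤ B :=
  (hs.fderiv (𝕜 := ℝ)).exists_bound_of_continuous (hg.continuous_fderiv (by norm_num))

theorem norm_smul_smul_le {F : Type*} [NormedAddCommGroup F] [NormedSpace ℝ F] {c : ℝ}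
    (h0 : 0 ≤ c) (h1 : c ≤ 1) (A : F) : ‖c • c • A‖ ≤ ‖A‖ := by
  rw [norm_smul, norm_smul, Real.norm_eq_abs, abs_of_nonneg h0]
  exact (mul_le_of_le_one_left (by positivity) h1).trans (mul_le_of_le_one_left (norm_nonneg _) h1)

theorem exists_cutoff_bound_fderiv [FiniteDimensional ℝ E] : ∃ B : ℝ, ∀ L : ℝ, 1 ≤ L →
    ∀ y : E, ‖fderiv ℝ (fun y : E => cutoff (L⁻¹ • y)) y‖ ≤ B / L := by
  obtain ⟨B, hB⟩ := (hasCompactSupport_fderiv_cutoff (E := E)).exists_bound_of_continuous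
    (contDiff_cutoff.continuous_fderiv (by norm_num))
  refine ⟨B, fun L hL y => ?_⟩
  rw [fderiv_cutoff_smul, norm_smul, Real.norm_eq_abs, abs_of_pos (by positivity), div_eq_inv_mul]
  exact mul_le_mul_of_nonneg_left (hB _) (by positivity)

theorem exists_cutoff_bound_fderiv_fderiv [FiniteDimensional ℝ E] : ∃ B : ℝ, ∀ L : ℝ, 1 ≤ L →
    ∀ y : E, ‖fderiv ℝ (fderiv ℝ (fun y : E => cutoff (L⁻¹ • y))) y‖ ≤ B := by
  obtain ⟨B, hB⟩ := exists_bound_fderiv_of_hasCompactSupport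
    (contDiff_cutoff.fderiv_right (m := 1) (by norm_num)) (hasCompactSupport_fderiv_cutoff (E := E))
  refine ⟨B, fun L hL y => ?_⟩
  rw [fderiv_fderiv_cutoff_smul]
  exact (norm_smul_smul_le (by positivity) (inv_le_one_of_one_le₀ hL) _).trans (hB (L⁻¹ • y))

/-- The first two derivatives of the dilated cutoff functions are bounded. -/
theorem exists_cutoff_bound [FiniteDimensional ℝ E] : ∃ B : ℝ, 1 ≤ B ∧ ∀ L : ℝ, 1 ≤ L →
    ∀ y : E, ‖fderiv ℝ (fun y : E => cutoff (L⁻¹ • y)) y‖ ≤ B / L ∧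
      ‖fderiv ℝ (fderiv ℝ (fun y : E => cutoff (L⁻¹ • y))) y‖ ≤ B := by
  obtain ⟨B₁, hB₁⟩ := exists_cutoff_bound_fderiv (E := E)
  obtain ⟨B₂, hB₂⟩ := exists_cutoff_bound_fderiv_fderiv (E := E)
  refine ⟨max 1 (max B₁ B₂), le_max_left _ _, fun L hL y => ⟨(hB₁ L hL y).trans ?_,
    (hB₂ L hL y).trans ((le_max_right _ _).trans (le_max_right _ _))⟩⟩
  exact div_le_div_of_nonneg_right ((le_max_left _ _).trans (le_max_right _ _)) (by linarith)

theorem norm_fderiv_mul_le {u χ : E → ℝ} (hu : Differentiable ℝ u) (hχ : Differentiable ℝ χ)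
    (y : E) : ‖fderiv ℝ (fun y => u y * χ y) y‖ ≤ |u y| * ‖fderiv ℝ χ y‖ + |χ y| * ‖fderiv ℝ u y‖ := by
  rw [fderiv_fun_mul (hu y) (hχ y)]
  refine (norm_add_le _ _).trans ?_
  rw [norm_smul, norm_smul, Real.norm_eq_abs, Real.norm_eq_abs]

theorem norm_smul_add_add_le {F : Type*} [NormedAddCommGroup F] [NormedSpace ℝ F] (a b : ℝ)
    (A B C D : F) : ‖(a • A + B) + (b • C + D)‖ ≤ |a| * ‖A‖ + ‖B‖ + (|b| * ‖C‖ + ‖D‖) := by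
  refine (norm_add_le _ _).trans (add_le_add ((norm_add_le _ _).trans ?_)
    ((norm_add_le _ _).trans ?_)) <;> rw [norm_smul, Real.norm_eq_abs]

theorem norm_fderiv_fderiv_mul_le {u χ : E → ℝ} (hu : ContDiff ℝ 2 u) (hχ : ContDiff ℝ 2 χ)
    (y : E) : ‖fderiv ℝ (fderiv ℝ fun y => u y * χ y) y‖
      ≤ |u y| * ‖fderiv ℝ (fderiv ℝ χ) y‖ + 2 * (‖fderiv ℝ u y‖ * ‖fderiv ℝ χ y‖)
        + |χ y| * ‖fderiv ℝ (fderiv ℝ u) y‖ := by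
  have hu1 := hu.differentiable (by norm_num)
  have hχ1 := hχ.differentiable (by norm_num)
  have hu2 : Differentiable ℝ (fderiv ℝ u) :=
    (hu.fderiv_right (m := 1) (by norm_num)).differentiable (by norm_num)
  have hχ2 : Differentiable ℝ (fderiv ℝ χ) :=
    (hχ.fderiv_right (m := 1) (by norm_num)).differentiable (by norm_num)
  have e : fderiv ℝ (fun y => u y * χ y) = fun y => u y • fderiv ℝ χ y + χ y • fderiv ℝ u y := by
    ext1 y
    exact fderiv_fun_mul (hu1 y) (hχ1 y)
  have e2 : fderiv ℝ (fun y => u y • fderiv ℝ χ y + χ y • fderiv ℝ u y) y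
      = (u y • fderiv ℝ (fderiv ℝ χ) y + (fderiv ℝ u y).smulRight (fderiv ℝ χ y))
        + (χ y • fderiv ℝ (fderiv ℝ u) y + (fderiv ℝ χ y).smulRight (fderiv ℝ u y)) :=
    (((hu1 y).hasFDerivAt.smul (hχ2 y).hasFDerivAt).add
      ((hχ1 y).hasFDerivAt.smul (hu2 y).hasFDerivAt)).fderiv
  rw [e, e2]
  refine (norm_smul_add_add_le (F := E →L[ℝ] E →L[ℝ] ℝ) _ _ _ _ _ _).trans (le_of_eq ?_)
  rw [ContinuousLinearMap.norm_smulRight_apply, ContinuousLinearMap.norm_smulRight_apply]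
  ring

end Cutoff

section CutKernel

variable {d : ℕ}

/-- Multiplying by a bounded function with bounded derivatives preserves smooth kernels. -/
theorem IsSmoothKernel.mul {μ : Measure ℝ} [SFinite μ] {p : ℝ → EuclideanSpace ℝ (Fin d) → ℝ}
    (hp : IsSmoothKernel μ p) {χ : EuclideanSpace ℝ (Fin d) → ℝ} (hχ : ContDiff ℝ 2 χ) {B : ℝ}
    (h0 : ∀ y, |χ y| ≤ B) (h1 : ∀ y, ‖fderiv ℝ χ y‖ ≤ B) (h2 : ∀ y, ‖fderiv ℝ (fderiv ℝ χ) y‖ ≤ B) :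
    IsSmoothKernel μ fun s y => p s y * χ y := by
  have hB : 0 ≤ B := (abs_nonneg _).trans (h0 0)
  have hsl := contDiff_slice hp.contDiff
  have hcd : ContDiff ℝ 2 (Function.uncurry fun s y => p s y * χ y) :=
    hp.contDiff.mul (hχ.comp contDiff_snd)
  refine ⟨hcd, ?_, ?_, ?_⟩
  · refine (hp.memLp.const_mul B).of_le hcd.continuous.aestronglyMeasurable (ae_of_all _ fun z => ?_)
    rw [norm_mul, norm_mul, Real.norm_eq_abs B, abs_of_nonneg hB, mul_comm B]
    exact mul_le_mul_of_nonneg_left (h0 _) (norm_nonneg _)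
  · refine ((hp.memLp.norm.const_mul B).add (hp.memLp_fderiv.const_mul B)).of_le
      (contDiff_fderiv_uncurry hcd).continuous.norm.aestronglyMeasurable (ae_of_all _ fun z => ?_)
    rw [norm_norm]
    refine le_trans ?_ (le_abs_self _)
    refine (norm_fderiv_mul_le ((hsl z.1).differentiable (by norm_num))
      (hχ.differentiable (by norm_num)) z.2).trans ?_
    simp only [Pi.add_apply]
    rw [mul_comm |p z.1 z.2|, Real.norm_eq_abs]
    exact add_le_add (mul_le_mul_of_nonneg_right (h1 _) (abs_nonneg _))
      (mul_le_mul_of_nonneg_right (h0 _) (norm_nonneg _))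
  · have hcont : Continuous fun z : ℝ × EuclideanSpace ℝ (Fin d) =>
        ‖fderiv ℝ (fderiv ℝ fun y => p z.1 y * χ y) z.2‖ :=
      (continuous_norm (E := EuclideanSpace ℝ (Fin d) →L[ℝ] EuclideanSpace ℝ (Fin d) →L[ℝ] ℝ)).comp
        (continuous_fderiv_fderiv_uncurry hcd)
    refine (((hp.memLp.norm.const_mul B).add (hp.memLp_fderiv.const_mul (2 * B))).add
      (hp.memLp_fderiv_fderiv.const_mul B)).of_le
      hcont.aestronglyMeasurable (ae_of_all _ fun z => ?_)
    rw [Real.norm_of_nonneg (norm_nonneg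
      (E := EuclideanSpace ℝ (Fin d) →L[ℝ] EuclideanSpace ℝ (Fin d) →L[ℝ] ℝ) _)]
    refine le_trans ?_ (le_abs_self _)
    refine (norm_fderiv_fderiv_mul_le (hsl z.1) hχ z.2).trans ?_
    simp only [Pi.add_apply]
    rw [Real.norm_eq_abs]
    have b1 := mul_le_mul_of_nonneg_left (h2 z.2) (abs_nonneg (p z.1 z.2))
    have b2 := mul_le_mul_of_nonneg_left (h1 z.2) (norm_nonneg (fderiv ℝ (p z.1) z.2))
    have b3 := mul_le_mul_of_nonneg_right (h0 z.2) (norm_nonneg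
      (E := EuclideanSpace ℝ (Fin d) →L[ℝ] EuclideanSpace ℝ (Fin d) →L[ℝ] ℝ)
      (fderiv ℝ (fderiv ℝ (p z.1)) z.2))
    linarith

/-- The part of the kernel `p` at distance of order at least `L` from the origin. -/
def tailKernel (p : ℝ → EuclideanSpace ℝ (Fin d) → ℝ) (L s : ℝ) (y : EuclideanSpace ℝ (Fin d)) : ℝ :=
  p s y * cutoff (L⁻¹ • y)

/-- The part of the kernel `p` supported in the ball of radius `L / 2`. -/
def headKernel (p : ℝ → EuclideanSpace ℝ (Fin d) → ℝ) (L s : ℝ) (y : EuclideanSpace ℝ (Fin d)) : ℝ :=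
  p s y * (1 - cutoff (L⁻¹ • y))

theorem contDiff_cutoff_smul (L : ℝ) :
    ContDiff ℝ 2 fun y : EuclideanSpace ℝ (Fin d) => cutoff (L⁻¹ • y) :=
  contDiff_cutoff.comp (by fun_prop)

theorem isSmoothKernel_tailKernel {μ : Measure ℝ} [SFinite μ]
    {p : ℝ → EuclideanSpace ℝ (Fin d) → ℝ} (hp : IsSmoothKernel μ p) {L : ℝ} (hL : 1 ≤ L) :
    IsSmoothKernel μ (tailKernel p L) := by
  obtain ⟨B, hB1, hB⟩ := exists_cutoff_bound (E := EuclideanSpace ℝ (Fin d))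
  exact hp.mul (contDiff_cutoff_smul L) (B := B)
    (fun y => by rw [abs_of_nonneg (cutoff_nonneg _)]; exact (cutoff_le_one _).trans hB1)
    (fun y => (hB L hL y).1.trans (div_le_self (by linarith) hL)) (fun y => (hB L hL y).2)

theorem isSmoothKernel_headKernel {μ : Measure ℝ} [SFinite μ]
    {p : ℝ → EuclideanSpace ℝ (Fin d) → ℝ} (hp : IsSmoothKernel μ p) {L : ℝ} (hL : 1 ≤ L) :
    IsSmoothKernel μ (headKernel p L) := by
  obtain ⟨B, hB1, hB⟩ := exists_cutoff_bound (E := EuclideanSpace ℝ (Fin d))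
  have e : fderiv ℝ (fun y : EuclideanSpace ℝ (Fin d) => 1 - cutoff (L⁻¹ • y))
      = fun y => -fderiv ℝ (fun y : EuclideanSpace ℝ (Fin d) => cutoff (L⁻¹ • y)) y := by
    ext1 y
    rw [fderiv_const_sub]
  refine hp.mul (contDiff_const.sub (contDiff_cutoff_smul L)) (B := B)
    (fun y => ?_) (fun y => ?_) (fun y => ?_)
  · rw [abs_of_nonneg (by linarith [cutoff_le_one (L⁻¹ • y)])]
    linarith [cutoff_nonneg (L⁻¹ • y)]
  · rw [e, norm_neg]
    exact (hB L hL y).1.trans (div_le_self (by linarith) hL)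
  · rw [e, fderiv_fun_neg]
    exact (norm_neg (E := EuclideanSpace ℝ (Fin d) →L[ℝ] EuclideanSpace ℝ (Fin d) →L[ℝ] ℝ)
      _).le.trans (hB L hL y).2

theorem inv_smul_norm_le_iff {L : ℝ} (hL : 0 < L) {c : ℝ} {y : EuclideanSpace ℝ (Fin d)} :
    ‖L⁻¹ • y‖ ≤ c ↔ ‖y‖ ≤ L * c := by
  rw [norm_smul, Real.norm_eq_abs, abs_of_pos (inv_pos.2 hL), inv_mul_le_iff₀ hL]

theorem le_inv_smul_norm_iff {L : ℝ} (hL : 0 < L) {c : ℝ} {y : EuclideanSpace ℝ (Fin d)} :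
    c ≤ ‖L⁻¹ • y‖ ↔ L * c ≤ ‖y‖ := by
  rw [norm_smul, Real.norm_eq_abs, abs_of_pos (inv_pos.2 hL), le_inv_mul_iff₀ hL]

theorem cutoff_inv_smul_eq_zero {L : ℝ} (hL : 0 < L) {y : EuclideanSpace ℝ (Fin d)}
    (hy : ‖y‖ ≤ L / 4) : cutoff (L⁻¹ • y) = 0 :=
  cutoff_eq_zero ((inv_smul_norm_le_iff hL).2 (by linarith))

theorem cutoff_inv_smul_eq_one {L : ℝ} (hL : 0 < L) {y : EuclideanSpace ℝ (Fin d)}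
    (hy : L / 2 ≤ ‖y‖) : cutoff (L⁻¹ • y) = 1 :=
  cutoff_eq_one ((le_inv_smul_norm_iff hL).2 (by linarith))

/-- The derivative of the tail of a kernel lives where the tail does. -/
theorem sq_norm_fderiv_tailKernel_le {p : ℝ → EuclideanSpace ℝ (Fin d) → ℝ}
    (hp : ContDiff ℝ 2 (Function.uncurry p)) {B : ℝ} (hB : ∀ L : ℝ, 1 ≤ L →
      ∀ y : EuclideanSpace ℝ (Fin d), ‖fderiv ℝ (fun y => cutoff (L⁻¹ • y)) y‖ ≤ B / L)
    {L : ℝ} (hL : 1 ≤ L) (s : ℝ) (y : EuclideanSpace ℝ (Fin d)) :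
    ‖fderiv ℝ (tailKernel p L s) y‖ ^ 2 ≤ {y : EuclideanSpace ℝ (Fin d) | L / 4 ≤ ‖y‖}.indicator
      (fun y => 2 * ‖fderiv ℝ (p s) y‖ ^ 2 + 2 * (B / L) ^ 2 * p s y ^ 2) y := by
  have hL0 : 0 < L := by linarith
  by_cases hy : L / 4 ≤ ‖y‖
  · rw [indicator_of_mem (by exact hy)]
    have h1 := norm_fderiv_mul_le ((contDiff_slice hp s).differentiable (by norm_num))
      ((contDiff_cutoff_smul (d := d) L).differentiable (by norm_num)) y
    have h2 := mul_le_mul_of_nonneg_left (hB L hL y) (abs_nonneg (p s y))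
    have h3 : |cutoff (L⁻¹ • y)| * ‖fderiv ℝ (p s) y‖ ≤ ‖fderiv ℝ (p s) y‖ := by
      rw [abs_of_nonneg (cutoff_nonneg _)]
      exact mul_le_of_le_one_left (norm_nonneg _) (cutoff_le_one _)
    have h4 : ‖fderiv ℝ (tailKernel p L s) y‖ ≤ |p s y| * (B / L) + ‖fderiv ℝ (p s) y‖ :=
      h1.trans (add_le_add h2 h3)
    calc ‖fderiv ℝ (tailKernel p L s) y‖ ^ 2
        ≤ (|p s y| * (B / L) + ‖fderiv ℝ (p s) y‖) ^ 2 := pow_le_pow_left₀ (norm_nonneg _) h4 2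
      _ ≤ 2 * ((|p s y| * (B / L)) ^ 2 + ‖fderiv ℝ (p s) y‖ ^ 2) := add_sq_le
      _ = _ := by rw [mul_pow, sq_abs]; ring
  · rw [indicator_of_notMem (by exact hy)]
    have : tailKernel p L s =ᶠ[𝓝 y] fun _ => 0 := by
      filter_upwards [(isOpen_lt continuous_norm continuous_const).mem_nhds (not_le.1 hy)] with w hw
      rw [tailKernel, cutoff_inv_smul_eq_zero hL0 (le_of_lt hw), mul_zero]
    rw [this.fderiv_eq]
    simp

end CutKernel

/-! ### The decomposition attached to a radial kernel -/

section Decomposition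

variable {d : ℕ}

theorem integral_shift_mul_shift {μ : Measure ℝ} [SFinite μ]
    (F G : ℝ × EuclideanSpace ℝ (Fin d) → ℝ) (x y : EuclideanSpace ℝ (Fin d)) :
    ∫ z, F (z.1, z.2 + x) * G (z.1, z.2 + y) ∂(μ.prod volume)
      = ∫ z, F z * G (z.1, z.2 + (y - x)) ∂(μ.prod volume) := by
  have h := (measurePreserving_shift μ x).integral_comp
    ((Homeomorph.refl ℝ).prodCongr (Homeomorph.addRight x)).measurableEmbedding
    (fun z => F z * G (z.1, z.2 + (y - x)))
  rw [← h]
  refine integral_congr_ae (ae_of_all _ fun z => ?_)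
  simp only
  rw [show z.2 + x + (y - x) = z.2 + y by abel]

/-- The covariance of a radial kernel is invariant under rotations: a reflection exchanges any two
vectors of the same length. -/
theorem integral_mul_shift_eq_of_norm_eq {μ : Measure ℝ} [SFinite μ]
    {p : ℝ → EuclideanSpace ℝ (Fin d) → ℝ} (hrad : ∀ s y y', ‖y‖ = ‖y'‖ → p s y = p s y')
    {x x' : EuclideanSpace ℝ (Fin d)} (hx : ‖x‖ = ‖x'‖) :
    ∫ z, p z.1 z.2 * p z.1 (z.2 + x) ∂(μ.prod volume)
      = ∫ z, p z.1 z.2 * p z.1 (z.2 + x') ∂(μ.prod volume) := by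
  let R : EuclideanSpace ℝ (Fin d) ≃ₗᵢ[ℝ] EuclideanSpace ℝ (Fin d) := (ℝ ∙ (x - x'))ᗮ.reflection
  have hR : R x = x' := Submodule.reflection_sub hx
  have hmp : MeasurePreserving (fun z : ℝ × EuclideanSpace ℝ (Fin d) => (z.1, R z.2))
      (μ.prod volume) (μ.prod volume) := (MeasurePreserving.id μ).prod R.measurePreserving
  have h := hmp.integral_comp ((Homeomorph.refl ℝ).prodCongr R.toHomeomorph).measurableEmbedding
    (fun z => p z.1 z.2 * p z.1 (z.2 + x'))
  rw [← h]
  refine integral_congr_ae (ae_of_all _ fun z => ?_)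
  simp only
  rw [← hR, ← map_add, hrad z.1 (R z.2) z.2 (R.norm_map _),
    hrad z.1 (R (z.2 + x)) (z.2 + x) (R.norm_map _)]

/-- Integrating the translates of a radial kernel against white noise yields an isotropic field. -/
theorem isIsotropicGaussianField_of_kernel {Ω : Type*} [MeasurableSpace Ω] {P : Measure Ω}
    {μ : Measure ℝ} [SFinite μ]
    {V : Lp ℝ 2 (μ.prod (volume : Measure (EuclideanSpace ℝ (Fin d)))) →ₗᵢ[ℝ] Lp ℝ 2 P}
    (hV : ∀ h, P.map (V h) = gaussianReal 0 (‖h‖₊ ^ 2)) (hd : 0 < d)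
    {p : ℝ → EuclideanSpace ℝ (Fin d) → ℝ} (hp : IsSmoothKernel μ p)
    (hrad : ∀ s y y', ‖y‖ = ‖y'‖ → p s y = p s y') {X : EuclideanSpace ℝ (Fin d) → Ω → ℝ}
    (hX : ∀ x, X x =ᵐ[P] V (shiftLp hp.memLp x)) : ∃ k, IsIsotropicGaussianField X k P := by
  refine ⟨fun r => ∫ z, p z.1 z.2 * p z.1 (z.2 + r • EuclideanSpace.single ⟨0, hd⟩ 1)
    ∂(μ.prod volume), isGaussianProcess_of_ae_eq hV hX, fun x => integral_of_ae_eq hV (hX x),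
    fun x y => ?_⟩
  rw [integral_mul_of_ae_eq (hX x) (hX y), inner_shiftLp hp.memLp hp.memLp,
    integral_shift_mul_shift (fun z => p z.1 z.2) (fun z => p z.1 z.2)]
  refine integral_mul_shift_eq_of_norm_eq hrad ?_
  rw [norm_smul, norm_norm, norm_sub_rev]
  simp

theorem tendsto_setIntegral_norm_ge_zero {μ : Measure ℝ} [SFinite μ]
    {F : ℝ × EuclideanSpace ℝ (Fin d) → ℝ} (hF : Integrable F (μ.prod volume)) :
    Tendsto (fun L : ℝ => ∫ z in {z : ℝ × EuclideanSpace ℝ (Fin d) | L / 4 ≤ ‖z.2‖}, F z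
      ∂(μ.prod volume)) atTop (𝓝 0) := by
  have hm : ∀ L : ℝ, MeasurableSet {z : ℝ × EuclideanSpace ℝ (Fin d) | L / 4 ≤ ‖z.2‖} := fun L =>
    measurableSet_le measurable_const measurable_snd.norm
  have h := tendsto_integral_filter_of_dominated_convergence (μ := μ.prod volume) (l := atTop)
    (F := fun (L : ℝ) => {z : ℝ × EuclideanSpace ℝ (Fin d) | L / 4 ≤ ‖z.2‖}.indicator F)
    (f := fun _ => 0) (fun z => ‖F z‖)
    (Eventually.of_forall fun L => hF.aestronglyMeasurable.indicator (hm L))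
    (Eventually.of_forall fun L => ae_of_all _ fun z => norm_indicator_le_norm_self _ _) hF.norm
    (ae_of_all _ fun z => by
      refine tendsto_const_nhds.congr' ?_
      filter_upwards [eventually_gt_atTop (4 * ‖z.2‖)] with L hL
      rw [indicator_of_notMem]
      simp only [mem_ofPred_eq, not_le]
      linarith)
  simpa only [integral_indicator (hm _), integral_zero] using h

/-- The variance of the derivative of the tail field is controlled by the kernel and its derivative
away from the origin. -/
theorem integral_sq_fderiv_tailKernel_le {μ : Measure ℝ} [SFinite μ]
    {p : ℝ → EuclideanSpace ℝ (Fin d) → ℝ} (hp : IsSmoothKernel μ p) {B : ℝ} (hB : ∀ L : ℝ, 1 ≤ L →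
      ∀ y : EuclideanSpace ℝ (Fin d), ‖fderiv ℝ (fun y => cutoff (L⁻¹ • y)) y‖ ≤ B / L)
    {L : ℝ} (hL : 1 ≤ L) (k : Fin d) :
    ∫ z, (fderiv ℝ (tailKernel p L z.1) z.2 (EuclideanSpace.single k 1)) ^ 2 ∂(μ.prod volume)
      ≤ 2 * (∫ z in {z : ℝ × EuclideanSpace ℝ (Fin d) | L / 4 ≤ ‖z.2‖},
          ‖fderiv ℝ (p z.1) z.2‖ ^ 2 ∂(μ.prod volume))
        + 2 * (B / L) ^ 2 * ∫ z in {z : ℝ × EuclideanSpace ℝ (Fin d) | L / 4 ≤ ‖z.2‖},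
          p z.1 z.2 ^ 2 ∂(μ.prod volume) := by
  have hm : MeasurableSet {z : ℝ × EuclideanSpace ℝ (Fin d) | L / 4 ≤ ‖z.2‖} :=
    measurableSet_le measurable_const measurable_snd.norm
  have i1 := hp.memLp_fderiv.integrable_sq
  have i0 := hp.memLp.integrable_sq
  have i2 := (isSmoothKernel_tailKernel hp hL).memLp_fderiv.integrable_sq
  have i3 := ((isSmoothKernel_tailKernel hp hL).memLp_partial k).integrable_sq
  rw [← integral_const_mul, ← integral_const_mul, ← integral_add
    (i1.integrableOn.const_mul 2) (i0.integrableOn.const_mul _), ← integral_indicator hm]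
  refine integral_mono i3 (((i1.const_mul 2).add (i0.const_mul _)).indicator hm) fun z => ?_
  have h1 : (fderiv ℝ (tailKernel p L z.1) z.2 (EuclideanSpace.single k 1)) ^ 2
      ≤ ‖fderiv ℝ (tailKernel p L z.1) z.2‖ ^ 2 := by
    rw [← sq_abs, ← Real.norm_eq_abs]
    refine pow_le_pow_left₀ (norm_nonneg _) ?_ 2
    exact (ContinuousLinearMap.le_opNorm _ _).trans (by simp)
  exact h1.trans (sq_norm_fderiv_tailKernel_le hp.contDiff hB hL z.1 z.2)

theorem integral_sq_tailKernel_le {μ : Measure ℝ} [SFinite μ]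
    {p : ℝ → EuclideanSpace ℝ (Fin d) → ℝ} (hp : IsSmoothKernel μ p) {L : ℝ} (hL : 1 ≤ L) :
    ∫ z, tailKernel p L z.1 z.2 ^ 2 ∂(μ.prod volume)
      ≤ ∫ z in {z : ℝ × EuclideanSpace ℝ (Fin d) | L / 4 ≤ ‖z.2‖},
          p z.1 z.2 ^ 2 ∂(μ.prod volume) := by
  have hm : MeasurableSet {z : ℝ × EuclideanSpace ℝ (Fin d) | L / 4 ≤ ‖z.2‖} :=
    measurableSet_le measurable_const measurable_snd.norm
  rw [← integral_indicator hm]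
  refine integral_mono (isSmoothKernel_tailKernel hp hL).memLp.integrable_sq
    (hp.memLp.integrable_sq.indicator hm) fun z => ?_
  by_cases hz : L / 4 ≤ ‖z.2‖
  · simp only
    rw [indicator_of_mem (by exact hz), tailKernel, mul_pow]
    exact mul_le_of_le_one_right (sq_nonneg _)
      (pow_le_one₀ (cutoff_nonneg _) (cutoff_le_one _))
  · simp only
    rw [indicator_of_notMem (by exact hz), tailKernel,
      cutoff_inv_smul_eq_zero (by linarith) (le_of_not_ge hz)]
    simp

/-- **Decomposition criterion.** If the field has the covariance of the white noise integral of the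
translates of a smooth radial kernel `p`, then cutting `p` off at distance of order `L` yields a
local-global decomposition as soon as the tails of `p` satisfy the relevant bounds. -/
theorem hasLocalGlobalDecomposition_of_kernel {Ω : Type*} [MeasurableSpace Ω] {P : Measure Ω}
    {f : EuclideanSpace ℝ (Fin d) → Ω → ℝ} {K : ℝ → ℝ} (hf : IsIsotropicGaussianField f K P)
    (hd : 0 < d) {μ : Measure ℝ} [SFinite μ]
    {p : ℝ → EuclideanSpace ℝ (Fin d) → ℝ} (hp : IsSmoothKernel μ p)
    (hrad : ∀ s y y', ‖y‖ = ‖y'‖ → p s y = p s y')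
    (hK : ∀ x, ∫ z, p z.1 z.2 * p z.1 (z.2 + x) ∂(μ.prod volume) = K ‖x‖)
    (hcov : ∀ ε : ℝ, 0 < ε → ∃ M₀ L₀ : ℝ, ∀ L ≥ L₀, ∀ x : EuclideanSpace ℝ (Fin d), M₀ * L ≤ ‖x‖ →
      |(∫ z, tailKernel p L z.1 z.2 * tailKernel p L z.1 (z.2 + x) ∂(μ.prod volume)) / K ‖x‖ - 1| ≤ ε)
    (hvar : (fun L : ℝ => ∫ z in {z : ℝ × EuclideanSpace ℝ (Fin d) | L / 4 ≤ ‖z.2‖},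
      p z.1 z.2 ^ 2 ∂(μ.prod volume)) =O[atTop] K)
    (hder : (∃ u : ℝ → ℝ, Tendsto u atTop (𝓝 0) ∧ ∀ᶠ L in atTop, |1 / K L| = L ^ (u L)) →
      (fun L : ℝ => ∫ z in {z : ℝ × EuclideanSpace ℝ (Fin d) | L / 4 ≤ ‖z.2‖},
      ‖fderiv ℝ (p z.1) z.2‖ ^ 2 ∂(μ.prod volume)) =O[atTop] fun L => L ^ (-2 : ℝ) * K L) :
    HasLocalGlobalDecomposition f K P := by
  obtain ⟨Ω', mΩ', P', hP', V, hV⟩ :=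
    exists_isonormal (Lp ℝ 2 (μ.prod (volume : Measure (EuclideanSpace ℝ (Fin d)))))
  have hL1 : ∀ L : ℝ, 1 ≤ max L 1 := fun L => le_max_right _ _
  have hh := fun L : ℝ => isSmoothKernel_headKernel hp (hL1 L)
  have ht := fun L : ℝ => isSmoothKernel_tailKernel hp (hL1 L)
  have hradc : ∀ (L : ℝ) (y y' : EuclideanSpace ℝ (Fin d)), ‖y‖ = ‖y'‖ →
      cutoff (L⁻¹ • y) = cutoff (L⁻¹ • y') := fun L y y' h => by
    rw [cutoff, cutoff, norm_smul, norm_smul, h]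
  have hradh : ∀ L s y y', ‖y‖ = ‖y'‖ → headKernel p L s y = headKernel p L s y' :=
    fun L s y y' h => by rw [headKernel, headKernel, hrad s y y' h, hradc L y y' h]
  have hradt : ∀ L s y y', ‖y‖ = ‖y'‖ → tailKernel p L s y = tailKernel p L s y' :=
    fun L s y y' h => by rw [tailKernel, tailKernel, hrad s y y' h, hradc L y y' h]
  have hfex : ∀ L : ℝ, ∃ X : EuclideanSpace ℝ (Fin d) → Ω' → ℝ,
      (∀ x, X x =ᵐ[P'] V (shiftLp (hh L).memLp x)) ∧ (∀ᵐ ω ∂P', ContDiff ℝ 1 fun x => X x ω) ∧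
      ∀ k x, (fun ω => fderiv ℝ (fun x => X x ω) x (EuclideanSpace.single k 1))
        =ᵐ[P'] V (shiftLp ((hh L).memLp_partial k) x) := fun L => by
    obtain ⟨C, h1, h2, h3⟩ := (hh L).exists_bounds
    exact exists_contDiff_field hV h1 h2 h3
  have hgex : ∀ L : ℝ, ∃ X : EuclideanSpace ℝ (Fin d) → Ω' → ℝ,
      (∀ x, X x =ᵐ[P'] V (shiftLp (ht L).memLp x)) ∧ (∀ᵐ ω ∂P', ContDiff ℝ 1 fun x => X x ω) ∧
      ∀ k x, (fun ω => fderiv ℝ (fun x => X x ω) x (EuclideanSpace.single k 1))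
        =ᵐ[P'] V (shiftLp ((ht L).memLp_partial k) x) := fun L => by
    obtain ⟨C, h1, h2, h3⟩ := (ht L).exists_bounds
    exact exists_contDiff_field hV h1 h2 h3
  choose fL hfV hfC hfD using hfex
  choose gL hgV hgC hgD using hgex
  have hgcov : ∀ L : ℝ, 1 ≤ L → ∀ x, ∫ ω, gL L 0 ω * gL L x ω ∂P'
      = ∫ z, tailKernel p L z.1 z.2 * tailKernel p L z.1 (z.2 + x) ∂(μ.prod volume) :=
    fun L hL x => by
      rw [integral_mul_of_ae_eq (hgV L 0) (hgV L x), inner_shiftLp, max_eq_left hL]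
      simp only [add_zero]
  have hgvar : ∀ L : ℝ, 1 ≤ L → ∫ ω, gL L 0 ω ^ 2 ∂P'
      ≤ ∫ z in {z : ℝ × EuclideanSpace ℝ (Fin d) | L / 4 ≤ ‖z.2‖}, p z.1 z.2 ^ 2 ∂(μ.prod volume) :=
    fun L hL => by
      refine le_trans (le_of_eq ?_) (integral_sq_tailKernel_le hp hL)
      simp only [sq]
      rw [hgcov L hL]
      simp only [add_zero]
  obtain ⟨B, -, hB⟩ := exists_cutoff_bound (E := EuclideanSpace ℝ (Fin d))
  have hB' := fun L hL y => (hB L hL y).1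
  have hne : Nonempty (Fin d) := ⟨⟨0, hd⟩⟩
  have hgder : ∀ L : ℝ, 1 ≤ L → maxDerivVariance (gL L) P'
      ≤ 2 * (∫ z in {z : ℝ × EuclideanSpace ℝ (Fin d) | L / 4 ≤ ‖z.2‖},
          ‖fderiv ℝ (p z.1) z.2‖ ^ 2 ∂(μ.prod volume))
        + 2 * (B / L) ^ 2 * ∫ z in {z : ℝ × EuclideanSpace ℝ (Fin d) | L / 4 ≤ ‖z.2‖},
          p z.1 z.2 ^ 2 ∂(μ.prod volume) := fun L hL => by
    refine ciSup_le fun k => ?_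
    refine le_trans (le_of_eq ?_) (integral_sq_fderiv_tailKernel_le hp hB' hL k)
    simp only [sq]
    rw [integral_mul_of_ae_eq (hgD L k 0) (hgD L k 0), inner_shiftLp, max_eq_left hL]
    simp only [add_zero]
  have hgder0 : ∀ L, 0 ≤ maxDerivVariance (gL L) P' := fun L =>
    Real.iSup_nonneg fun k => integral_nonneg fun ω => sq_nonneg _
  have t1 := tendsto_setIntegral_norm_ge_zero hp.memLp_fderiv.integrable_sq
  have t0 := tendsto_setIntegral_norm_ge_zero hp.memLp.integrable_sq
  have tB : Tendsto (fun L : ℝ => 2 * (B / L) ^ 2) atTop (𝓝 0) := by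
    simpa using ((tendsto_const_nhds (x := B)).div_atTop tendsto_id).pow 2 |>.const_mul 2
  refine ⟨Ω', mΩ', P', fL, gL, hP', fun L hL => ⟨?_, ?_, ?_, ?_, ?_, ?_⟩, ?_, ?_, ?_, ?_⟩
  · exact isIsotropicGaussianField_of_kernel hV hd (hh L) (hradh _) (hfV L)
  · exact isIsotropicGaussianField_of_kernel hV hd (ht L) (hradt _) (hgV L)
  · filter_upwards [hfC L] with ω hω
    exact hω.of_le (by norm_num)
  · filter_upwards [hgC L] with ω hω
    exact hω
  · have hsum : ∀ x, (fun ω => fL L x ω + gL L x ω) =ᵐ[P'] V (shiftLp hp.memLp x) := fun x => by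
      have e : shiftLp hp.memLp x = shiftLp (hh L).memLp x + shiftLp (ht L).memLp x := by
        refine Lp.ext ?_
        filter_upwards [Lp.coeFn_add (shiftLp (hh L).memLp x) (shiftLp (ht L).memLp x),
          coeFn_shiftLp hp.memLp x, coeFn_shiftLp (hh L).memLp x,
          coeFn_shiftLp (ht L).memLp x] with z e1 e2 e3 e4
        rw [e1, Pi.add_apply, e2, e3, e4, headKernel, tailKernel]
        ring
      rw [e, map_add]
      filter_upwards [hfV L x, hgV L x, Lp.coeFn_add (V (shiftLp (hh L).memLp x))
        (V (shiftLp (ht L).memLp x))] with ω h1 h2 h3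
      rw [h3, Pi.add_apply, h1, h2]
    refine sameLaw_of_covariance_eq hf.gaussian (isGaussianProcess_of_ae_eq hV hsum) hf.centred
      (fun x => integral_of_ae_eq hV (hsum x)) fun x y => ?_
    rw [hf.covariance, integral_mul_of_ae_eq (hsum x) (hsum y), inner_shiftLp,
      integral_shift_mul_shift (fun z => p z.1 z.2) (fun z => p z.1 z.2), hK, norm_sub_rev]
  · intro x hx
    rw [integral_mul_of_ae_eq (hfV L 0) (hfV L x), inner_shiftLp, max_eq_left hL]
    refine integral_eq_zero_of_ae (ae_of_all _ fun z => ?_)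
    have hz : ∀ y : EuclideanSpace ℝ (Fin d), L / 2 ≤ ‖y‖ → headKernel p L z.1 y = 0 :=
      fun y hy => by rw [headKernel, cutoff_inv_smul_eq_one (by linarith) hy, sub_self, mul_zero]
    rcases le_total (L / 2) ‖z.2‖ with h | h
    · simp only [add_zero, Pi.zero_apply]
      rw [hz z.2 h, zero_mul]
    · simp only [Pi.zero_apply]
      rw [hz (z.2 + x), mul_zero]
      have := norm_sub_le (z.2 + x) z.2
      rw [add_sub_cancel_left] at this
      linarith
  · refine ENNReal.tendsto_nhds_zero.2 fun ε hε => ?_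
    obtain ⟨δ, hδ0, hδ⟩ := ENNReal.lt_iff_exists_real_btwn.1 hε
    have hδ0' : 0 < δ := by simpa using hδ.1
    obtain ⟨M₀, L₀, h⟩ := hcov δ hδ0'
    filter_upwards [eventually_ge_atTop M₀] with M hM
    refine limsup_le_of_le (by isBoundedDefault) ?_
    filter_upwards [eventually_ge_atTop L₀, eventually_ge_atTop 1] with L h1 h2
    refine iSup₂_le fun x hx => le_trans (ENNReal.ofReal_le_ofReal ?_) hδ.2.le
    rw [hgcov L h2]
    exact h L h1 x ((mul_le_mul_of_nonneg_right hM (by linarith)).trans hx)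
  · refine IsBigO.trans (IsBigO.of_bound 1 ?_) hvar
    filter_upwards [eventually_ge_atTop 1] with L hL
    rw [Real.norm_of_nonneg (integral_nonneg fun ω => sq_nonneg _), one_mul]
    exact (hgvar L hL).trans (le_abs_self _)
  · refine (isLittleO_one_iff ℝ).2 ?_
    refine tendsto_of_tendsto_of_tendsto_of_le_of_le' tendsto_const_nhds
      (by simpa using (t1.const_mul 2).add (tB.mul t0)) (Eventually.of_forall hgder0) ?_
    filter_upwards [eventually_ge_atTop 1] with L hL
    exact hgder L hL
  · intro hu
    have h1 := hder hu
    have h2 : (fun L : ℝ => 2 * (B / L) ^ 2) =O[atTop] fun L : ℝ => L ^ (-2 : ℝ) := by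
      refine IsBigO.of_bound (2 * B ^ 2) ?_
      filter_upwards [eventually_ge_atTop 1] with L hL
      rw [Real.norm_of_nonneg (by positivity), Real.norm_of_nonneg (by positivity),
        Real.rpow_neg (by linarith), Real.rpow_two, div_pow]
      exact le_of_eq (by ring)
    refine IsBigO.trans (IsBigO.of_bound 1 ?_) ((h1.const_mul_left 2).add (h2.mul hvar))
    filter_upwards [eventually_ge_atTop 1] with L hL
    rw [Real.norm_of_nonneg (hgder0 L), one_mul]
    exact (hgder L hL).trans (le_abs_self _)

end Decomposition

/-! ### The effect of the cutoff on the covariance -/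

section CutCovariance

variable {d : ℕ}

theorem integrable_mul_shift {μ : Measure ℝ} [SFinite μ] {F : ℝ × EuclideanSpace ℝ (Fin d) → ℝ}
    (hF : MemLp F 2 (μ.prod volume)) (x : EuclideanSpace ℝ (Fin d)) :
    Integrable (fun z => F z * F (z.1, z.2 + x)) (μ.prod volume) :=
  hF.integrable_mul (hF.comp_measurePreserving (measurePreserving_shift μ x))

/-- Cutting off a radial kernel changes its covariance by at most the contribution of the points
close to the origin. -/
theorem abs_integral_sub_integral_tailKernel_le {μ : Measure ℝ} [SFinite μ]
    {p : ℝ → EuclideanSpace ℝ (Fin d) → ℝ} (hp : IsSmoothKernel μ p)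
    (hrad : ∀ s y y', ‖y‖ = ‖y'‖ → p s y = p s y') {L : ℝ} (hL : 1 ≤ L)
    (x : EuclideanSpace ℝ (Fin d)) :
    |(∫ z, p z.1 z.2 * p z.1 (z.2 + x) ∂(μ.prod volume))
        - ∫ z, tailKernel p L z.1 z.2 * tailKernel p L z.1 (z.2 + x) ∂(μ.prod volume)|
      ≤ 2 * ∫ z in {z : ℝ × EuclideanSpace ℝ (Fin d) | ‖z.2‖ ≤ L / 2},
          |p z.1 z.2 * p z.1 (z.2 + x)| ∂(μ.prod volume) := by
  have hL0 : 0 < L := by linarith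
  set A := {z : ℝ × EuclideanSpace ℝ (Fin d) | ‖z.2‖ ≤ L / 2}
  have hA : MeasurableSet A := measurableSet_le measurable_snd.norm measurable_const
  have i1 := integrable_mul_shift hp.memLp x
  have i2 := integrable_mul_shift (isSmoothKernel_tailKernel hp hL).memLp x
  set G : ℝ × EuclideanSpace ℝ (Fin d) → ℝ := A.indicator fun z => |p z.1 z.2 * p z.1 (z.2 + x)|
  have iG : Integrable G (μ.prod volume) := i1.abs.indicator hA
  have hT : MeasurePreserving (fun z : ℝ × EuclideanSpace ℝ (Fin d) => (z.1, -(z.2 + x)))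
      (μ.prod volume) (μ.prod volume) := (MeasurePreserving.id μ).prod
    ((Measure.measurePreserving_neg volume).comp (measurePreserving_add_right volume x))
  have hTe : MeasurableEmbedding fun z : ℝ × EuclideanSpace ℝ (Fin d) => (z.1, -(z.2 + x)) :=
    ((Homeomorph.refl ℝ).prodCongr ((Homeomorph.addRight x).trans
      (Homeomorph.neg _))).measurableEmbedding
  have iGT : Integrable (fun z : ℝ × EuclideanSpace ℝ (Fin d) => G (z.1, -(z.2 + x)))
    (μ.prod volume) := hT.integrable_comp_of_integrable iG
  have eGT : ∫ z, G (z.1, -(z.2 + x)) ∂(μ.prod volume) = ∫ z, G z ∂(μ.prod volume) :=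
    hT.integral_comp hTe G
  have hone : ∀ y : EuclideanSpace ℝ (Fin d), 1 - cutoff (L⁻¹ • y) ≤ if ‖y‖ ≤ L / 2 then 1 else 0 :=
    fun y => by
      split_ifs with h
      · linarith [cutoff_nonneg (L⁻¹ • y)]
      · rw [cutoff_inv_smul_eq_one hL0 (le_of_not_ge h), sub_self]
  have hbound : ∀ z, |p z.1 z.2 * p z.1 (z.2 + x)
      - tailKernel p L z.1 z.2 * tailKernel p L z.1 (z.2 + x)| ≤ G z + G (z.1, -(z.2 + x)) := fun z => by
    have e : p z.1 z.2 * p z.1 (z.2 + x) - tailKernel p L z.1 z.2 * tailKernel p L z.1 (z.2 + x)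
        = p z.1 z.2 * p z.1 (z.2 + x) * (1 - cutoff (L⁻¹ • z.2) * cutoff (L⁻¹ • (z.2 + x))) := by
      rw [tailKernel, tailKernel]
      ring
    have hG1 : G z = |p z.1 z.2 * p z.1 (z.2 + x)| * if ‖z.2‖ ≤ L / 2 then 1 else 0 := by
      by_cases h : ‖z.2‖ ≤ L / 2
      · rw [if_pos h, mul_one]; exact indicator_of_mem (by exact h) _
      · rw [if_neg h, mul_zero]; exact indicator_of_notMem (by exact h) _
    have hG2 : G (z.1, -(z.2 + x))
        = |p z.1 z.2 * p z.1 (z.2 + x)| * if ‖z.2 + x‖ ≤ L / 2 then 1 else 0 := by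
      have e1 : p z.1 (-(z.2 + x)) = p z.1 (z.2 + x) := hrad _ _ _ (norm_neg _)
      have e2 : p z.1 (-(z.2 + x) + x) = p z.1 z.2 :=
        hrad _ _ _ (by rw [neg_add_rev, neg_add_cancel_comm, norm_neg])
      by_cases h : ‖z.2 + x‖ ≤ L / 2
      · rw [if_pos h, mul_one]
        refine (indicator_of_mem ?_ _).trans ?_
        · change ‖-(z.2 + x)‖ ≤ L / 2
          rwa [norm_neg]
        · simp only
          rw [e1, e2, mul_comm]
      · rw [if_neg h, mul_zero]
        refine indicator_of_notMem ?_ _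
        change ¬ ‖-(z.2 + x)‖ ≤ L / 2
        rwa [norm_neg]
    have a1 := cutoff_nonneg (L⁻¹ • z.2)
    have a2 := cutoff_le_one (L⁻¹ • z.2)
    have a3 := cutoff_nonneg (L⁻¹ • (z.2 + x))
    have a4 := cutoff_le_one (L⁻¹ • (z.2 + x))
    rw [e, hG1, hG2, abs_mul, ← mul_add]
    refine mul_le_mul_of_nonneg_left ?_ (abs_nonneg _)
    rw [abs_of_nonneg (by nlinarith)]
    nlinarith [hone z.2, hone (z.2 + x)]
  rw [← integral_sub i1 i2]
  calc |∫ z, (p z.1 z.2 * p z.1 (z.2 + x)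
        - tailKernel p L z.1 z.2 * tailKernel p L z.1 (z.2 + x)) ∂(μ.prod volume)|
      ≤ ∫ z, |p z.1 z.2 * p z.1 (z.2 + x)
        - tailKernel p L z.1 z.2 * tailKernel p L z.1 (z.2 + x)| ∂(μ.prod volume) :=
        abs_integral_le_integral_abs
    _ ≤ ∫ z, (G z + G (z.1, -(z.2 + x))) ∂(μ.prod volume) :=
        integral_mono (i1.sub i2).abs (iG.add iGT) hbound
    _ = 2 * ∫ z, G z ∂(μ.prod volume) := by rw [integral_add iG iGT, eGT]; ring
    _ = _ := by rw [integral_indicator hA]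

end CutCovariance

/-! ### Regularly varying covariances -/

theorem isBigO_comp_const_mul {K ℓ : ℝ → ℝ} {α : ℝ} (hℓ : IsSlowlyVarying ℓ)
    (hK : K ~[atTop] fun r => r ^ (-α) * ℓ r) {a : ℝ} (ha : 0 < a) :
    (fun r => K (a * r)) =O[atTop] K := by
  have ht : Tendsto (fun r : ℝ => a * r) atTop atTop := tendsto_id.const_mul_atTop ha
  have h1 : (fun r => K (a * r)) =O[atTop] fun r => (a * r) ^ (-α) * ℓ (a * r) :=
    hK.isBigO.comp_tendsto ht
  have h2 : (fun r => (a * r) ^ (-α) * ℓ (a * r))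
      =ᶠ[atTop] fun r => a ^ (-α) * (ℓ (a * r) / ℓ r) * (r ^ (-α) * ℓ r) := by
    filter_upwards [eventually_gt_atTop 0] with r hr
    have := (hℓ.pos r hr).ne'
    rw [Real.mul_rpow ha.le hr.le]
    field_simp
  have h3 : (fun r => a ^ (-α) * (ℓ (a * r) / ℓ r)) =O[atTop] fun _ => (1 : ℝ) :=
    ((hℓ.tendsto_ratio a ha).const_mul _).isBigO_one ℝ
  have h4 := h3.mul (isBigO_refl (fun r => r ^ (-α) * ℓ r) atTop)
  simp only [one_mul] at h4
  exact (h1.trans (h2.trans_isBigO h4)).trans hK.symm.isBigO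

theorem eventually_pos_of_isEquivalent {K ℓ : ℝ → ℝ} {α : ℝ} (hℓ : IsSlowlyVarying ℓ)
    (hK : K ~[atTop] fun r => r ^ (-α) * ℓ r) : ∀ᶠ r in atTop, 0 < K r := by
  obtain ⟨φ, hφ, h⟩ := hK.exists_eq_mul
  filter_upwards [h, hφ.eventually_const_lt (zero_lt_one' ℝ), eventually_gt_atTop 0] with r h1 h2 h3
  rw [h1]
  have := hℓ.pos r h3
  simp only [Pi.mul_apply]
  positivity

/-! ### Covariances which are mixtures of Gaussians -/

section GaussianKernel

theorem norm_fderiv_smul_le {E F : Type*} [NormedAddCommGroup E] [NormedSpace ℝ E]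
    [NormedAddCommGroup F] [NormedSpace ℝ F] {c : E → ℝ} (hc : Differentiable ℝ c) (A : E →L[ℝ] F)
    (y : E) : ‖fderiv ℝ (fun y => c y • A y) y‖ ≤ |c y| * ‖A‖ + ‖fderiv ℝ c y‖ * ‖A y‖ := by
  have h : fderiv ℝ (fun y => c y • A y) y = c y • A + (fderiv ℝ c y).smulRight (A y) :=
    ((hc y).hasFDerivAt.smul A.hasFDerivAt).fderiv
  rw [h]
  refine (norm_add_le _ _).trans ?_
  rw [norm_smul, Real.norm_eq_abs, ContinuousLinearMap.norm_smulRight_apply]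

variable {d : ℕ}

/-- The Gaussian kernel, whose variance is proportional to `1 / s`. -/
def gaussKernel (s : ℝ) (y : EuclideanSpace ℝ (Fin d)) : ℝ := Real.exp (-2 * s * ‖y‖ ^ 2)

theorem gaussKernel_pos (s : ℝ) (y : EuclideanSpace ℝ (Fin d)) : 0 < gaussKernel s y :=
  Real.exp_pos _

theorem contDiff_uncurry_gaussKernel :
    ContDiff ℝ 2 (Function.uncurry (gaussKernel : ℝ → EuclideanSpace ℝ (Fin d) → ℝ)) :=
  ((contDiff_const.mul contDiff_fst).mul ((contDiff_norm_sq ℝ).comp contDiff_snd)).exp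

theorem fderiv_gaussKernel (s : ℝ) : fderiv ℝ (gaussKernel s : EuclideanSpace ℝ (Fin d) → ℝ)
    = fun y => (-4 * s * gaussKernel s y) • innerSL ℝ y := by
  ext1 y
  have h : HasFDerivAt (gaussKernel s : EuclideanSpace ℝ (Fin d) → ℝ)
      (gaussKernel s y • ((-2 * s) • (2 • innerSL ℝ y))) y :=
    (((hasStrictFDerivAt_norm_sq y).hasFDerivAt).const_mul (-2 * s)).exp
  rw [h.fderiv, ← Nat.cast_smul_eq_nsmul ℝ, smul_smul, smul_smul]
  congr 1
  push_cast
  ring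

theorem norm_fderiv_gaussKernel {s : ℝ} (hs : 0 ≤ s) (y : EuclideanSpace ℝ (Fin d)) :
    ‖fderiv ℝ (gaussKernel s) y‖ = 4 * s * ‖y‖ * gaussKernel s y := by
  rw [fderiv_gaussKernel, norm_smul, innerSL_apply_norm, Real.norm_eq_abs, abs_mul, abs_mul,
    abs_of_nonneg hs, abs_of_pos (gaussKernel_pos s y)]
  norm_num
  ring

theorem norm_fderiv_fderiv_gaussKernel_le {s : ℝ} (hs : 0 ≤ s) (y : EuclideanSpace ℝ (Fin d)) :
    ‖fderiv ℝ (fderiv ℝ (gaussKernel s)) y‖ ≤ (4 * s + 16 * (s * ‖y‖) ^ 2) * gaussKernel s y := by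
  have hdiff : Differentiable ℝ (gaussKernel s : EuclideanSpace ℝ (Fin d) → ℝ) :=
    (contDiff_slice contDiff_uncurry_gaussKernel s).differentiable (by norm_num)
  have hd2 : Differentiable ℝ fun y : EuclideanSpace ℝ (Fin d) => -4 * s * gaussKernel s y :=
    hdiff.const_mul _
  have h1 := norm_fderiv_smul_le hd2 (innerSL ℝ) y
  have h2 : ‖fderiv ℝ (fun y : EuclideanSpace ℝ (Fin d) => -4 * s * gaussKernel s y) y‖
      = 4 * s * (4 * s * ‖y‖ * gaussKernel s y) := by
    rw [fderiv_const_mul (hdiff y), norm_smul, norm_fderiv_gaussKernel hs, Real.norm_eq_abs,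
      abs_mul, abs_of_nonneg hs]
    norm_num
  have h3 : |-4 * s * gaussKernel s y| = 4 * s * gaussKernel s y := by
    rw [abs_mul, abs_mul, abs_of_nonneg hs, abs_of_pos (gaussKernel_pos s y)]
    norm_num
  rw [h2, h3, innerSL_apply_norm] at h1
  rw [fderiv_gaussKernel]
  refine h1.trans ?_
  have h4 : ‖innerSL ℝ (E := EuclideanSpace ℝ (Fin d))‖ ≤ 1 := norm_innerSL_le ℝ
  have h5 := mul_le_mul_of_nonneg_left h4
    (mul_nonneg (mul_nonneg (by norm_num : (0 : ℝ) ≤ 4) hs) (gaussKernel_pos s y).le)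
  linarith

theorem gaussKernel_sq (s : ℝ) (y : EuclideanSpace ℝ (Fin d)) :
    gaussKernel s y ^ 2 = Real.exp (-4 * s * ‖y‖ ^ 2) := by
  rw [gaussKernel, ← Real.exp_nat_mul]
  congr 1
  push_cast
  ring

theorem sq_norm_fderiv_gaussKernel_le {s : ℝ} (hs : 0 ≤ s) (y : EuclideanSpace ℝ (Fin d)) :
    ‖fderiv ℝ (gaussKernel s) y‖ ^ 2 ≤ 8 * s * Real.exp (-2 * s * ‖y‖ ^ 2) := by
  rw [norm_fderiv_gaussKernel hs, mul_pow, gaussKernel_sq]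
  have h1 : 2 * (s * ‖y‖ ^ 2) ≤ Real.exp (2 * s * ‖y‖ ^ 2) := by
    have := Real.add_one_le_exp (2 * s * ‖y‖ ^ 2)
    linarith
  have h2 : Real.exp (-2 * s * ‖y‖ ^ 2)
      = Real.exp (2 * s * ‖y‖ ^ 2) * Real.exp (-4 * s * ‖y‖ ^ 2) := by
    rw [← Real.exp_add]
    ring_nf
  rw [h2]
  have h3 := mul_le_mul_of_nonneg_left h1 (mul_nonneg (by norm_num : (0 : ℝ) ≤ 8) hs)
  have h4 := mul_le_mul_of_nonneg_right h3 (Real.exp_pos (-4 * s * ‖y‖ ^ 2)).le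
  refine le_trans (le_of_eq ?_) (h4.trans (le_of_eq ?_)) <;> ring

theorem sq_norm_fderiv_fderiv_gaussKernel_le {s : ℝ} (hs : 0 ≤ s) (y : EuclideanSpace ℝ (Fin d)) :
    ‖fderiv ℝ (fderiv ℝ (gaussKernel s)) y‖ ^ 2
      ≤ 256 * s ^ 2 * Real.exp (-2 * s * ‖y‖ ^ 2) := by
  have h0 := pow_le_pow_left₀ (norm_nonneg
    (E := EuclideanSpace ℝ (Fin d) →L[ℝ] EuclideanSpace ℝ (Fin d) →L[ℝ] ℝ) _)
    (norm_fderiv_fderiv_gaussKernel_le hs y) 2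
  refine h0.trans ?_
  have h1 : 1 + s * ‖y‖ ^ 2 ≤ Real.exp (s * ‖y‖ ^ 2) := by
    have := Real.add_one_le_exp (s * ‖y‖ ^ 2)
    linarith
  have hs2 : 0 ≤ s * ‖y‖ ^ 2 := by positivity
  have h2 : 4 * s + 16 * (s * ‖y‖) ^ 2 ≤ 16 * s * Real.exp (s * ‖y‖ ^ 2) := by
    have := mul_le_mul_of_nonneg_left h1 (mul_nonneg (by norm_num : (0 : ℝ) ≤ 16) hs)
    nlinarith
  have h3 := mul_le_mul_of_nonneg_right h2 (gaussKernel_pos s y).le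
  refine (pow_le_pow_left₀ (mul_nonneg (by positivity) (gaussKernel_pos s y).le) h3 2).trans
    (le_of_eq ?_)
  have e : Real.exp (-2 * s * ‖y‖ ^ 2)
      = (Real.exp (s * ‖y‖ ^ 2) * gaussKernel s y) ^ 2 := by
    rw [gaussKernel, ← Real.exp_add, ← Real.exp_nat_mul]
    congr 1
    push_cast
    ring
  rw [e]
  ring

theorem gaussKernel_mul_shift (s : ℝ) (x y : EuclideanSpace ℝ (Fin d)) :
    gaussKernel s y * gaussKernel s (y + x)
      = Real.exp (-s * ‖x‖ ^ 2) * Real.exp (-(4 * s) * ‖y + (2⁻¹ : ℝ) • x‖ ^ 2) := by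
  rw [gaussKernel, gaussKernel, ← Real.exp_add, ← Real.exp_add, norm_add_sq_real, norm_add_sq_real,
    inner_smul_right, norm_smul, Real.norm_eq_abs, abs_of_pos (by norm_num)]
  congr 1
  ring

theorem integral_exp_neg_mul_sq_norm {b : ℝ} (hb : 0 < b) :
    ∫ y : EuclideanSpace ℝ (Fin d), Real.exp (-b * ‖y‖ ^ 2) = (Real.pi / b) ^ ((d : ℝ) / 2) := by
  rw [GaussianFourier.integral_rexp_neg_mul_sq_norm hb, finrank_euclideanSpace_fin]

theorem integrable_exp_neg_mul_sq_norm {b : ℝ} (hb : 0 < b) :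
    Integrable fun y : EuclideanSpace ℝ (Fin d) => Real.exp (-b * ‖y‖ ^ 2) :=
  Integrable.of_integral_ne_zero (by rw [integral_exp_neg_mul_sq_norm hb]; positivity)

theorem lintegral_exp_neg_mul_sq_norm {b : ℝ} (hb : 0 < b) :
    ∫⁻ y : EuclideanSpace ℝ (Fin d), ENNReal.ofReal (Real.exp (-b * ‖y‖ ^ 2))
      = ENNReal.ofReal ((Real.pi / b) ^ ((d : ℝ) / 2)) := by
  rw [← integral_exp_neg_mul_sq_norm hb, ofReal_integral_eq_lintegral_ofReal
    (integrable_exp_neg_mul_sq_norm hb) (ae_of_all _ fun _ => (Real.exp_pos _).le)]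

/-- The mixing measure of the Gaussian kernels corresponding to the density `v` of the Laplace
transform; the weight normalises the autocorrelation of `gaussKernel s`. -/
def mixingMeasure (d : ℕ) (v : ℝ → ℝ) : Measure ℝ :=
  (volume.restrict (Ioi 0)).withDensity fun s =>
    ENNReal.ofReal ((Real.pi / (4 * s)) ^ (-((d : ℝ) / 2)) * v s)

instance sFinite_mixingMeasure (v : ℝ → ℝ) : SFinite (mixingMeasure d v) := by
  unfold mixingMeasure
  infer_instance

theorem lintegral_mixingMeasure {v : ℝ → ℝ} (hv : ContinuousOn v (Ioi 0))
    {F : ℝ × EuclideanSpace ℝ (Fin d) → ℝ≥0∞} (hF : Measurable F) :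
    ∫⁻ z, F z ∂((mixingMeasure d v).prod volume) = ∫⁻ s in Ioi (0 : ℝ),
      ENNReal.ofReal ((Real.pi / (4 * s)) ^ (-((d : ℝ) / 2)) * v s) * ∫⁻ y, F (s, y) := by
  have hm : AEMeasurable (fun s : ℝ =>
      ENNReal.ofReal ((Real.pi / (4 * s)) ^ (-((d : ℝ) / 2)) * v s)) (volume.restrict (Ioi 0)) :=
    (AEMeasurable.mul (by fun_prop) (hv.aemeasurable measurableSet_Ioi)).ennreal_ofReal
  rw [lintegral_prod _ hF.aemeasurable, mixingMeasure, lintegral_withDensity_eq_lintegral_mul₀ hm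
    hF.lintegral_prod_right'.aemeasurable]
  rfl

theorem lintegral_weight_mul {v b : ℝ → ℝ} (hv0 : ∀ s, 0 < s → 0 ≤ v s)
    (hb0 : ∀ s, 0 < s → 0 ≤ b s) (hb : IntegrableOn (fun s => b s * v s) (Ioi 0)) :
    ∫⁻ s in Ioi (0 : ℝ), ENNReal.ofReal ((Real.pi / (4 * s)) ^ (-((d : ℝ) / 2)) * v s)
        * ENNReal.ofReal (b s * (Real.pi / (4 * s)) ^ ((d : ℝ) / 2))
      = ENNReal.ofReal (∫ s in Ioi (0 : ℝ), b s * v s) := by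
  rw [ofReal_integral_eq_lintegral_ofReal hb]
  · refine setLIntegral_congr_fun measurableSet_Ioi fun s hs => ?_
    have hs' : 0 < s := hs
    have hp : 0 < Real.pi / (4 * s) := by positivity
    rw [← ENNReal.ofReal_mul (mul_nonneg (by positivity) (hv0 s hs))]
    congr 1
    rw [Real.rpow_neg hp.le]
    have := (Real.rpow_pos_of_pos hp ((d : ℝ) / 2)).ne'
    field_simp
  · filter_upwards [ae_restrict_mem measurableSet_Ioi] with s hs
    exact mul_nonneg (hb0 s hs) (hv0 s hs)

/-- Integrals over the mixture are bounded once the integrals for each component are. -/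
theorem integrable_and_integral_le_of_mixture {v b : ℝ → ℝ} (hv : ContinuousOn v (Ioi 0))
    (hv0 : ∀ s, 0 < s → 0 ≤ v s) (hb0 : ∀ s, 0 < s → 0 ≤ b s)
    (hb : IntegrableOn (fun s => b s * v s) (Ioi 0)) {F : ℝ × EuclideanSpace ℝ (Fin d) → ℝ}
    (hF : Measurable F) (hF0 : ∀ z, 0 ≤ F z) (hFb : ∀ s, 0 < s → ∫⁻ y, ENNReal.ofReal (F (s, y))
      ≤ ENNReal.ofReal (b s * (Real.pi / (4 * s)) ^ ((d : ℝ) / 2))) :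
    Integrable F ((mixingMeasure d v).prod volume) ∧
      ∫ z, F z ∂((mixingMeasure d v).prod volume) ≤ ∫ s in Ioi (0 : ℝ), b s * v s := by
  have h : ∫⁻ z, ENNReal.ofReal (F z) ∂((mixingMeasure d v).prod volume)
      ≤ ENNReal.ofReal (∫ s in Ioi (0 : ℝ), b s * v s) := by
    rw [lintegral_mixingMeasure hv hF.ennreal_ofReal, ← lintegral_weight_mul (d := d) hv0 hb0 hb]
    refine setLIntegral_mono_ae' measurableSet_Ioi (ae_of_all _ fun s hs => ?_)
    gcongr
    exact hFb s hs
  refine ⟨⟨hF.aestronglyMeasurable, ?_⟩, ?_⟩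
  · rw [hasFiniteIntegral_iff_ofReal (ae_of_all _ hF0)]
    exact h.trans_lt ENNReal.ofReal_lt_top
  · rw [integral_eq_lintegral_of_nonneg_ae (ae_of_all _ hF0) hF.aestronglyMeasurable]
    refine ENNReal.toReal_le_of_le_ofReal (setIntegral_nonneg measurableSet_Ioi fun s hs => ?_) h
    exact mul_nonneg (hb0 s hs) (hv0 s hs)

/-- A version of `integrable_and_integral_le_of_mixture` with a Gaussian pointwise bound. -/
theorem integrable_and_integral_le_of_gaussian_bound {v b : ℝ → ℝ} (hv : ContinuousOn v (Ioi 0))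
    (hv0 : ∀ s, 0 < s → 0 ≤ v s) (hb0 : ∀ s, 0 < s → 0 ≤ b s)
    (hb : IntegrableOn (fun s => b s * v s) (Ioi 0)) {F : ℝ × EuclideanSpace ℝ (Fin d) → ℝ}
    (hF : Measurable F) (hF0 : ∀ z, 0 ≤ F z)
    (hFb : ∀ s, 0 < s → ∀ y, F (s, y) ≤ b s * Real.exp (-2 * s * ‖y‖ ^ 2)) :
    Integrable F ((mixingMeasure d v).prod volume) ∧
      ∫ z, F z ∂((mixingMeasure d v).prod volume)
        ≤ 2 ^ ((d : ℝ) / 2) * ∫ s in Ioi (0 : ℝ), b s * v s := by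
  rw [← integral_const_mul]
  simp_rw [← mul_assoc]
  refine integrable_and_integral_le_of_mixture hv hv0
    (fun s hs => mul_nonneg (by positivity) (hb0 s hs)) ?_ hF hF0 fun s hs => ?_
  · simp_rw [mul_assoc]
    exact hb.const_mul _
  · calc ∫⁻ y, ENNReal.ofReal (F (s, y))
        ≤ ∫⁻ y : EuclideanSpace ℝ (Fin d),
            ENNReal.ofReal (b s) * ENNReal.ofReal (Real.exp (-(2 * s) * ‖y‖ ^ 2)) := by
          refine lintegral_mono fun y => ?_
          rw [← ENNReal.ofReal_mul (hb0 s hs)]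
          refine ENNReal.ofReal_le_ofReal ((hFb s hs y).trans (le_of_eq ?_))
          ring_nf
      _ = _ := by
          rw [lintegral_const_mul _ (by fun_prop), lintegral_exp_neg_mul_sq_norm (by positivity),
            ← ENNReal.ofReal_mul (hb0 s hs)]
          congr 1
          rw [mul_comm _ (b s), mul_assoc, ← Real.mul_rpow (by norm_num) (by positivity)]
          congr 2
          field_simp
          norm_num

theorem lintegral_gaussKernel_mul_shift {s : ℝ} (hs : 0 < s) (x : EuclideanSpace ℝ (Fin d)) :
    ∫⁻ y, ENNReal.ofReal (gaussKernel s y * gaussKernel s (y + x))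
      = ENNReal.ofReal (Real.exp (-s * ‖x‖ ^ 2) * (Real.pi / (4 * s)) ^ ((d : ℝ) / 2)) := by
  simp_rw [gaussKernel_mul_shift, ENNReal.ofReal_mul (Real.exp_pos _).le]
  rw [lintegral_const_mul _ (by fun_prop), ← lintegral_exp_neg_mul_sq_norm (by positivity),
    lintegral_add_right_eq_self
      (fun y : EuclideanSpace ℝ (Fin d) => ENNReal.ofReal (Real.exp (-(4 * s) * ‖y‖ ^ 2)))]

theorem integrableOn_exp_mul {v : ℝ → ℝ} (hv1 : IntegrableOn v (Ioi 0))
    (r : ℝ) : IntegrableOn (fun s => Real.exp (-s * r ^ 2) * v s) (Ioi 0) := by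
  refine Integrable.mono' hv1.norm ((by fun_prop : Continuous fun s : ℝ =>
    Real.exp (-s * r ^ 2)).aestronglyMeasurable.mul hv1.aestronglyMeasurable) ?_
  filter_upwards [ae_restrict_mem measurableSet_Ioi] with s hs
  have hs' : 0 < s := hs
  rw [norm_mul, Real.norm_of_nonneg (Real.exp_pos _).le]
  refine mul_le_of_le_one_left (norm_nonneg _) (Real.exp_le_one_iff.2 ?_)
  nlinarith [sq_nonneg r]

/-- The covariance of the mixture of Gaussian kernels is the Laplace transform of `v`. -/
theorem integral_gaussKernel_mul_shift {v : ℝ → ℝ} (hv : ContinuousOn v (Ioi 0))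
    (hv0 : ∀ s, 0 < s → 0 ≤ v s) (hv1 : IntegrableOn v (Ioi 0)) (x : EuclideanSpace ℝ (Fin d)) :
    ∫ z, gaussKernel z.1 z.2 * gaussKernel z.1 (z.2 + x) ∂((mixingMeasure d v).prod volume)
      = ∫ s in Ioi (0 : ℝ), Real.exp (-s * ‖x‖ ^ 2) * v s := by
  have hc : Continuous fun z : ℝ × EuclideanSpace ℝ (Fin d) =>
      gaussKernel z.1 z.2 * gaussKernel z.1 (z.2 + x) := by
    unfold gaussKernel
    fun_prop
  rw [integral_eq_lintegral_of_nonneg_ae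
    (ae_of_all _ fun z => (mul_pos (gaussKernel_pos _ _) (gaussKernel_pos _ _)).le)
    hc.aestronglyMeasurable, lintegral_mixingMeasure hv hc.measurable.ennreal_ofReal]
  have := lintegral_weight_mul (d := d) hv0 (fun s _ => (Real.exp_pos (-s * ‖x‖ ^ 2)).le)
    (integrableOn_exp_mul hv1 ‖x‖)
  rw [setLIntegral_congr_fun (g := fun s =>
    ENNReal.ofReal ((Real.pi / (4 * s)) ^ (-((d : ℝ) / 2)) * v s)
      * ENNReal.ofReal (Real.exp (-s * ‖x‖ ^ 2) * (Real.pi / (4 * s)) ^ ((d : ℝ) / 2)))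
    measurableSet_Ioi fun s hs => by
      simp only
      rw [lintegral_gaussKernel_mul_shift hs], this, ENNReal.toReal_ofReal]
  exact setIntegral_nonneg measurableSet_Ioi fun s hs => mul_nonneg (Real.exp_pos _).le (hv0 s hs)

/-- The bound on `v` at infinity provides two moments. -/
theorem integrableOn_pow_mul {v : ℝ → ℝ} (hv : ContinuousOn v (Ioi 0))
    (hv0 : ∀ s, 0 < s → 0 ≤ v s) (hv1 : IntegrableOn v (Ioi 0)) {C : ℝ}
    (hC : ∀ s, 0 < s → v s * s ^ ((d : ℝ) / 2 + 3) ≤ C) (hd : 2 ≤ d) {n : ℕ} (hn : n ≤ 2) :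
    IntegrableOn (fun s => s ^ n * v s) (Ioi 0) := by
  have hm : ContinuousOn (fun s => s ^ n * v s) (Ioi 0) := (by fun_prop : ContinuousOn
    (fun s : ℝ => s ^ n) (Ioi 0)).mul hv
  rw [← Ioc_union_Ioi_eq_Ioi zero_le_one]
  refine IntegrableOn.union ?_ ?_
  · refine Integrable.mono' ((hv1.mono_set Ioc_subset_Ioi_self).norm)
      ((hm.mono Ioc_subset_Ioi_self).aestronglyMeasurable measurableSet_Ioc) ?_
    filter_upwards [ae_restrict_mem measurableSet_Ioc] with s hs
    rw [norm_mul, Real.norm_of_nonneg (pow_nonneg hs.1.le _)]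
    exact mul_le_of_le_one_left (norm_nonneg _) (pow_le_one₀ hs.1.le hs.2)
  · have hsub : Ioi (1 : ℝ) ⊆ Ioi 0 := Ioi_subset_Ioi zero_le_one
    refine Integrable.mono' ((integrableOn_Ioi_rpow_of_lt (by norm_num : (-2 : ℝ) < -1)
      zero_lt_one).const_mul C) ((hm.mono hsub).aestronglyMeasurable measurableSet_Ioi) ?_
    filter_upwards [ae_restrict_mem measurableSet_Ioi] with s hs
    have hs1 : 1 < s := hs
    have hs0 : 0 < s := by linarith
    rw [Real.norm_of_nonneg (mul_nonneg (pow_nonneg hs0.le _) (hv0 s hs0)), Real.rpow_neg hs0.le,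
      ← div_eq_mul_inv, le_div_iff₀ (by positivity), Real.rpow_two]
    refine le_trans ?_ (hC s hs0)
    rw [mul_comm _ (v s), mul_assoc, ← pow_add]
    refine mul_le_mul_of_nonneg_left ?_ (hv0 s hs0)
    rw [← Real.rpow_natCast]
    refine Real.rpow_le_rpow_of_exponent_le hs1.le ?_
    have h2 : (2 : ℝ) ≤ d := by exact_mod_cast hd
    have h3 : (n : ℝ) ≤ 2 := by exact_mod_cast hn
    push_cast
    linarith

theorem isSmoothKernel_gaussKernel {v : ℝ → ℝ} (hv : ContinuousOn v (Ioi 0))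
    (hv0 : ∀ s, 0 < s → 0 ≤ v s) (hv1 : IntegrableOn v (Ioi 0)) {C : ℝ}
    (hC : ∀ s, 0 < s → v s * s ^ ((d : ℝ) / 2 + 3) ≤ C) (hd : 2 ≤ d) :
    IsSmoothKernel (mixingMeasure d v) (gaussKernel : ℝ → EuclideanSpace ℝ (Fin d) → ℝ) := by
  have hcd := contDiff_uncurry_gaussKernel (d := d)
  have hc0 : Continuous fun z : ℝ × EuclideanSpace ℝ (Fin d) => gaussKernel z.1 z.2 := hcd.continuous
  have hc1 : Continuous fun z : ℝ × EuclideanSpace ℝ (Fin d) => ‖fderiv ℝ (gaussKernel z.1) z.2‖ :=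
    (contDiff_fderiv_uncurry hcd).continuous.norm
  have hc2 : Continuous fun z : ℝ × EuclideanSpace ℝ (Fin d) =>
      ‖fderiv ℝ (fderiv ℝ (gaussKernel z.1)) z.2‖ :=
    (continuous_norm (E := EuclideanSpace ℝ (Fin d) →L[ℝ] EuclideanSpace ℝ (Fin d) →L[ℝ] ℝ)).comp
      (continuous_fderiv_fderiv_uncurry hcd)
  refine ⟨hcd, ?_, ?_, ?_⟩
  · refine (memLp_two_iff_integrable_sq hc0.aestronglyMeasurable).2
      (integrable_and_integral_le_of_gaussian_bound hv hv0 (b := fun _ => 1) (by simp)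
        (by simpa using hv1) (hc0.pow 2).measurable (fun z => sq_nonneg _) fun s hs y => ?_).1
    change gaussKernel s y ^ 2 ≤ _
    rw [gaussKernel_sq, one_mul]
    exact Real.exp_le_exp.2 (by nlinarith [mul_nonneg hs.le (sq_nonneg ‖y‖)])
  · refine (memLp_two_iff_integrable_sq hc1.aestronglyMeasurable).2
      (integrable_and_integral_le_of_gaussian_bound hv hv0 (b := fun s => 8 * s)
        (fun s hs => by positivity) ?_ (hc1.pow 2).measurable (fun z => sq_nonneg _) fun s hs y =>
          sq_norm_fderiv_gaussKernel_le hs.le y).1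
    have := (integrableOn_pow_mul hv hv0 hv1 hC hd (n := 1) (by norm_num)).const_mul 8
    simp only [pow_one, ← mul_assoc] at this
    exact this
  · refine (memLp_two_iff_integrable_sq hc2.aestronglyMeasurable).2
      (integrable_and_integral_le_of_gaussian_bound hv hv0 (b := fun s => 256 * s ^ 2)
        (fun s hs => by positivity) ?_ (hc2.pow 2).measurable (fun z => sq_nonneg _) fun s hs y =>
          sq_norm_fderiv_fderiv_gaussKernel_le hs.le y).1
    have := (integrableOn_pow_mul hv hv0 hv1 hC hd (n := 2) le_rfl).const_mul 256
    simp only [← mul_assoc] at this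
    exact this

end GaussianKernel

/-! ### Covariances which are Laplace transforms -/

section Laplace

variable {d : ℕ}

theorem exp_neg_div_le (hd : 0 < d) {t : ℝ} (ht : 0 < t) :
    Real.exp (-t / 8) ≤ (4 * d / t) ^ ((d : ℝ) / 2) := by
  have hd' : (0 : ℝ) < d := by exact_mod_cast hd
  have h1 : Real.exp (-(t / (4 * d))) ≤ 4 * d / t := by
    rw [Real.exp_neg, ← inv_div t]
    refine inv_anti₀ (by positivity) ?_
    have := Real.add_one_le_exp (t / (4 * d))
    linarith
  have h2 := Real.rpow_le_rpow (Real.exp_pos _).le h1 (by positivity : 0 ≤ (d : ℝ) / 2)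
  rw [← Real.exp_mul] at h2
  refine le_trans (le_of_eq ?_) h2
  congr 1
  field_simp
  norm_num

/-- The points at distance at most `L / 2` from the origin contribute little to the covariance at
distance much larger than `L`. -/
theorem exists_integral_near_le {v : ℝ → ℝ} (hv : ContinuousOn v (Ioi 0))
    (hv0 : ∀ s, 0 < s → 0 ≤ v s) (hv1 : IntegrableOn v (Ioi 0)) (hd : 0 < d) : ∃ C : ℝ, 0 ≤ C ∧
    ∀ (L : ℝ) (x : EuclideanSpace ℝ (Fin d)), 1 ≤ L → 2 * L ≤ ‖x‖ →
      ∫ z in {z : ℝ × EuclideanSpace ℝ (Fin d) | ‖z.2‖ ≤ L / 2},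
        |gaussKernel z.1 z.2 * gaussKernel z.1 (z.2 + x)| ∂((mixingMeasure d v).prod volume)
      ≤ C * (L / ‖x‖) ^ d * ∫ s in Ioi (0 : ℝ), Real.exp (-s * ‖x‖ ^ 2) * v s := by
  set w := (volume (Metric.ball (0 : EuclideanSpace ℝ (Fin d)) 1)).toReal with hw
  set C := w * (1 / 2) ^ d * (16 * d / Real.pi) ^ ((d : ℝ) / 2)
  have hw0 : 0 ≤ w := ENNReal.toReal_nonneg
  have hC : 0 ≤ C := by positivity
  refine ⟨C, hC, fun L x hL hx => ?_⟩
  have hx0 : 0 < ‖x‖ := by linarith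
  have hA : MeasurableSet {z : ℝ × EuclideanSpace ℝ (Fin d) | ‖z.2‖ ≤ L / 2} :=
    measurableSet_le measurable_snd.norm measurable_const
  have hc : Continuous fun z : ℝ × EuclideanSpace ℝ (Fin d) =>
      |gaussKernel z.1 z.2 * gaussKernel z.1 (z.2 + x)| := by
    unfold gaussKernel
    fun_prop
  rw [← integral_indicator hA, ← integral_const_mul]
  simp_rw [← mul_assoc]
  refine (integrable_and_integral_le_of_mixture hv hv0 (fun s hs => by positivity) ?_
    (hc.measurable.indicator hA) (fun z => indicator_nonneg (fun _ _ => abs_nonneg _) _)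
    fun s hs => ?_).2
  · simp_rw [mul_assoc]
    exact ((integrableOn_exp_mul hv1 ‖x‖).const_mul _).const_mul _
  · have hvol : volume (Metric.closedBall (0 : EuclideanSpace ℝ (Fin d)) (L / 2))
        = ENNReal.ofReal ((L / 2) ^ d * w) := by
      rw [Measure.addHaar_closedBall _ _ (by linarith), finrank_euclideanSpace_fin,
        ENNReal.ofReal_mul (by positivity), hw, ENNReal.ofReal_toReal measure_ball_lt_top.ne]
    calc ∫⁻ y, ENNReal.ofReal ({z : ℝ × EuclideanSpace ℝ (Fin d) | ‖z.2‖ ≤ L / 2}.indicator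
            (fun z => |gaussKernel z.1 z.2 * gaussKernel z.1 (z.2 + x)|) (s, y))
        ≤ ∫⁻ y, (Metric.closedBall (0 : EuclideanSpace ℝ (Fin d)) (L / 2)).indicator
            (fun _ => ENNReal.ofReal (Real.exp (-s * ‖x‖ ^ 2) * Real.exp (-(s * ‖x‖ ^ 2) / 8))) y := by
          refine lintegral_mono fun y => ?_
          by_cases hy : ‖y‖ ≤ L / 2
          · rw [indicator_of_mem (by exact hy), indicator_of_mem (by simpa using hy)]
            refine ENNReal.ofReal_le_ofReal ?_
            simp only
            rw [abs_of_pos (mul_pos (gaussKernel_pos _ _) (gaussKernel_pos _ _)), gaussKernel,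
              gaussKernel, ← Real.exp_add, ← Real.exp_add]
            refine Real.exp_le_exp.2 ?_
            have h1 : 3 / 4 * ‖x‖ ≤ ‖y + x‖ := by
              have := norm_sub_le (y + x) y
              rw [add_sub_cancel_left] at this
              linarith
            have h2 : (3 / 4 * ‖x‖) ^ 2 ≤ ‖y + x‖ ^ 2 := pow_le_pow_left₀ (by positivity) h1 2
            nlinarith [mul_le_mul_of_nonneg_left h2 hs.le, mul_nonneg hs.le (sq_nonneg ‖y‖)]
          · rw [indicator_of_notMem (by exact hy)]
            simp
      _ = ENNReal.ofReal (Real.exp (-s * ‖x‖ ^ 2) * Real.exp (-(s * ‖x‖ ^ 2) / 8))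
            * ENNReal.ofReal ((L / 2) ^ d * w) := by
          rw [lintegral_indicator_const Metric.isClosed_closedBall.measurableSet, hvol]
      _ ≤ _ := by
          rw [← ENNReal.ofReal_mul (by positivity)]
          refine ENNReal.ofReal_le_ofReal ?_
          have h3 := exp_neg_div_le hd (t := s * ‖x‖ ^ 2) (by positivity)
          have h4 : (4 * d / (s * ‖x‖ ^ 2)) ^ ((d : ℝ) / 2)
              = (16 * d / Real.pi) ^ ((d : ℝ) / 2) * (Real.pi / (4 * s)) ^ ((d : ℝ) / 2)
                * (1 / ‖x‖) ^ d := by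
            have h5 : (1 / ‖x‖) ^ d = ((1 / ‖x‖) ^ (2 : ℝ)) ^ ((d : ℝ) / 2) := by
              rw [← Real.rpow_mul (by positivity), ← Real.rpow_natCast]
              congr 1
              ring
            rw [h5, ← Real.mul_rpow (by positivity) (by positivity),
              ← Real.mul_rpow (by positivity) (by positivity)]
            congr 1
            rw [Real.rpow_two]
            have := Real.pi_pos
            field_simp
            norm_num
          rw [h4] at h3
          calc Real.exp (-s * ‖x‖ ^ 2) * Real.exp (-(s * ‖x‖ ^ 2) / 8) * ((L / 2) ^ d * w)
              ≤ Real.exp (-s * ‖x‖ ^ 2) * ((16 * d / Real.pi) ^ ((d : ℝ) / 2)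
                * (Real.pi / (4 * s)) ^ ((d : ℝ) / 2) * (1 / ‖x‖) ^ d) * ((L / 2) ^ d * w) := by
                gcongr
            _ = _ := by
                simp only [C, div_pow, one_pow]
                ring

theorem integral_sq_gaussKernel_far_le {v : ℝ → ℝ} (hv : ContinuousOn v (Ioi 0))
    (hv0 : ∀ s, 0 < s → 0 ≤ v s) (hv1 : IntegrableOn v (Ioi 0)) {L : ℝ} (hL : 0 < L) :
    ∫ z in {z : ℝ × EuclideanSpace ℝ (Fin d) | L / 4 ≤ ‖z.2‖}, gaussKernel z.1 z.2 ^ 2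
        ∂((mixingMeasure d v).prod volume)
      ≤ 2 ^ ((d : ℝ) / 2) * ∫ s in Ioi (0 : ℝ), Real.exp (-s * (1 / 4 * L) ^ 2) * v s := by
  have hA : MeasurableSet {z : ℝ × EuclideanSpace ℝ (Fin d) | L / 4 ≤ ‖z.2‖} :=
    measurableSet_le measurable_const measurable_snd.norm
  have hc : Continuous fun z : ℝ × EuclideanSpace ℝ (Fin d) => gaussKernel z.1 z.2 ^ 2 := by
    unfold gaussKernel
    fun_prop
  rw [← integral_indicator hA]
  refine (integrable_and_integral_le_of_gaussian_bound hv hv0 (fun s hs => (Real.exp_pos _).le)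
    (integrableOn_exp_mul hv1 _) (hc.measurable.indicator hA)
    (fun z => indicator_nonneg (fun _ _ => sq_nonneg _) _) fun s hs y => ?_).2
  by_cases hy : L / 4 ≤ ‖y‖
  · rw [indicator_of_mem (by exact hy)]
    simp only
    rw [gaussKernel_sq, ← Real.exp_add]
    refine Real.exp_le_exp.2 ?_
    have h2 : (L / 4) ^ 2 ≤ ‖y‖ ^ 2 := pow_le_pow_left₀ (by positivity) hy 2
    nlinarith [mul_le_mul_of_nonneg_left h2 hs.le, mul_nonneg hs.le (sq_nonneg ‖y‖)]
  · rw [indicator_of_notMem (by exact hy)]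
    positivity

theorem integral_sq_fderiv_gaussKernel_far_le {v : ℝ → ℝ} (hv : ContinuousOn v (Ioi 0))
    (hv0 : ∀ s, 0 < s → 0 ≤ v s) (hv1 : IntegrableOn v (Ioi 0)) {L : ℝ} (hL : 0 < L) :
    ∫ z in {z : ℝ × EuclideanSpace ℝ (Fin d) | L / 4 ≤ ‖z.2‖}, ‖fderiv ℝ (gaussKernel z.1) z.2‖ ^ 2
        ∂((mixingMeasure d v).prod volume)
      ≤ 2 ^ ((d : ℝ) / 2) * (512 * L ^ (-2 : ℝ) *
        ∫ s in Ioi (0 : ℝ), Real.exp (-s * (1 / 4 * L) ^ 2) * v s) := by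
  have hA : MeasurableSet {z : ℝ × EuclideanSpace ℝ (Fin d) | L / 4 ≤ ‖z.2‖} :=
    measurableSet_le measurable_const measurable_snd.norm
  have hc : Continuous fun z : ℝ × EuclideanSpace ℝ (Fin d) =>
      ‖fderiv ℝ (gaussKernel z.1) z.2‖ ^ 2 :=
    (contDiff_fderiv_uncurry contDiff_uncurry_gaussKernel).continuous.norm.pow 2
  rw [← integral_indicator hA, ← integral_const_mul]
  simp_rw [← mul_assoc (512 * L ^ (-2 : ℝ))]
  refine (integrable_and_integral_le_of_gaussian_bound hv hv0 (fun s hs => by positivity)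
    (by simp_rw [mul_assoc (512 * L ^ (-2 : ℝ))]; exact (integrableOn_exp_mul hv1 _).const_mul _)
    (hc.measurable.indicator hA)
    (fun z => indicator_nonneg (fun _ _ => sq_nonneg _) _) fun s hs y => ?_).2
  by_cases hy : L / 4 ≤ ‖y‖
  · rw [indicator_of_mem (by exact hy)]
    simp only
    have h2 : (L / 4) ^ 2 ≤ ‖y‖ ^ 2 := pow_le_pow_left₀ (by positivity) hy 2
    have h3 : s ^ 2 * ‖y‖ ^ 2 ≤ 32 * L ^ (-2 : ℝ) * Real.exp (s * ‖y‖ ^ 2) := by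
      have h4 := Real.quadratic_le_exp_of_nonneg (mul_nonneg hs.le (sq_nonneg ‖y‖))
      have h5 : (s * ‖y‖ ^ 2) ^ 2 ≤ 2 * Real.exp (s * ‖y‖ ^ 2) := by
        nlinarith [mul_nonneg hs.le (sq_nonneg ‖y‖)]
      have h6 : s ^ 2 * ‖y‖ ^ 2 * (L / 4) ^ 2 ≤ 2 * Real.exp (s * ‖y‖ ^ 2) :=
        (mul_le_mul_of_nonneg_left h2 (by positivity)).trans (le_trans (le_of_eq (by ring)) h5)
      rw [Real.rpow_neg hL.le, Real.rpow_two, mul_right_comm, ← div_eq_mul_inv,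
        le_div_iff₀ (by positivity)]
      linarith
    have h7 : Real.exp (s * ‖y‖ ^ 2) * Real.exp (-4 * s * ‖y‖ ^ 2)
        ≤ Real.exp (-s * (1 / 4 * L) ^ 2) * Real.exp (-2 * s * ‖y‖ ^ 2) := by
      rw [← Real.exp_add, ← Real.exp_add]
      refine Real.exp_le_exp.2 ?_
      nlinarith [mul_le_mul_of_nonneg_left h2 hs.le]
    rw [norm_fderiv_gaussKernel hs.le, mul_pow, gaussKernel_sq]
    calc (4 * s * ‖y‖) ^ 2 * Real.exp (-4 * s * ‖y‖ ^ 2)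
        = 16 * (s ^ 2 * ‖y‖ ^ 2) * Real.exp (-4 * s * ‖y‖ ^ 2) := by ring
      _ ≤ 16 * (32 * L ^ (-2 : ℝ) * Real.exp (s * ‖y‖ ^ 2)) * Real.exp (-4 * s * ‖y‖ ^ 2) := by
          gcongr
      _ = 512 * L ^ (-2 : ℝ) * (Real.exp (s * ‖y‖ ^ 2) * Real.exp (-4 * s * ‖y‖ ^ 2)) := by ring
      _ ≤ 512 * L ^ (-2 : ℝ) * (Real.exp (-s * (1 / 4 * L) ^ 2) * Real.exp (-2 * s * ‖y‖ ^ 2)) := by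
          gcongr
      _ = _ := by ring
  · rw [indicator_of_notMem (by exact hy)]
    positivity

theorem exists_euclidean_norm_eq (hd : 0 < d) {r : ℝ} (hr : 0 ≤ r) :
    ∃ x : EuclideanSpace ℝ (Fin d), ‖x‖ = r :=
  ⟨EuclideanSpace.single ⟨0, hd⟩ r, by simp [abs_of_nonneg hr]⟩

/-- A covariance which does not vanish identically does not vanish at the origin. -/
theorem ne_zero_of_isSpectralMeasure {K : ℝ → ℝ} {ν : Measure (EuclideanSpace ℝ (Fin d))}
    (hν : IsSpectralMeasure K ν) {x : EuclideanSpace ℝ (Fin d)} (hx : K ‖x‖ ≠ 0) : K 0 ≠ 0 := by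
  intro h0
  have hfin := hν.finite
  have h1 := hν.fourier 0
  simp only [norm_zero, h0, inner_zero_left, Complex.ofReal_zero, mul_zero, Complex.exp_zero,
    integral_const, Complex.real_smul, mul_one] at h1
  have h2 : ν = 0 := by
    have : ν.real univ = 0 := by exact_mod_cast h1.symm
    rw [measureReal_eq_zero_iff] at this
    exact Measure.measure_univ_eq_zero.1 this
  have h3 := hν.fourier x
  rw [h2, integral_zero_measure] at h3
  exact hx (by exact_mod_cast h3)

/-- The case of a Laplace transform. Only regular variation of `K` and the decay of `v` at infinity
enter: integrating over `s` turns the Gaussian bounds on the kernels into values of `K`. -/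
theorem hasLocalGlobalDecomposition_of_laplaceCondition {Ω : Type*} [MeasurableSpace Ω]
    {P : Measure Ω} {f : EuclideanSpace ℝ (Fin d) → Ω → ℝ} {K : ℝ → ℝ} {α γ : ℝ} {ℓ : ℝ → ℝ}
    (hf : RegularlyVaryingField f K P α γ ℓ) (h : LaplaceCondition d K α γ ℓ) :
    HasLocalGlobalDecomposition f K P := by
  obtain ⟨v, hv, hv0, hvK, ⟨C₀, hC₀⟩, -⟩ := h
  have hd2 := hf.two_le_dim
  have hd : 0 < d := by omega
  have hpos := eventually_pos_of_isEquivalent hf.slowlyVarying hf.covariance_equiv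
  have hv1 : IntegrableOn v (Ioi 0) := by
    by_contra hcon
    -- the Bochner integral of a function which is not integrable is `0`, which would give `K 0 = 0`
    obtain ⟨ν, hν, -⟩ := hf.spectral_support
    obtain ⟨r, hr, hr0⟩ := (hpos.and (eventually_ge_atTop 0)).exists
    obtain ⟨x, rfl⟩ := exists_euclidean_norm_eq hd hr0
    refine ne_zero_of_isSpectralMeasure hν hr.ne' ?_
    rw [hvK 0 le_rfl]
    refine integral_undef fun hi => hcon ?_
    simpa [IntegrableOn] using hi
  have hp := isSmoothKernel_gaussKernel hv hv0 hv1 hC₀ hd2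
  have hrad : ∀ (s : ℝ) (y y' : EuclideanSpace ℝ (Fin d)), ‖y‖ = ‖y'‖ →
      gaussKernel s y = gaussKernel s y' := fun s y y' h => by rw [gaussKernel, gaussKernel, h]
  have hK : ∀ x : EuclideanSpace ℝ (Fin d), ∫ z, gaussKernel z.1 z.2 * gaussKernel z.1 (z.2 + x)
      ∂((mixingMeasure d v).prod volume) = K ‖x‖ := fun x => by
    rw [integral_gaussKernel_mul_shift hv hv0 hv1, hvK _ (norm_nonneg x)]
  have hK4 := isBigO_comp_const_mul hf.slowlyVarying hf.covariance_equiv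
    (by norm_num : (0 : ℝ) < 1 / 4)
  refine hasLocalGlobalDecomposition_of_kernel hf.field hd hp hrad hK ?_ ?_ fun _ => ?_
  · intro ε hε
    obtain ⟨C, hC, hnear⟩ := exists_integral_near_le hv hv0 hv1 hd
    obtain ⟨R, hR⟩ := eventually_atTop.1 hpos
    refine ⟨max 2 (2 * C / ε), max 1 R, fun L hL x hx => ?_⟩
    have hL1 : 1 ≤ L := (le_max_left _ _).trans hL
    have hL0 : 0 < L := by linarith
    have hx2 : 2 * L ≤ ‖x‖ := (mul_le_mul_of_nonneg_right (le_max_left _ _) hL0.le).trans hx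
    have hxC : 2 * C / ε * L ≤ ‖x‖ := (mul_le_mul_of_nonneg_right (le_max_right _ _) hL0.le).trans hx
    have hx0 : 0 < ‖x‖ := by linarith
    have hKx : 0 < K ‖x‖ := hR _ (by linarith [(le_max_right 1 R).trans hL])
    have h1 := abs_integral_sub_integral_tailKernel_le hp hrad hL1 x
    have h2 := hnear L x hL1 hx2
    rw [hK] at h1
    rw [← hvK _ (norm_nonneg x)] at h2
    have h3 : (L / ‖x‖) ^ d ≤ L / ‖x‖ :=
      pow_le_of_le_one (by positivity) ((div_le_one hx0).2 (by linarith)) hd.ne'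
    have h4 : 2 * (C * (L / ‖x‖)) ≤ ε := by
      have e : 2 * (C * (L / ‖x‖)) = 2 * C * L / ‖x‖ := by ring
      rw [e, div_le_iff₀ hx0]
      rw [div_mul_eq_mul_div, div_le_iff₀ hε] at hxC
      linarith
    rw [div_sub_one hKx.ne', abs_div, abs_of_pos hKx, div_le_iff₀ hKx, abs_sub_comm]
    refine h1.trans (le_trans (mul_le_mul_of_nonneg_left h2 zero_le_two) ?_)
    rw [← mul_assoc]
    refine mul_le_mul_of_nonneg_right (le_trans ?_ h4) hKx.le
    gcongr
  · refine IsBigO.trans (IsBigO.of_bound (2 ^ ((d : ℝ) / 2)) ?_) hK4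
    filter_upwards [eventually_gt_atTop 0] with L hL
    rw [Real.norm_of_nonneg (integral_nonneg fun z => sq_nonneg _)]
    refine (integral_sq_gaussKernel_far_le hv hv0 hv1 hL).trans ?_
    rw [← hvK _ (by positivity)]
    gcongr
    exact le_abs_self _
  · refine IsBigO.trans (IsBigO.of_bound (2 ^ ((d : ℝ) / 2) * 512) ?_)
      ((isBigO_refl (fun L : ℝ => L ^ (-2 : ℝ)) atTop).mul hK4)
    filter_upwards [eventually_gt_atTop 0] with L hL
    rw [Real.norm_of_nonneg (integral_nonneg fun z => sq_nonneg _)]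
    refine (integral_sq_fderiv_gaussKernel_far_le hv hv0 hv1 hL).trans ?_
    rw [← hvK _ (by positivity), norm_mul, Real.norm_of_nonneg (by positivity : 0 ≤ L ^ (-2 : ℝ)),
      mul_assoc, mul_assoc]
    gcongr
    exact le_abs_self _

end Laplace

/-! ### The Fourier transform of the square root of the spectral density -/

section Fourier

variable {d : ℕ}

/-- Duality characterises the inverse Fourier transform on `L²`. -/
theorem eq_fourierInv_of_forall_integral_inner {F G : Lp ℂ 2 (volume : Measure (EuclideanSpace ℝ (Fin d)))}
    (h : ∀ φ : SchwartzMap (EuclideanSpace ℝ (Fin d)) ℂ,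
      ∫ y, inner ℂ (φ y) (F y) = ∫ ξ, inner ℂ (𝓕 φ ξ) (G ξ)) :
    F = (𝓕⁻ G : Lp ℂ 2 volume) := by
  refine (SchwartzMap.denseRange_toLpCLM (E := EuclideanSpace ℝ (Fin d)) (F := ℂ) (p := 2)
    (μ := volume) ENNReal.ofNat_ne_top).eq_of_inner_left ℂ ?_
  intro φ
  change inner ℂ F (φ.toLp 2) = inner ℂ (𝓕⁻ G : Lp ℂ 2 volume) (φ.toLp 2)
  rw [← inner_conj_symm, ← inner_conj_symm (𝓕⁻ G : Lp ℂ 2 volume)]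
  congr 1
  have e : inner ℂ (φ.toLp 2 : Lp ℂ 2 (volume : Measure (EuclideanSpace ℝ (Fin d))))
      (𝓕⁻ G : Lp ℂ 2 volume) = inner ℂ ((𝓕 φ).toLp 2 : Lp ℂ 2 volume) G := by
    rw [← Lp.inner_fourier_eq, SchwartzMap.toLp_fourier_eq, FourierTransform.fourier_fourierInv_eq]
  rw [e, L2.inner_def, L2.inner_def]
  refine Eq.trans (integral_congr_ae ?_) ((h φ).trans (integral_congr_ae ?_))
  · filter_upwards [φ.coeFn_toLp 2 (volume : Measure (EuclideanSpace ℝ (Fin d)))] with y hy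
    rw [hy]
  · filter_upwards [(𝓕 φ).coeFn_toLp 2 (volume : Measure (EuclideanSpace ℝ (Fin d)))] with y hy
    rw [hy]

theorem integral_inner_fourierInv (φ : SchwartzMap (EuclideanSpace ℝ (Fin d)) ℂ)
    (G : Lp ℂ 2 (volume : Measure (EuclideanSpace ℝ (Fin d)))) :
    ∫ y, inner ℂ (φ y) ((𝓕⁻ G : Lp ℂ 2 volume) y) = ∫ ξ, inner ℂ (𝓕 φ ξ) (G ξ) := by
  have e : inner ℂ (φ.toLp 2 : Lp ℂ 2 (volume : Measure (EuclideanSpace ℝ (Fin d))))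
      (𝓕⁻ G : Lp ℂ 2 volume) = inner ℂ ((𝓕 φ).toLp 2 : Lp ℂ 2 volume) G := by
    rw [← Lp.inner_fourier_eq, SchwartzMap.toLp_fourier_eq, FourierTransform.fourier_fourierInv_eq]
  rw [L2.inner_def, L2.inner_def] at e
  refine Eq.trans (integral_congr_ae ?_) (e.trans (integral_congr_ae ?_))
  · filter_upwards [φ.coeFn_toLp 2 (volume : Measure (EuclideanSpace ℝ (Fin d)))] with y hy
    rw [hy]
  · filter_upwards [(𝓕 φ).coeFn_toLp 2 (volume : Measure (EuclideanSpace ℝ (Fin d)))] with y hy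
    rw [hy]

theorem fourier_compSubConst (φ : SchwartzMap (EuclideanSpace ℝ (Fin d)) ℂ)
    (x ξ : EuclideanSpace ℝ (Fin d)) : 𝓕 (φ.compSubConstCLM ℂ x) ξ
      = Complex.exp (-(2 * Real.pi * Complex.I * (⟪x, ξ⟫ : ℝ))) * 𝓕 φ ξ := by
  rw [SchwartzMap.fourier_coe, SchwartzMap.fourier_coe, Real.fourier_eq', Real.fourier_eq',
    ← integral_const_mul,
    ← integral_sub_right_eq_self (fun y => Complex.exp (-(2 * Real.pi * Complex.I * (⟪x, ξ⟫ : ℝ)))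
      * Complex.exp ((↑(-2 * Real.pi * ⟪y, ξ⟫) * Complex.I)) • φ y) x]
  congr 1
  ext1 y
  rw [SchwartzMap.compSubConstCLM_apply, smul_eq_mul, smul_eq_mul, ← mul_assoc, ← Complex.exp_add]
  congr 2
  rw [inner_sub_left]
  push_cast
  ring

/-- A translate of an inverse Fourier transform is the inverse Fourier transform of a modulation. -/
theorem fourierInv_shift {F G₁ : Lp ℂ 2 (volume : Measure (EuclideanSpace ℝ (Fin d)))}
    (G : Lp ℂ 2 (volume : Measure (EuclideanSpace ℝ (Fin d)))) (x : EuclideanSpace ℝ (Fin d))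
    (hF : F =ᵐ[volume] fun y => (𝓕⁻ G : Lp ℂ 2 volume) (y + x))
    (hG : G₁ =ᵐ[volume] fun ξ => Complex.exp (2 * Real.pi * Complex.I * (⟪x, ξ⟫ : ℝ)) * G ξ) :
    F = (𝓕⁻ G₁ : Lp ℂ 2 volume) := by
  refine eq_fourierInv_of_forall_integral_inner fun φ => ?_
  have h1 := integral_inner_fourierInv (φ.compSubConstCLM ℂ x) G
  rw [← integral_add_right_eq_self _ x] at h1
  refine Eq.trans (integral_congr_ae ?_) (h1.trans (integral_congr_ae ?_))
  · filter_upwards [hF] with y hy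
    rw [hy, SchwartzMap.compSubConstCLM_apply, add_sub_cancel_right]
  · filter_upwards [hG] with ξ hξ
    rw [hξ, fourier_compSubConst]
    simp only [RCLike.inner_apply, map_mul, ← Complex.exp_conj, map_neg, Complex.conj_ofReal,
      Complex.conj_I, map_ofNat]
    rw [show -(2 * (Real.pi : ℂ) * -Complex.I * (⟪x, ξ⟫ : ℝ))
      = 2 * Real.pi * Complex.I * (⟪x, ξ⟫ : ℝ) by ring]
    ring

/-- The inverse Fourier transform commutes with linear isometries. -/
theorem fourierInv_comp_isometry {F G₁ : Lp ℂ 2 (volume : Measure (EuclideanSpace ℝ (Fin d)))}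
    (G : Lp ℂ 2 (volume : Measure (EuclideanSpace ℝ (Fin d))))
    (R : EuclideanSpace ℝ (Fin d) ≃ₗᵢ[ℝ] EuclideanSpace ℝ (Fin d))
    (hF : F =ᵐ[volume] fun y => (𝓕⁻ G : Lp ℂ 2 volume) (R y))
    (hG : G₁ =ᵐ[volume] fun ξ => G (R ξ)) : F = (𝓕⁻ G₁ : Lp ℂ 2 volume) := by
  refine eq_fourierInv_of_forall_integral_inner fun φ => ?_
  set φ' := SchwartzMap.compCLMOfContinuousLinearEquiv ℂ R.symm.toContinuousLinearEquiv φ with hφ'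
  have e1 : ∀ y, φ' (R y) = φ y := fun y => by
    change φ (R.symm (R y)) = φ y
    rw [R.symm_apply_apply]
  have e2 : ∀ ξ, 𝓕 φ' (R ξ) = 𝓕 φ ξ := fun ξ => by
    rw [SchwartzMap.fourier_coe, SchwartzMap.fourier_coe]
    have := Real.fourier_comp_linearIsometry R.symm (φ : EuclideanSpace ℝ (Fin d) → ℂ) (R ξ)
    rw [R.symm_apply_apply] at this
    exact this
  have h1 := integral_inner_fourierInv φ' G
  rw [← R.measurePreserving.integral_comp R.toHomeomorph.measurableEmbedding,
    ← R.measurePreserving.integral_comp R.toHomeomorph.measurableEmbedding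
      (fun ξ => inner ℂ (𝓕 φ' ξ) (G ξ))] at h1
  refine Eq.trans (integral_congr_ae ?_) (h1.trans (integral_congr_ae ?_))
  · filter_upwards [hF] with y hy
    rw [hy, e1]
  · filter_upwards [hG] with ξ hξ
    rw [hξ, e2]

variable {K : ℝ → ℝ} {ρ q : EuclideanSpace ℝ (Fin d) → ℝ}

/-- By Plancherel's theorem, the autocorrelation of the inverse Fourier transform of `√ρ` is the
covariance with spectral density `ρ`. -/
theorem integral_mul_shift_of_fourierInv (hρ : Measurable ρ) (hρ0 : ∀ ξ, 0 ≤ ρ ξ)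
    (hν : IsSpectralMeasure K (volume.withDensity fun ξ => ENNReal.ofReal (ρ ξ)))
    (h : MemLp (fun ξ => (√(ρ ξ) : ℂ)) 2 volume)
    (hq : (fun x => (q x : ℂ)) =ᵐ[volume] (𝓕⁻ (h.toLp : Lp ℂ 2 volume) : Lp ℂ 2 volume))
    (x : EuclideanSpace ℝ (Fin d)) : ∫ y, q y * q (y + x) = K ‖x‖ := by
  have hqL : MemLp (fun x => (q x : ℂ)) 2 volume := (memLp_congr_ae hq).2 (Lp.memLp _)
  have hmp : MeasurePreserving (fun y : EuclideanSpace ℝ (Fin d) => y + x) volume volume :=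
    measurePreserving_add_right volume x
  have hqx : MemLp (fun y => (q (y + x) : ℂ)) 2 volume := hqL.comp_measurePreserving hmp
  have hm : AEStronglyMeasurable (fun ξ : EuclideanSpace ℝ (Fin d) =>
      Complex.exp (2 * Real.pi * Complex.I * (⟪x, ξ⟫ : ℝ))) volume :=
    (by fun_prop : Continuous fun ξ : EuclideanSpace ℝ (Fin d) =>
      Complex.exp (2 * Real.pi * Complex.I * (⟪x, ξ⟫ : ℝ))).aestronglyMeasurable
  have hexp : ∀ ξ : EuclideanSpace ℝ (Fin d),
      ‖Complex.exp (2 * Real.pi * Complex.I * (⟪x, ξ⟫ : ℝ))‖ = 1 := fun ξ => by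
    rw [show 2 * (Real.pi : ℂ) * Complex.I * (⟪x, ξ⟫ : ℝ)
      = ((2 * Real.pi * ⟪x, ξ⟫ : ℝ) : ℂ) * Complex.I by push_cast; ring]
    exact Complex.norm_exp_ofReal_mul_I _
  have hG : MemLp (fun ξ => Complex.exp (2 * Real.pi * Complex.I * (⟪x, ξ⟫ : ℝ)) * (√(ρ ξ) : ℂ)) 2
      volume := by
    refine h.of_le (hm.mul h.aestronglyMeasurable) (ae_of_all _ fun ξ => ?_)
    rw [norm_mul, hexp, one_mul]
  have hshift : hqx.toLp = (𝓕⁻ (hG.toLp : Lp ℂ 2 volume) : Lp ℂ 2 volume) := by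
    refine fourierInv_shift h.toLp x ?_ ?_
    · filter_upwards [hqx.coeFn_toLp, hmp.quasiMeasurePreserving.ae_eq_comp hq] with y h1 h2
      rw [h1]
      exact h2
    · filter_upwards [hG.coeFn_toLp, h.coeFn_toLp] with ξ h1 h2
      rw [h1, h2]
  have hq0 : hqL.toLp = (𝓕⁻ (h.toLp : Lp ℂ 2 volume) : Lp ℂ 2 volume) :=
    Lp.ext (hqL.coeFn_toLp.trans hq)
  have hinner : inner ℂ (hqL.toLp : Lp ℂ 2 volume) (hqx.toLp : Lp ℂ 2 volume)
      = inner ℂ (h.toLp : Lp ℂ 2 volume) (hG.toLp : Lp ℂ 2 volume) := by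
    rw [hq0, hshift, ← Lp.inner_fourier_eq, FourierTransform.fourier_fourierInv_eq,
      FourierTransform.fourier_fourierInv_eq]
  rw [L2.inner_def, L2.inner_def] at hinner
  have e1 : ∫ y, inner ℂ ((hqL.toLp : Lp ℂ 2 volume) y) ((hqx.toLp : Lp ℂ 2 volume) y)
      = ((∫ y, q y * q (y + x) : ℝ) : ℂ) := by
    rw [← integral_complex_ofReal]
    refine integral_congr_ae ?_
    filter_upwards [hqL.coeFn_toLp, hqx.coeFn_toLp] with y h1 h2
    rw [h1, h2]
    simp [mul_comm]
  have e2 : ∫ ξ, inner ℂ ((h.toLp : Lp ℂ 2 volume) ξ) ((hG.toLp : Lp ℂ 2 volume) ξ)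
      = (K ‖x‖ : ℂ) := by
    rw [hν.fourier, integral_withDensity_eq_integral_toReal_smul
      hρ.ennreal_ofReal (ae_of_all _ fun _ => ENNReal.ofReal_lt_top)]
    refine integral_congr_ae ?_
    filter_upwards [h.coeFn_toLp, hG.coeFn_toLp] with ξ h1 h2
    rw [h1, h2, ENNReal.toReal_ofReal (hρ0 ξ)]
    simp only [RCLike.inner_apply, Complex.conj_ofReal, Complex.real_smul]
    have : ((√(ρ ξ) : ℝ) : ℂ) * (√(ρ ξ) : ℝ) = (ρ ξ : ℂ) := by
      rw [← Complex.ofReal_mul, Real.mul_self_sqrt (hρ0 ξ)]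
    rw [← this]
    ring
  rw [e1, e2] at hinner
  exact_mod_cast hinner

/-- The spectral density of an isotropic covariance is invariant under linear isometries. -/
theorem spectralDensity_comp_isometry (hρ : Measurable ρ)
    (hν : IsSpectralMeasure K (volume.withDensity fun ξ => ENNReal.ofReal (ρ ξ)))
    (R : EuclideanSpace ℝ (Fin d) ≃ₗᵢ[ℝ] EuclideanSpace ℝ (Fin d)) :
    (fun ξ => ENNReal.ofReal (ρ (R ξ))) =ᵐ[volume] fun ξ => ENNReal.ofReal (ρ ξ) := by
  set ν := (volume : Measure (EuclideanSpace ℝ (Fin d))).withDensity fun ξ => ENNReal.ofReal (ρ ξ)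
    with hνdef
  have hfin := hν.finite
  have hRm : Measurable R.symm := R.symm.continuous.measurable
  have h1 : ν.map R.symm = volume.withDensity fun ξ => ENNReal.ofReal (ρ (R ξ)) := by
    ext s hs
    rw [Measure.map_apply hRm hs, hνdef, withDensity_apply _ (hRm hs), withDensity_apply _ hs,
      ← R.measurePreserving.setLIntegral_comp_preimage (hRm hs) hρ.ennreal_ofReal]
    congr 2
    ext y
    simp
  have hchar : ∀ t : EuclideanSpace ℝ (Fin d),
      charFun ν t = K ‖(2 * Real.pi)⁻¹ • t‖ := fun t => by
    rw [hν.fourier, charFun_apply]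
    congr 1
    ext1 ξ
    congr 1
    rw [inner_smul_left, real_inner_comm]
    have := Real.pi_ne_zero
    simp only [conj_trivial]
    push_cast
    have : (Real.pi : ℂ) ≠ 0 := by exact_mod_cast this
    field_simp
  have h2 : ν.map R.symm = ν := by
    have : IsFiniteMeasure (ν.map R.symm) := Measure.isFiniteMeasure_map ν _
    refine Measure.ext_of_charFun ?_
    ext1 t
    have e : charFun (ν.map R.symm) t = charFun ν (R t) := by
      rw [charFun_apply, charFun_apply, integral_map hRm.aemeasurable (by fun_prop)]
      congr 1
      ext1 ξ
      rw [← R.inner_map_map, R.apply_symm_apply]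
    rw [e, hchar, hchar, norm_smul, norm_smul, R.norm_map]
  rw [h1] at h2
  exact (withDensity_eq_iff_of_sigmaFinite
    (hρ.comp R.continuous.measurable).ennreal_ofReal.aemeasurable
    hρ.ennreal_ofReal.aemeasurable).1 h2

/-- The inverse Fourier transform of `√ρ` is radial. -/
theorem radial_of_fourierInv (hρ : Measurable ρ) (hρ0 : ∀ ξ, 0 ≤ ρ ξ)
    (hν : IsSpectralMeasure K (volume.withDensity fun ξ => ENNReal.ofReal (ρ ξ)))
    (h : MemLp (fun ξ => (√(ρ ξ) : ℂ)) 2 volume)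
    (hq : (fun x => (q x : ℂ)) =ᵐ[volume] (𝓕⁻ (h.toLp : Lp ℂ 2 volume) : Lp ℂ 2 volume))
    (hqc : Continuous q) {x x' : EuclideanSpace ℝ (Fin d)} (hx : ‖x‖ = ‖x'‖) : q x = q x' := by
  let R : EuclideanSpace ℝ (Fin d) ≃ₗᵢ[ℝ] EuclideanSpace ℝ (Fin d) := (ℝ ∙ (x - x'))ᗮ.reflection
  have hR : R x = x' := Submodule.reflection_sub hx
  have hqL : MemLp (fun x => (q x : ℂ)) 2 volume := (memLp_congr_ae hq).2 (Lp.memLp _)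
  have hqR : MemLp (fun y => (q (R y) : ℂ)) 2 volume :=
    hqL.comp_measurePreserving R.measurePreserving
  have hcomp := R.measurePreserving.quasiMeasurePreserving.ae_eq_comp hq
  have hG := R.measurePreserving.quasiMeasurePreserving.ae_eq_comp h.coeFn_toLp
  have e : hqR.toLp = (𝓕⁻ (h.toLp : Lp ℂ 2 volume) : Lp ℂ 2 volume) := by
    refine fourierInv_comp_isometry h.toLp R ?_ ?_
    · filter_upwards [hqR.coeFn_toLp, hcomp] with y h1 h2
      rw [h1]
      exact h2
    · filter_upwards [h.coeFn_toLp, hG, spectralDensity_comp_isometry hρ hν R] with ξ h1 h2 h3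
      have h4 : ρ (R ξ) = ρ ξ := (ENNReal.ofReal_eq_ofReal_iff (hρ0 _) (hρ0 _)).1 h3
      rw [h1]
      refine Eq.trans ?_ h2.symm
      simp only [Function.comp_apply, h4]
  have hae : (fun y => q (R y)) =ᵐ[volume] q := by
    have h5 := hqR.coeFn_toLp
    rw [e] at h5
    filter_upwards [h5, hq] with y h1 h2
    have h3 : (q y : ℂ) = q (R y) := h2.trans h1
    exact_mod_cast h3.symm
  have := congrFun ((hqc.comp R.continuous).ae_eq_iff_eq volume hqc |>.1 hae) x
  simp only [Function.comp_apply, hR] at this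
  exact this.symm

end Fourier

/-! ### Kernels with a regularly varying tail -/

section RegularTail

variable {d : ℕ}

/-- The function `q` on `ℝ^d` is comparable at infinity to the positive radial profile `Q`, which is
almost decreasing and such that `r ^ d * Q r` grows at least like a positive power `r ^ β`, up to a
multiplicative constant `A`; all bounds hold at distance at least `R` from the origin. -/
structure HasRegularTail (q : EuclideanSpace ℝ (Fin d) → ℝ) (Q : ℝ → ℝ) (R A β : ℝ) : Prop where
  one_le_radius : 1 ≤ R
  one_le_const : 1 ≤ A
  exponent_pos : 0 < β
  pos : ∀ r ≥ R, 0 < Q r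
  lower : ∀ x, R ≤ ‖x‖ → Q ‖x‖ / 2 ≤ q x
  upper : ∀ x, R ≤ ‖x‖ → q x ≤ 2 * Q ‖x‖
  le_of_le : ∀ r ≥ R, ∀ r' ≥ r, Q r' ≤ A * Q r
  growth : ∀ r ≥ R, ∀ r' ≥ r, r ^ d * Q r ≤ A * (r / r') ^ β * (r' ^ d * Q r')

variable {q : EuclideanSpace ℝ (Fin d) → ℝ} {Q : ℝ → ℝ} {R A β : ℝ}

theorem HasRegularTail.le_of_ge (h : HasRegularTail q Q R A β) {r r' : ℝ} (hr : R ≤ r)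
    (hrr : r ≤ r') : Q r ≤ A * (r' / r) ^ d * Q r' := by
  have hr0 : 0 < r := by linarith [h.one_le_radius]
  have hr0' : 0 < r' := by linarith
  have h1 := h.growth r hr r' hrr
  have h2 : (r / r') ^ β ≤ 1 :=
    Real.rpow_le_one (by positivity) ((div_le_one hr0').2 hrr) h.exponent_pos.le
  have h3 : r ^ d * Q r ≤ A * 1 * (r' ^ d * Q r') := by
    refine h1.trans ?_
    have := h.pos r' (hr.trans hrr)
    have := h.one_le_const
    gcongr
  rw [div_pow, mul_div_assoc', div_mul_eq_mul_div, le_div_iff₀ (by positivity)]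
  linarith

theorem HasRegularTail.pos_apply (h : HasRegularTail q Q R A β) {x : EuclideanSpace ℝ (Fin d)}
    (hx : R ≤ ‖x‖) : 0 < q x := by
  linarith [h.lower x hx, h.pos _ hx]

theorem exists_integral_norm_rpow_ball (hd : 0 < d) (hβ : 0 < β) : ∃ C : ℝ, 0 ≤ C ∧ ∀ L : ℝ, 0 < L →
    IntegrableOn (fun y : EuclideanSpace ℝ (Fin d) => ‖y‖ ^ (β - d)) (Metric.ball 0 L) ∧
      ∫ y in Metric.ball (0 : EuclideanSpace ℝ (Fin d)) L, ‖y‖ ^ (β - d) = C * L ^ β := by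
  refine ⟨∫ y in Metric.ball (0 : EuclideanSpace ℝ (Fin d)) 1, ‖y‖ ^ (β - d),
    integral_nonneg fun y => by positivity, fun L hL => ⟨?_, ?_⟩⟩
  · refine integrableOn_ball_of_norm_le_rpow (C := 1) (α := d - β) (μ := volume) (by
      rw [finrank_euclideanSpace_fin]; exact hd) (by rw [finrank_euclideanSpace_fin]; linarith)
      (ae_of_all _ fun y => ?_) (by fun_prop : Measurable _).aestronglyMeasurable
    rw [Real.norm_of_nonneg (by positivity), one_mul, neg_sub]
  · have h := Measure.setIntegral_comp_smul_of_pos volume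
      (fun y : EuclideanSpace ℝ (Fin d) => ‖y‖ ^ (β - d)) (Metric.ball 0 1) hL
    rw [smul_ball hL.ne', smul_zero, Real.norm_of_nonneg hL.le, mul_one,
      finrank_euclideanSpace_fin, smul_eq_mul, eq_inv_mul_iff_mul_eq₀ (by positivity)] at h
    rw [← h, ← integral_mul_const, ← integral_const_mul]
    refine integral_congr_ae (ae_of_all _ fun y => ?_)
    simp only
    rw [norm_smul, Real.norm_of_nonneg hL.le, Real.mul_rpow hL.le (norm_nonneg _), ← mul_assoc,
      ← Real.rpow_natCast, ← Real.rpow_add hL, mul_comm]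
    congr 2
    ring

/-- Over a ball of radius `L`, the integral of a kernel with a regular tail is of order
`L ^ d * Q L`. -/
theorem HasRegularTail.exists_integral_ball_le (h : HasRegularTail q Q R A β) (hq : Continuous q)
    (hd : 0 < d) : ∃ C : ℝ, 0 ≤ C ∧ ∀ L ≥ R,
      ∫ y in Metric.ball (0 : EuclideanSpace ℝ (Fin d)) L, |q y| ≤ C * (L ^ d * Q L) := by
  obtain ⟨C, hC, hCL⟩ := exists_integral_norm_rpow_ball (d := d) hd h.exponent_pos
  have hR1 := h.one_le_radius
  have hA1 := h.one_le_const
  have hloc : ∀ L, IntegrableOn (fun y => |q y|) (Metric.ball 0 L) := fun L =>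
    (hq.abs.continuousOn.integrableOn_compact (isCompact_closedBall 0 L)).mono_set
      Metric.ball_subset_closedBall
  set I := ∫ y in Metric.ball (0 : EuclideanSpace ℝ (Fin d)) R, |q y|
  have hI : 0 ≤ I := integral_nonneg fun y => abs_nonneg _
  have hQR := h.pos R le_rfl
  refine ⟨I * (A / (R ^ d * Q R)) + 2 * A * C, by positivity, fun L hL => ?_⟩
  have hL0 : 0 < L := by linarith
  have hQL := h.pos L hL
  have hdiff : ∫ y in Metric.ball (0 : EuclideanSpace ℝ (Fin d)) L \ Metric.ball 0 R, |q y|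
      ≤ 2 * A * C * (L ^ d * Q L) := by
    calc ∫ y in Metric.ball (0 : EuclideanSpace ℝ (Fin d)) L \ Metric.ball 0 R, |q y|
        ≤ ∫ y in Metric.ball (0 : EuclideanSpace ℝ (Fin d)) L \ Metric.ball 0 R,
            2 * A * (L ^ d * Q L) * L ^ (-β) * ‖y‖ ^ (β - d) := by
          refine setIntegral_mono_on ((hloc L).mono_set sdiff_subset)
            (((hCL L hL0).1.mono_set sdiff_subset).const_mul _)
            (Metric.isOpen_ball.measurableSet.diff Metric.isOpen_ball.measurableSet) fun y hy => ?_
          have hy1 : ‖y‖ ≤ L := by simpa using (mem_ball_zero_iff.1 hy.1).le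
          have hy2 : R ≤ ‖y‖ := by simpa using hy.2
          have hy0 : 0 < ‖y‖ := by linarith
          rw [abs_of_pos (h.pos_apply hy2)]
          have h1 := h.growth _ hy2 _ hy1
          rw [mul_comm (‖y‖ ^ d), ← le_div_iff₀ (by positivity)] at h1
          refine (h.upper y hy2).trans ((mul_le_mul_of_nonneg_left h1 zero_le_two).trans
            (le_of_eq ?_))
          rw [Real.div_rpow hy0.le hL0.le, Real.rpow_neg hL0.le, Real.rpow_sub hy0,
            Real.rpow_natCast]
          field_simp
      _ ≤ ∫ y in Metric.ball (0 : EuclideanSpace ℝ (Fin d)) L,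
            2 * A * (L ^ d * Q L) * L ^ (-β) * ‖y‖ ^ (β - d) := by
          refine setIntegral_mono_set ((hCL L hL0).1.const_mul _)
            (ae_of_all _ fun y => by simp only [Pi.zero_apply]; positivity)
            (LE.le.eventuallyLE sdiff_subset)
      _ = 2 * A * C * (L ^ d * Q L) := by
          rw [integral_const_mul, (hCL L hL0).2, Real.rpow_neg hL0.le]
          have := (Real.rpow_pos_of_pos hL0 β).ne'
          field_simp
  have hsplit := setIntegral_sdiff (μ := volume) Metric.isOpen_ball.measurableSet (hloc L)
    (Metric.ball_subset_ball (x := (0 : EuclideanSpace ℝ (Fin d))) hL)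
  rw [hsplit] at hdiff
  have h2 : I ≤ I * (A / (R ^ d * Q R)) * (L ^ d * Q L) := by
    have h3 := h.growth R le_rfl L hL
    have h4 : (R / L) ^ β ≤ 1 :=
      Real.rpow_le_one (by positivity) ((div_le_one hL0).2 hL) h.exponent_pos.le
    have h5 : R ^ d * Q R ≤ A * (L ^ d * Q L) := by
      refine h3.trans ?_
      have : A * (R / L) ^ β ≤ A := mul_le_of_le_one_right (by linarith) h4
      gcongr
    rw [mul_assoc]
    refine le_mul_of_one_le_right hI ?_
    rw [div_mul_eq_mul_div, one_le_div (by positivity)]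
    exact h5
  linarith

/-- The contribution to the autocorrelation at `x` of the points at distance at most `L / 2` from
the origin. -/
theorem HasRegularTail.exists_integral_near_le (h : HasRegularTail q Q R A β) (hq : Continuous q)
    (hd : 0 < d) : ∃ C : ℝ, 0 ≤ C ∧ ∀ L ≥ R, ∀ x : EuclideanSpace ℝ (Fin d), 2 * L ≤ ‖x‖ →
      ∫ y in {y : EuclideanSpace ℝ (Fin d) | ‖y‖ ≤ L / 2}, |q y * q (y + x)|
        ≤ C * (L ^ d * Q L * Q ‖x‖) := by
  obtain ⟨C, hC, hI⟩ := h.exists_integral_ball_le hq hd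
  have hR1 := h.one_le_radius
  have hA1 := h.one_le_const
  refine ⟨C * (2 * (A * (A * (4 / 3) ^ d))), by positivity, fun L hL x hx => ?_⟩
  have hL0 : 0 < L := by linarith
  have hx0 : 0 < ‖x‖ := by linarith
  have hQx := h.pos ‖x‖ (by linarith)
  have hfar : ∀ y : EuclideanSpace ℝ (Fin d), ‖y‖ ≤ L / 2 →
      |q (y + x)| ≤ 2 * (A * (A * (4 / 3) ^ d)) * Q ‖x‖ := fun y hy => by
    have h1 : 3 / 4 * ‖x‖ ≤ ‖y + x‖ := by
      have := norm_sub_le (y + x) y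
      rw [add_sub_cancel_left] at this
      linarith
    have h2 : R ≤ 3 / 4 * ‖x‖ := by linarith
    have h3 := h.le_of_le _ h2 _ h1
    have h4 := h.le_of_ge h2 (by linarith : 3 / 4 * ‖x‖ ≤ ‖x‖)
    rw [show ‖x‖ / (3 / 4 * ‖x‖) = 4 / 3 by field_simp] at h4
    rw [abs_of_pos (h.pos_apply (h2.trans h1))]
    have h5 := mul_le_mul_of_nonneg_left h4 (by linarith : 0 ≤ A)
    linarith [h.upper _ (h2.trans h1)]
  have hsub : {y : EuclideanSpace ℝ (Fin d) | ‖y‖ ≤ L / 2} ⊆ Metric.ball 0 L := fun y hy => by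
    have : ‖y‖ ≤ L / 2 := hy
    rw [mem_ball_zero_iff]
    linarith
  have hm : MeasurableSet {y : EuclideanSpace ℝ (Fin d) | ‖y‖ ≤ L / 2} :=
    measurableSet_le measurable_norm measurable_const
  have hloc : ∀ g : EuclideanSpace ℝ (Fin d) → ℝ, Continuous g →
      IntegrableOn g (Metric.ball 0 L) := fun g hg =>
    (hg.continuousOn.integrableOn_compact (isCompact_closedBall 0 L)).mono_set
      Metric.ball_subset_closedBall
  calc ∫ y in {y : EuclideanSpace ℝ (Fin d) | ‖y‖ ≤ L / 2}, |q y * q (y + x)|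
      ≤ ∫ y in {y : EuclideanSpace ℝ (Fin d) | ‖y‖ ≤ L / 2},
          |q y| * (2 * (A * (A * (4 / 3) ^ d)) * Q ‖x‖) := by
        refine setIntegral_mono_on ((hloc _ (by fun_prop)).mono_set hsub)
          ((hloc _ (by fun_prop)).mono_set hsub) hm fun y hy => ?_
        rw [abs_mul]
        exact mul_le_mul_of_nonneg_left (hfar y hy) (abs_nonneg _)
    _ ≤ ∫ y in Metric.ball (0 : EuclideanSpace ℝ (Fin d)) L,
          |q y| * (2 * (A * (A * (4 / 3) ^ d)) * Q ‖x‖) := by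
        refine setIntegral_mono_set (hloc _ (by fun_prop))
          (ae_of_all _ fun y => by simp only [Pi.zero_apply]; positivity)
          (LE.le.eventuallyLE hsub)
    _ ≤ C * (L ^ d * Q L) * (2 * (A * (A * (4 / 3) ^ d)) * Q ‖x‖) := by
        rw [integral_mul_const]
        exact mul_le_mul_of_nonneg_right (hI L hL) (by positivity)
    _ = _ := by ring

/-- The autocorrelation at `x` controls the square of the kernel at distance at least `2 * ‖x‖`:
there `q y * q (y + x)` is comparable to `q y ^ 2`, while the product can be negative only if `y` or
`y + x` stays in a fixed ball. -/
theorem HasRegularTail.exists_integral_sq_far_le (h : HasRegularTail q Q R A β) (hq : Continuous q)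
    (hq2 : MemLp q 2 volume) : ∃ B C : ℝ, 0 ≤ B ∧ 0 ≤ C ∧
    ∀ x : EuclideanSpace ℝ (Fin d), 4 * R ≤ ‖x‖ →
      ∫ y in {y : EuclideanSpace ℝ (Fin d) | 2 * ‖x‖ ≤ ‖y‖}, q y ^ 2
        ≤ B * (∫ y, q y * q (y + x)) + C * Q ‖x‖ := by
  have hR1 := h.one_le_radius
  have hA1 := h.one_le_const
  obtain ⟨S, hS⟩ := (isCompact_closedBall (0 : EuclideanSpace ℝ (Fin d)) R).exists_bound_of_continuousOn
    hq.continuousOn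
  have hS0 : 0 ≤ S := (norm_nonneg _).trans (hS 0 (by simp; linarith))
  set B := 4 * A * 2 ^ d with hB
  set T := S * (2 * (A * (A * (4 / 3) ^ d))) with hT
  set w := volume.real (Metric.closedBall (0 : EuclideanSpace ℝ (Fin d)) R)
  have hB0 : 0 < B := by positivity
  have hT0 : 0 ≤ T := by positivity
  refine ⟨B, 2 * B * T * w, hB0.le, by positivity, fun x hx => ?_⟩
  have hx0 : 0 < ‖x‖ := by linarith
  have hQx := h.pos ‖x‖ (by linarith)
  -- values of the kernel at points which are not much closer to the origin than `x`
  have hfar : ∀ y : EuclideanSpace ℝ (Fin d), 3 / 4 * ‖x‖ ≤ ‖y‖ →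
      |q y| ≤ 2 * (A * (A * (4 / 3) ^ d)) * Q ‖x‖ := fun y hy => by
    have h2 : R ≤ 3 / 4 * ‖x‖ := by linarith
    have h3 := h.le_of_le _ h2 _ hy
    have h4 := h.le_of_ge h2 (by linarith : 3 / 4 * ‖x‖ ≤ ‖x‖)
    rw [show ‖x‖ / (3 / 4 * ‖x‖) = 4 / 3 by field_simp] at h4
    rw [abs_of_pos (h.pos_apply (h2.trans hy))]
    have h5 := mul_le_mul_of_nonneg_left h4 (by linarith : 0 ≤ A)
    linarith [h.upper _ (h2.trans hy)]
  set D := Metric.closedBall (0 : EuclideanSpace ℝ (Fin d)) R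
  have hDm : MeasurableSet D := Metric.isClosed_closedBall.measurableSet
  set χ : EuclideanSpace ℝ (Fin d) → ℝ := D.indicator fun _ => 1
  have hχ0 : ∀ y, 0 ≤ χ y := fun y => indicator_nonneg (fun _ _ => zero_le_one) _
  have hχ1 : ∀ y, ‖y‖ ≤ R → χ y = 1 := fun y hy => indicator_of_mem (by simpa [D] using hy) _
  have hχi : Integrable χ volume := by
    refine (integrable_indicator_iff hDm).2 ?_
    exact integrableOn_const measure_closedBall_lt_top.ne
  have hχx : Integrable (fun y => χ (y + x)) volume := hχi.comp_add_right x
  have iprod : Integrable (fun y => q y * q (y + x)) volume :=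
    hq2.integrable_mul (hq2.comp_measurePreserving (measurePreserving_add_right volume x))
  have hbad : ∀ y z : EuclideanSpace ℝ (Fin d), ‖y‖ ≤ R → ‖x‖ ≤ ‖y‖ + ‖z‖ →
      |q y * q z| ≤ T * Q ‖x‖ := fun y z hy hz => by
    have h1 : |q y| ≤ S := hS y (mem_closedBall_zero_iff.2 hy)
    have h2 := hfar z (by linarith)
    rw [abs_mul]
    refine (mul_le_mul h1 h2 (abs_nonneg _) hS0).trans (le_of_eq ?_)
    rw [hT]
    ring
  have hpt : ∀ y, {y : EuclideanSpace ℝ (Fin d) | 2 * ‖x‖ ≤ ‖y‖}.indicator (fun y => q y ^ 2) y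
      ≤ B * (q y * q (y + x)) + B * (T * Q ‖x‖) * (χ y + χ (y + x)) := fun y => by
    have htri1 : ‖x‖ ≤ ‖y‖ + ‖y + x‖ := by
      have := norm_sub_le (y + x) y
      rw [add_sub_cancel_left] at this
      linarith
    have hrest : 0 ≤ B * (T * Q ‖x‖) * (χ y + χ (y + x)) :=
      mul_nonneg (by positivity) (add_nonneg (hχ0 _) (hχ0 _))
    by_cases hy : 2 * ‖x‖ ≤ ‖y‖
    · rw [indicator_of_mem (by exact hy)]
      have hyR : R ≤ ‖y‖ := by linarith
      have htri2 : ‖y‖ ≤ 2 * ‖y + x‖ := by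
        have := norm_sub_le (y + x) x
        rw [add_sub_cancel_right] at this
        linarith
      have htri3 : ‖y + x‖ ≤ 2 * ‖y‖ := by
        have := norm_add_le y x
        linarith
      have hzR : R ≤ ‖y + x‖ := by linarith
      have hz0 : 0 < ‖y + x‖ := by linarith
      have hy0 : 0 < ‖y‖ := by linarith
      have hQz := h.pos _ hzR
      have h1 : Q ‖y‖ ≤ A * 2 ^ d * Q ‖y + x‖ := by
        rcases le_total ‖y + x‖ ‖y‖ with hle | hle
        · refine (h.le_of_le _ hzR _ hle).trans ?_
          have : (1 : ℝ) ≤ 2 ^ d := one_le_pow₀ (by norm_num)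
          have h2 : A ≤ A * 2 ^ d := le_mul_of_one_le_right (by linarith) this
          gcongr
        · refine (h.le_of_ge hyR hle).trans ?_
          have : ‖y + x‖ / ‖y‖ ≤ 2 := (div_le_iff₀ hy0).2 htri3
          gcongr
      have h2 : q y ≤ B * q (y + x) := by
        have h3 := h.upper y hyR
        have h4 := h.lower (y + x) hzR
        have h5 : A * 2 ^ d * (Q ‖y + x‖ / 2) ≤ A * 2 ^ d * q (y + x) := by gcongr
        rw [hB]
        linarith
      have h3 := mul_le_mul_of_nonneg_left h2 (h.pos_apply hyR).le
      nlinarith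
    · rw [indicator_of_notMem (by exact hy)]
      by_cases h1 : ‖y‖ ≤ R
      · have h2 := hbad y (y + x) h1 htri1
        have h3 := neg_le_of_abs_le h2
        have h4 : T * Q ‖x‖ ≤ T * Q ‖x‖ * (χ y + χ (y + x)) := by
          rw [hχ1 y h1]
          exact le_mul_of_one_le_right (by positivity) (by linarith [hχ0 (y + x)])
        nlinarith
      · by_cases h1' : ‖y + x‖ ≤ R
        · have h2 := hbad (y + x) y h1' (by linarith)
          rw [mul_comm] at h2
          have h3 := neg_le_of_abs_le h2
          have h4 : T * Q ‖x‖ ≤ T * Q ‖x‖ * (χ y + χ (y + x)) := by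
            rw [hχ1 (y + x) h1']
            exact le_mul_of_one_le_right (by positivity) (by linarith [hχ0 y])
          nlinarith
        · have h2 := h.pos_apply (le_of_not_ge h1)
          have h3 := h.pos_apply (le_of_not_ge h1')
          positivity
  have hm : MeasurableSet {y : EuclideanSpace ℝ (Fin d) | 2 * ‖x‖ ≤ ‖y‖} :=
    measurableSet_le measurable_const measurable_norm
  have hχs : Integrable (fun y => χ y + χ (y + x)) volume := hχi.add hχx
  have hχc : Integrable (fun y => B * (T * Q ‖x‖) * (χ y + χ (y + x))) volume := hχs.const_mul _
  have e1 : ∫ y, χ y = w := by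
    rw [integral_indicator hDm, setIntegral_const, smul_eq_mul, mul_one]
  have e2 : ∫ y, χ (y + x) = w := by
    rw [integral_add_right_eq_self χ x, e1]
  calc ∫ y in {y : EuclideanSpace ℝ (Fin d) | 2 * ‖x‖ ≤ ‖y‖}, q y ^ 2
      = ∫ y, {y : EuclideanSpace ℝ (Fin d) | 2 * ‖x‖ ≤ ‖y‖}.indicator (fun y => q y ^ 2) y :=
        (integral_indicator hm).symm
    _ ≤ ∫ y, (B * (q y * q (y + x)) + B * (T * Q ‖x‖) * (χ y + χ (y + x))) :=
        integral_mono (hq2.integrable_sq.indicator hm) ((iprod.const_mul B).add hχc) hpt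
    _ = B * (∫ y, q y * q (y + x)) + 2 * B * T * w * Q ‖x‖ := by
        rw [integral_add (iprod.const_mul B) hχc, integral_const_mul, integral_const_mul,
          integral_add hχi hχx, e1, e2]
        ring

end RegularTail

section RegularTailField

variable {d : ℕ}

theorem exists_of_eventually_cocompact {p : EuclideanSpace ℝ (Fin d) → Prop}
    (h : ∀ᶠ x in cocompact (EuclideanSpace ℝ (Fin d)), p x) : ∃ R : ℝ, ∀ x, R ≤ ‖x‖ → p x := by
  rw [← Metric.cobounded_eq_cocompact, ← comap_norm_atTop, eventually_comap, eventually_atTop] at h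
  obtain ⟨R, hR⟩ := h
  exact ⟨R, fun x hx => hR _ hx x rfl⟩

/-- Potter's bounds for the slowly varying factor `m` of the profile. -/
theorem exists_hasRegularTail {q : EuclideanSpace ℝ (Fin d) → ℝ} {m : ℝ → ℝ} {R₀ α c : ℝ}
    (hc : 0 < c) (hα : 0 ≤ α) (hαd : α < d) (hm : ContinuousOn m (Ici R₀)) (hR₀ : 0 < R₀)
    (hpos : ∀ r ≥ R₀, 0 < m r) (hratio : ∀ a, 0 < a → Tendsto (fun r => m (a * r) / m r) atTop (𝓝 1))
    (hq : q ~[cocompact _] fun x => c * ‖x‖ ^ (-((d + α) / 2)) * √(m ‖x‖)) :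
    ∃ R A, HasRegularTail q (fun r => c * r ^ (-((d + α) / 2)) * √(m r)) R A ((d - α) / 4) := by
  set β := (d - α) / 4 with hβdef
  have hβ : 0 < β := by rw [hβdef]; linarith
  obtain ⟨R₁, hR₁, hP⟩ := potter_bounds hm hR₀ hpos hratio (δ := 2 * β) (by linarith)
  obtain ⟨R₂, hR₂⟩ := exists_of_eventually_cocompact
    (hq.isLittleO.def (by norm_num : (0 : ℝ) < 1 / 2))
  have hR1 : ∀ r ≥ max 1 (max R₁ R₂), 1 ≤ r ∧ R₁ ≤ r ∧ R₂ ≤ r := fun r hr =>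
    ⟨(le_max_left _ _).trans hr, ((le_max_left _ _).trans (le_max_right _ _)).trans hr,
      ((le_max_right _ _).trans (le_max_right _ _)).trans hr⟩
  have hQ : ∀ r ≥ max 1 (max R₁ R₂), 0 < c * r ^ (-((d + α) / 2)) * √(m r) := fun r hr => by
    obtain ⟨h1, h2, -⟩ := hR1 r hr
    have := hpos r (hR₁.trans h2)
    have : 0 < r := by linarith
    positivity
  have hsqrt : ∀ a, 0 < a → ∀ t, 0 ≤ t →
      √(Real.exp (2 * β) * a ^ (2 * β) * t) = Real.exp β * a ^ β * √t := fun a ha t ht => by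
    rw [Real.sqrt_mul' _ ht]
    congr 1
    rw [show Real.exp (2 * β) * a ^ (2 * β) = (Real.exp β * a ^ β) ^ 2 by
      rw [mul_pow, ← Real.exp_nat_mul, ← Real.rpow_natCast (a ^ β), ← Real.rpow_mul ha.le,
        mul_comm β]
      norm_num]
    exact Real.sqrt_sq (by positivity)
  refine ⟨max 1 (max R₁ R₂), Real.exp β, le_max_left _ _, Real.one_le_exp hβ.le, hβ, hQ,
    fun x hx => ?_, fun x hx => ?_, fun r hr r' hrr => ?_, fun r hr r' hrr => ?_⟩
  · have h1 := hR₂ x (hR1 _ hx).2.2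
    have h2 := hQ _ hx
    simp only [Pi.sub_apply] at h1
    rw [Real.norm_of_nonneg h2.le, Real.norm_eq_abs] at h1
    linarith [(abs_le.1 h1).1]
  · have h1 := hR₂ x (hR1 _ hx).2.2
    have h2 := hQ _ hx
    simp only [Pi.sub_apply] at h1
    rw [Real.norm_of_nonneg h2.le, Real.norm_eq_abs] at h1
    linarith [(abs_le.1 h1).2]
  · obtain ⟨h1, h2, -⟩ := hR1 r hr
    have hr0 : 0 < r := by linarith
    have ha1 : 1 ≤ r' / r := (one_le_div hr0).2 hrr
    have ha0 : 0 < r' / r := by linarith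
    have h3 := Real.sqrt_le_sqrt ((hP r h2 (r' / r) ha1).1)
    rw [div_mul_cancel₀ _ hr0.ne', hsqrt _ ha0 _ (hpos r (hR₁.trans h2)).le] at h3
    have h4 : r' ^ (-((d + α) / 2)) = (r' / r) ^ (-((d + α) / 2)) * r ^ (-((d + α) / 2)) := by
      rw [← Real.mul_rpow ha0.le hr0.le, div_mul_cancel₀ _ hr0.ne']
    have h5 : (r' / r) ^ (-((d + α) / 2)) * (r' / r) ^ β ≤ 1 := by
      rw [← Real.rpow_add ha0]
      refine Real.rpow_le_one_of_one_le_of_nonpos ha1 ?_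
      rw [hβdef]
      linarith
    calc c * r' ^ (-((d + α) / 2)) * √(m r')
        ≤ c * r' ^ (-((d + α) / 2)) * (Real.exp β * (r' / r) ^ β * √(m r)) := by
          have : 0 < r' := by linarith
          gcongr
      _ = Real.exp β * (c * r ^ (-((d + α) / 2)) * √(m r))
            * ((r' / r) ^ (-((d + α) / 2)) * (r' / r) ^ β) := by rw [h4]; ring
      _ ≤ _ := mul_le_of_le_one_right (mul_nonneg (Real.exp_pos _).le (hQ r hr).le) h5
  · obtain ⟨h1, h2, -⟩ := hR1 r hr
    have hr0 : 0 < r := by linarith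
    have hr0' : 0 < r' := by linarith
    have ha1 : 1 ≤ r' / r := (one_le_div hr0).2 hrr
    have ha0 : 0 < r' / r := by linarith
    have hr' : R₀ ≤ r' := (hR₁.trans h2).trans hrr
    have h3 := Real.sqrt_le_sqrt ((hP r h2 (r' / r) ha1).2)
    rw [div_mul_cancel₀ _ hr0.ne', hsqrt _ ha0 _ (hpos r' hr').le] at h3
    have hpow : ∀ s : ℝ, 0 < s → s ^ d * s ^ (-((d + α) / 2)) = s ^ β * s ^ β := fun s hs => by
      rw [← Real.rpow_natCast, ← Real.rpow_add hs, ← Real.rpow_add hs]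
      congr 1
      rw [hβdef]
      ring
    have e1 : r ^ β * (r' / r) ^ β = r' ^ β := by
      rw [← Real.mul_rpow hr0.le ha0.le, mul_div_cancel₀ _ hr0.ne']
    have e2 : (r / r') ^ β * r' ^ β = r ^ β := by
      rw [← Real.mul_rpow (by positivity) hr0'.le, div_mul_cancel₀ _ hr0'.ne']
    calc r ^ d * (c * r ^ (-((d + α) / 2)) * √(m r))
        = c * (r ^ β * r ^ β) * √(m r) := by rw [← hpow r hr0]; ring
      _ ≤ c * (r ^ β * r ^ β) * (Real.exp β * (r' / r) ^ β * √(m r')) := by gcongr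
      _ = Real.exp β * c * r ^ β * (r ^ β * (r' / r) ^ β) * √(m r') := by ring
      _ = Real.exp β * c * ((r / r') ^ β * r' ^ β) * r' ^ β * √(m r') := by rw [e1, e2]
      _ = Real.exp β * (r / r') ^ β * (c * (r' ^ β * r' ^ β) * √(m r')) := by ring
      _ = _ := by rw [← hpow r' hr0']; ring

theorem integral_dirac_prod {A : Set (EuclideanSpace ℝ (Fin d))} (hA : MeasurableSet A)
    (F : ℝ × EuclideanSpace ℝ (Fin d) → ℝ) :
    ∫ z in {z | z.2 ∈ A}, F z ∂((Measure.dirac (0 : ℝ)).prod volume) = ∫ y in A, F (0, y) := by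
  have hm : MeasurableSet {z : ℝ × EuclideanSpace ℝ (Fin d) | z.2 ∈ A} := measurable_snd hA
  rw [Measure.dirac_prod, (measurableEmbedding_prodMk_left (0 : ℝ)).setIntegral_map]
  rfl

theorem integral_dirac_prod_univ (F : ℝ × EuclideanSpace ℝ (Fin d) → ℝ) :
    ∫ z, F z ∂((Measure.dirac (0 : ℝ)).prod volume) = ∫ y, F (0, y) := by
  rw [Measure.dirac_prod, (measurableEmbedding_prodMk_left (0 : ℝ)).integral_map]

theorem isSmoothKernel_dirac {q : EuclideanSpace ℝ (Fin d) → ℝ} (hq : ContDiff ℝ 2 q)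
    (h0 : MemLp q 2 volume) (h1 : MemLp (fun y => ‖fderiv ℝ q y‖) 2 volume)
    (h2 : MemLp (fun y => ‖fderiv ℝ (fderiv ℝ q) y‖) 2 volume) :
    IsSmoothKernel (Measure.dirac 0) fun _ => q :=
  have hmp : MeasurePreserving (Prod.snd : ℝ × EuclideanSpace ℝ (Fin d) → _)
    ((Measure.dirac (0 : ℝ)).prod volume) volume := measurePreserving_snd
  ⟨hq.comp contDiff_snd, h0.comp_measurePreserving hmp, h1.comp_measurePreserving hmp,
    h2.comp_measurePreserving hmp⟩

section Bounds

variable {K ℓ : ℝ → ℝ} {α : ℝ} {q : EuclideanSpace ℝ (Fin d) → ℝ} {Q : ℝ → ℝ} {R A β : ℝ}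

theorem HasRegularTail.isBigO_profile (h : HasRegularTail q Q R A β)
    (hQK : (fun r => r ^ d * Q r ^ 2) =O[atTop] K) : Q =O[atTop] K := by
  have hR1 := h.one_le_radius
  have hA1 := h.one_le_const
  refine IsBigO.trans (IsBigO.of_bound (A / (R ^ d * Q R)) ?_) hQK
  filter_upwards [eventually_ge_atTop R] with r hr
  have hr0 : 0 < r := by linarith
  have hQr := h.pos r hr
  have hQR := h.pos R le_rfl
  have hR0 : 0 < R := by linarith
  have h1 := h.growth R le_rfl r hr
  have h2 : (R / r) ^ β ≤ 1 :=
    Real.rpow_le_one (by positivity) ((div_le_one hr0).2 hr) h.exponent_pos.le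
  have h3 : R ^ d * Q R ≤ A * (r ^ d * Q r) := by
    refine h1.trans ?_
    have : A * (R / r) ^ β ≤ A := mul_le_of_le_one_right (by linarith) h2
    gcongr
  rw [Real.norm_of_nonneg hQr.le, Real.norm_of_nonneg (by positivity), div_mul_eq_mul_div,
    le_div_iff₀ (by positivity)]
  nlinarith

/-- The tail of the kernel carries a variance of order `K L`. -/
theorem HasRegularTail.isBigO_variance (h : HasRegularTail q Q R A β) (hd : 0 < d)
    (hℓ : IsSlowlyVarying ℓ) (hKℓ : K ~[atTop] fun r => r ^ (-α) * ℓ r) (hqc : Continuous q)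
    (hq2 : MemLp q 2 volume) (hK : ∀ x, ∫ y, q y * q (y + x) = K ‖x‖)
    (hQK : (fun r => r ^ d * Q r ^ 2) =O[atTop] K) :
    (fun L : ℝ => ∫ y in {y : EuclideanSpace ℝ (Fin d) | L / 4 ≤ ‖y‖}, q y ^ 2) =O[atTop] K := by
  have hR1 := h.one_le_radius
  obtain ⟨B, C, hB, hC, hfar⟩ := h.exists_integral_sq_far_le hqc hq2
  have h8 := isBigO_comp_const_mul hℓ hKℓ (by norm_num : (0 : ℝ) < 1 / 8)
  have ht8 : Tendsto (fun r : ℝ => 1 / 8 * r) atTop atTop :=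
    tendsto_id.const_mul_atTop (by norm_num)
  have hQ8 := ((h.isBigO_profile hQK).comp_tendsto ht8).trans h8
  refine IsBigO.trans (IsBigO.of_bound 1 ?_) ((h8.const_mul_left B).add (hQ8.const_mul_left C))
  filter_upwards [eventually_ge_atTop (32 * R)] with L hL
  rw [Real.norm_of_nonneg (integral_nonneg fun z => sq_nonneg _), one_mul]
  obtain ⟨x, hx⟩ := exists_euclidean_norm_eq hd (by linarith : 0 ≤ 1 / 8 * L)
  have h9 := hfar x (by linarith)
  rw [hK, hx, show 2 * (1 / 8 * L) = L / 4 by ring] at h9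
  exact h9.trans (le_abs_self _)

/-- The points close to the origin contribute a negligible part of the covariance at large
distance. -/
theorem HasRegularTail.exists_near_le_mul (h : HasRegularTail q Q R A β) (hd : 0 < d)
    (hℓ : IsSlowlyVarying ℓ) (hKℓ : K ~[atTop] fun r => r ^ (-α) * ℓ r) (hqc : Continuous q)
    (hQK : (fun r => r ^ d * Q r ^ 2) =O[atTop] K) {ε : ℝ} (hε : 0 < ε) :
    ∃ M₀ L₀ : ℝ, ∀ L ≥ L₀, 1 ≤ L ∧ ∀ x : EuclideanSpace ℝ (Fin d), M₀ * L ≤ ‖x‖ → 0 < K ‖x‖ ∧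
      2 * ∫ y in {y : EuclideanSpace ℝ (Fin d) | ‖y‖ ≤ L / 2}, |q y * q (y + x)| ≤ ε * K ‖x‖ := by
  have hR1 := h.one_le_radius
  have hA1 := h.one_le_const
  have hβ := h.exponent_pos
  have hpos := eventually_pos_of_isEquivalent hℓ hKℓ
  obtain ⟨C, hC, hnear⟩ := h.exists_integral_near_le hqc hd
  obtain ⟨C', hC', hQKb⟩ := hQK.exists_pos
  obtain ⟨R', hR'⟩ := eventually_atTop.1 (hpos.and hQKb.bound)
  set D := 2 * C * A * C' + 1
  have hD : 0 < D := by positivity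
  set N := (D / ε) ^ (1 / β)
  have hN : 0 < N := by positivity
  have hNβ : N ^ β = D / ε := by
    rw [← Real.rpow_mul (by positivity), one_div_mul_cancel hβ.ne', Real.rpow_one]
  refine ⟨max 2 N, max R R', fun L hL => ⟨hR1.trans ((le_max_left _ _).trans hL), fun x hx => ?_⟩⟩
  have hLR : R ≤ L := (le_max_left _ _).trans hL
  have hL0 : 0 < L := by linarith
  have hx2 : 2 * L ≤ ‖x‖ := (mul_le_mul_of_nonneg_right (le_max_left _ _) hL0.le).trans hx
  have hxN : N * L ≤ ‖x‖ := (mul_le_mul_of_nonneg_right (le_max_right _ _) hL0.le).trans hx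
  have hx0 : 0 < ‖x‖ := by linarith
  obtain ⟨hKx, hQx⟩ := hR' ‖x‖ (by linarith [(le_max_right R R').trans hL])
  have hQpos := h.pos ‖x‖ (by linarith)
  rw [Real.norm_of_nonneg (by positivity), Real.norm_of_nonneg hKx.le] at hQx
  have h2 := hnear L hLR x hx2
  have h3 := h.growth L hLR ‖x‖ (by linarith)
  have h4 : (L / ‖x‖) ^ β ≤ ε / D := by
    have h5 : L / ‖x‖ ≤ N⁻¹ := by
      rw [div_le_iff₀ hx0, inv_mul_eq_div, le_div_iff₀ hN]
      linarith
    refine (Real.rpow_le_rpow (by positivity) h5 hβ.le).trans (le_of_eq ?_)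
    rw [Real.inv_rpow hN.le, hNβ, inv_div]
  refine ⟨hKx, ?_⟩
  have h6 : 2 * C * A * C' ≤ D := by simp only [D]; linarith
  calc 2 * ∫ y in {y : EuclideanSpace ℝ (Fin d) | ‖y‖ ≤ L / 2}, |q y * q (y + x)|
      ≤ 2 * (C * (L ^ d * Q L * Q ‖x‖)) := by gcongr
    _ ≤ 2 * (C * (A * (L / ‖x‖) ^ β * (‖x‖ ^ d * Q ‖x‖) * Q ‖x‖)) := by gcongr
    _ = 2 * C * A * (L / ‖x‖) ^ β * (‖x‖ ^ d * Q ‖x‖ ^ 2) := by ring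
    _ ≤ 2 * C * A * (ε / D) * (C' * K ‖x‖) := by gcongr
    _ = 2 * C * A * C' / D * ε * K ‖x‖ := by ring
    _ ≤ 1 * ε * K ‖x‖ := by
        gcongr
        exact (div_le_one hD).2 h6
    _ = ε * K ‖x‖ := by ring

end Bounds

/-- The decomposition criterion for moving averages of white noise whose kernel has a regular
tail. -/
theorem hasLocalGlobalDecomposition_of_hasRegularTail {Ω : Type*} [MeasurableSpace Ω]
    {P : Measure Ω} {f : EuclideanSpace ℝ (Fin d) → Ω → ℝ} {K : ℝ → ℝ}
    (hf : IsIsotropicGaussianField f K P) (hd : 0 < d) {ℓ : ℝ → ℝ} {α : ℝ} (hℓ : IsSlowlyVarying ℓ)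
    (hKℓ : K ~[atTop] fun r => r ^ (-α) * ℓ r) {q : EuclideanSpace ℝ (Fin d) → ℝ}
    (hqc : ContDiff ℝ 2 q) (hq2 : MemLp q 2 volume) (hDq2 : MemLp (fun y => ‖fderiv ℝ q y‖) 2 volume)
    (hDDq2 : MemLp (fun y => ‖fderiv ℝ (fderiv ℝ q) y‖) 2 volume) (hrad : ∀ y y', ‖y‖ = ‖y'‖ → q y = q y')
    (hK : ∀ x, ∫ y, q y * q (y + x) = K ‖x‖) {Q : ℝ → ℝ} {R A β : ℝ}
    (h : HasRegularTail q Q R A β) (hQK : (fun r => r ^ d * Q r ^ 2) =O[atTop] K)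
    (hder : (∃ u : ℝ → ℝ, Tendsto u atTop (𝓝 0) ∧ ∀ᶠ L in atTop, |1 / K L| = L ^ (u L)) →
      ∃ C R', ∀ x, R' ≤ ‖x‖ → ‖fderiv ℝ q x‖ ≤ C * (‖x‖⁻¹ * |q x|)) :
    HasLocalGlobalDecomposition f K P := by
  have hq := isSmoothKernel_dirac hqc hq2 hDq2 hDDq2
  have hmfar : ∀ r : ℝ, MeasurableSet {y : EuclideanSpace ℝ (Fin d) | r ≤ ‖y‖} := fun r =>
    measurableSet_le measurable_const measurable_norm
  have hvar : (fun L : ℝ => ∫ z in {z : ℝ × EuclideanSpace ℝ (Fin d) | L / 4 ≤ ‖z.2‖},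
      q z.2 ^ 2 ∂((Measure.dirac (0 : ℝ)).prod volume)) =O[atTop] K :=
    (h.isBigO_variance hd hℓ hKℓ hqc.continuous hq2 hK hQK).congr_left fun L =>
      (integral_dirac_prod (hmfar (L / 4)) fun z => q z.2 ^ 2).symm
  refine hasLocalGlobalDecomposition_of_kernel hf hd hq (fun _ => hrad) (fun x => ?_)
    (fun ε hε => ?_) hvar ?_
  · rw [integral_dirac_prod_univ fun z => q z.2 * q (z.2 + x), hK]
  · obtain ⟨M₀, L₀, hML⟩ := h.exists_near_le_mul hd hℓ hKℓ hqc.continuous hQK hε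
    refine ⟨M₀, L₀, fun L hL x hx => ?_⟩
    obtain ⟨hL1, hx'⟩ := hML L hL
    obtain ⟨hKx, hnear⟩ := hx' x hx
    have h1 := abs_integral_sub_integral_tailKernel_le hq (fun _ => hrad) hL1 x
    have e := integral_dirac_prod (measurableSet_le measurable_norm measurable_const :
      MeasurableSet {y : EuclideanSpace ℝ (Fin d) | ‖y‖ ≤ L / 2}) fun z => |q z.2 * q (z.2 + x)|
    simp only [mem_ofPred_eq] at e
    rw [integral_dirac_prod_univ fun z => q z.2 * q (z.2 + x), hK, e] at h1
    rw [div_sub_one hKx.ne', abs_div, abs_of_pos hKx, div_le_iff₀ hKx, abs_sub_comm]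
    exact h1.trans hnear
  · intro hu
    obtain ⟨C, R', hCR⟩ := hder hu
    refine IsBigO.trans (IsBigO.of_bound (16 * C ^ 2) ?_)
      ((isBigO_refl (fun L : ℝ => L ^ (-2 : ℝ)) atTop).mul hvar)
    filter_upwards [eventually_ge_atTop (4 * R'), eventually_gt_atTop 0] with L hL hL0
    have e1 := integral_dirac_prod (hmfar (L / 4)) fun z => ‖fderiv ℝ q z.2‖ ^ 2
    have e2 := integral_dirac_prod (hmfar (L / 4)) fun z => q z.2 ^ 2
    simp only [mem_ofPred_eq] at e1 e2
    rw [e1, e2, norm_mul, Real.norm_of_nonneg (integral_nonneg fun z => sq_nonneg _),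
      Real.norm_of_nonneg (integral_nonneg fun z => sq_nonneg _),
      Real.norm_of_nonneg (by positivity), ← mul_assoc, ← integral_const_mul]
    refine setIntegral_mono_on hDq2.integrable_sq.integrableOn
      (hq2.integrable_sq.integrableOn.const_mul _) (hmfar _) fun y hy => ?_
    have hy' : L / 4 ≤ ‖y‖ := hy
    have hy0 : 0 < ‖y‖ := by linarith
    have h1 := pow_le_pow_left₀ (norm_nonneg _) (hCR y (by linarith)) 2
    rw [mul_pow, mul_pow, sq_abs] at h1
    refine h1.trans ?_
    have h2 : ‖y‖⁻¹ ^ 2 ≤ 16 * L ^ (-2 : ℝ) := by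
      rw [Real.rpow_neg hL0.le, Real.rpow_two, inv_pow, ← div_eq_mul_inv, le_div_iff₀ (by positivity),
        inv_mul_le_iff₀ (by positivity)]
      nlinarith
    calc C ^ 2 * (‖y‖⁻¹ ^ 2 * q y ^ 2) ≤ C ^ 2 * (16 * L ^ (-2 : ℝ) * q y ^ 2) := by gcongr
      _ = _ := by ring

end RegularTailField

/-! ### Moving averages of white noise with a regularly varying kernel -/

section WhiteNoise

variable {d : ℕ}

theorem norm_le_sum_norm_apply_single {F : Type*} [NormedAddCommGroup F] [NormedSpace ℝ F]
    (T : EuclideanSpace ℝ (Fin d) →L[ℝ] F) : ‖T‖ ≤ ∑ k, ‖T (EuclideanSpace.single k 1)‖ := by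
  refine T.opNorm_le_bound (Finset.sum_nonneg fun k _ => norm_nonneg _) fun v => ?_
  have hv : v = ∑ k, v k • EuclideanSpace.single k (1 : ℝ) := by
    ext i
    simp [Finset.sum_apply, Pi.single_apply]
  conv_lhs => rw [hv]
  simp only [map_sum, map_smul]
  refine (norm_sum_le _ _).trans ?_
  rw [Finset.sum_mul]
  refine Finset.sum_le_sum fun k _ => ?_
  rw [norm_smul, mul_comm]
  exact mul_le_mul_of_nonneg_left (abs_coord_le_norm v k) (norm_nonneg _)

theorem memLp_norm_fderiv {q : EuclideanSpace ℝ (Fin d) → ℝ} (hq : ContDiff ℝ 2 q)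
    (h : ∀ i : Fin 1 → Fin d, MemLp (partialDeriv q i) 2 volume) :
    MemLp (fun y => ‖fderiv ℝ q y‖) 2 volume := by
  have hsum : MemLp (fun y => ∑ k : Fin d, ‖partialDeriv q (fun _ : Fin 1 => k) y‖) 2 volume :=
    memLp_finsetSum _ fun k _ => (h _).norm
  refine hsum.of_le (hq.continuous_fderiv (by norm_num)).norm.aestronglyMeasurable
    (ae_of_all _ fun y => ?_)
  rw [norm_norm, Real.norm_of_nonneg (Finset.sum_nonneg fun k _ => norm_nonneg _)]
  refine (norm_le_sum_norm_apply_single _).trans (le_of_eq ?_)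
  refine Finset.sum_congr rfl fun k _ => ?_
  rw [partialDeriv, iteratedFDeriv_one_apply]

theorem norm_fderiv_fderiv_le_sum (q : EuclideanSpace ℝ (Fin d) → ℝ) (y : EuclideanSpace ℝ (Fin d)) :
    ‖fderiv ℝ (fderiv ℝ q) y‖ ≤ ∑ k : Fin d, ∑ l : Fin d, ‖partialDeriv q ![k, l] y‖ := by
  refine (norm_le_sum_norm_apply_single _).trans (Finset.sum_le_sum fun k _ => ?_)
  refine (norm_le_sum_norm_apply_single _).trans (le_of_eq ?_)
  refine Finset.sum_congr rfl fun l _ => ?_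
  rw [partialDeriv, iteratedFDeriv_two_apply]
  rfl

theorem memLp_norm_fderiv_fderiv {q : EuclideanSpace ℝ (Fin d) → ℝ} (hq : ContDiff ℝ 2 q)
    (h : ∀ i : Fin 2 → Fin d, MemLp (partialDeriv q i) 2 volume) :
    MemLp (fun y => ‖fderiv ℝ (fderiv ℝ q) y‖) 2 volume := by
  have hsum : MemLp (fun y => ∑ k : Fin d, ∑ l : Fin d, ‖partialDeriv q ![k, l] y‖) 2 volume :=
    memLp_finsetSum _ fun k _ => memLp_finsetSum _ fun l _ => (h _).norm
  have hc : Continuous (fderiv ℝ (fderiv ℝ q)) :=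
    (hq.fderiv_right (m := 1) (by norm_num)).continuous_fderiv (by norm_num)
  have hcn : Continuous fun y => ‖fderiv ℝ (fderiv ℝ q) y‖ :=
    (continuous_norm (E := EuclideanSpace ℝ (Fin d) →L[ℝ] EuclideanSpace ℝ (Fin d) →L[ℝ] ℝ)).comp hc
  refine hsum.of_le hcn.aestronglyMeasurable (ae_of_all _ fun y => ?_)
  rw [Real.norm_of_nonneg (norm_nonneg
      (E := EuclideanSpace ℝ (Fin d) →L[ℝ] EuclideanSpace ℝ (Fin d) →L[ℝ] ℝ) _),
    Real.norm_of_nonneg (Finset.sum_nonneg fun k _ => Finset.sum_nonneg fun l _ => norm_nonneg _)]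
  exact norm_fderiv_fderiv_le_sum q y

/-- If `α > 0` then `1 / K` grows at least like a power. -/
theorem not_subpolynomial {K ℓ : ℝ → ℝ} {α : ℝ} (hα : 0 < α) (hℓ : IsSlowlyVarying ℓ)
    (hK : K ~[atTop] fun r => r ^ (-α) * ℓ r) :
    ¬ ∃ u : ℝ → ℝ, Tendsto u atTop (𝓝 0) ∧ ∀ᶠ L in atTop, |1 / K L| = L ^ (u L) := by
  rintro ⟨u, hu, huK⟩
  obtain ⟨R, hR, hP⟩ := potter_bounds (m := ℓ) (R₀ := 1)
    (hℓ.continuousOn.mono fun x hx => (zero_lt_one' ℝ).trans_le hx)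
    zero_lt_one (fun r hr => hℓ.pos r (zero_lt_one.trans_le hr)) hℓ.tendsto_ratio (half_pos hα)
  have hR0 : 0 < R := zero_lt_one.trans_le hR
  have hO : (fun r => r ^ (-α) * ℓ r) =O[atTop] fun r : ℝ => r ^ (-(α / 2)) := by
    refine IsBigO.of_bound (Real.exp (α / 2) * ℓ R) ?_
    filter_upwards [eventually_ge_atTop R] with r hr
    have hr0 : 0 < r := by linarith
    have hℓr := hℓ.pos r hr0
    have hℓR := hℓ.pos R hR0
    have h1 := (hP R le_rfl (r / R) ((one_le_div hR0).2 hr)).1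
    rw [div_mul_cancel₀ _ hR0.ne'] at h1
    have h2 : (r / R) ^ (α / 2) ≤ r ^ (α / 2) :=
      Real.rpow_le_rpow (by positivity) (div_le_self hr0.le hR) (by positivity)
    rw [Real.norm_of_nonneg (by positivity), Real.norm_of_nonneg (by positivity)]
    calc r ^ (-α) * ℓ r ≤ r ^ (-α) * (Real.exp (α / 2) * (r / R) ^ (α / 2) * ℓ R) := by gcongr
      _ ≤ r ^ (-α) * (Real.exp (α / 2) * r ^ (α / 2) * ℓ R) := by gcongr
      _ = Real.exp (α / 2) * ℓ R * (r ^ (-α) * r ^ (α / 2)) := by ring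
      _ = _ := by
          rw [← Real.rpow_add hr0]
          congr 2
          ring
  obtain ⟨C, hC, hKC⟩ := (hK.isBigO.trans hO).exists_pos
  have hlim := tendsto_rpow_atTop (by positivity : 0 < α / 4)
  obtain ⟨L, h1, h2, h3, h4, h5, h6⟩ := (hKC.bound.and (huK.and
    ((hu.eventually_lt_const (by positivity : 0 < α / 4)).and
      ((hlim.eventually_gt_atTop C).and ((eventually_gt_atTop 1).and
        (eventually_pos_of_isEquivalent hℓ hK)))))).exists
  have hL0 : 0 < L := by linarith
  rw [Real.norm_of_nonneg h6.le, Real.norm_of_nonneg (by positivity), Real.rpow_neg hL0.le,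
    ← div_eq_mul_inv, le_div_iff₀ (by positivity)] at h1
  rw [abs_of_pos (by positivity)] at h2
  have h7 : 1 / K L ≤ L ^ (α / 4) := by
    rw [h2]
    exact Real.rpow_le_rpow_of_exponent_le h5.le h3.le
  rw [div_le_iff₀ h6] at h7
  have h8 : L ^ (α / 2) = L ^ (α / 4) * L ^ (α / 4) := by
    rw [← Real.rpow_add hL0]
    congr 1
    ring
  rw [h8] at h1
  have hL4 : 0 < L ^ (α / 4) := by positivity
  nlinarith

/-- Powers of the logarithm are slowly varying. -/
theorem tendsto_log_rpow_ratio (s : ℝ) {a : ℝ} (ha : 0 < a) :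
    Tendsto (fun r => Real.log (a * r) ^ s / Real.log r ^ s) atTop (𝓝 1) := by
  have h1 : Tendsto (fun r => Real.log (a * r) / Real.log r) atTop (𝓝 1) := by
    have h2 : Tendsto (fun r => Real.log a / Real.log r + 1) atTop (𝓝 (0 + 1)) :=
      (tendsto_const_nhds.div_atTop Real.tendsto_log_atTop).add_const 1
    rw [zero_add] at h2
    refine h2.congr' ?_
    filter_upwards [eventually_gt_atTop 1] with r hr
    have := (Real.log_pos hr).ne'
    rw [Real.log_mul ha.ne' (by linarith), add_div, div_self this]
  have h3 := h1.rpow_const (p := s) (Or.inl one_ne_zero)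
  rw [Real.one_rpow] at h3
  refine h3.congr' ?_
  have hlog : Tendsto (fun r => Real.log (a * r)) atTop atTop :=
    Real.tendsto_log_atTop.comp (tendsto_id.const_mul_atTop ha)
  filter_upwards [hlog.eventually_ge_atTop 0, eventually_gt_atTop 1] with r h4 h5
  rw [Real.div_rpow h4 (Real.log_pos h5).le]

/-- The profile `Q` of the kernel is such that `r ^ d * Q r ^ 2` is, up to a constant,
`r ^ (-α) * m r`, where `m` is `ℓ` or, when `α = 0`, the function `(log r) ^ (-γ - 1)`. -/
theorem isBigO_profile_sq {K m : ℝ → ℝ} {α c : ℝ}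
    (hm : ∀ᶠ r in atTop, 0 ≤ m r) (hK : (fun r => r ^ (-α) * m r) =O[atTop] K) :
    (fun r => r ^ d * (c * r ^ (-((d + α) / 2)) * √(m r)) ^ 2) =O[atTop] K := by
  refine (EventuallyEq.trans_isBigO ?_ (hK.const_mul_left (c ^ 2)))
  filter_upwards [hm, eventually_gt_atTop 0] with r h1 h2
  rw [mul_pow, Real.sq_sqrt h1, mul_pow, ← Real.rpow_natCast r d,
    ← Real.rpow_natCast (r ^ (-((d + α) / 2))), ← Real.rpow_mul h2.le]
  have : r ^ (-α) = r ^ (d : ℝ) * r ^ (-((d + α) / 2) * (2 : ℕ)) := by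
    rw [← Real.rpow_add h2]
    congr 1
    push_cast
    ring
  rw [this]
  ring

theorem exists_norm_fderiv_le {q : EuclideanSpace ℝ (Fin d) → ℝ}
    (h : (fun x => ⨆ k : Fin d, |fderiv ℝ q x (EuclideanSpace.single k 1)|)
      =O[cocompact _] fun x => ‖x‖⁻¹ * q x) :
    ∃ C R', ∀ x, R' ≤ ‖x‖ → ‖fderiv ℝ q x‖ ≤ C * (‖x‖⁻¹ * |q x|) := by
  obtain ⟨C, hC⟩ := h.bound
  obtain ⟨R, hR⟩ := exists_of_eventually_cocompact hC
  refine ⟨d * C, R, fun x hx => ?_⟩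
  have h1 := hR x hx
  rw [Real.norm_of_nonneg (Real.iSup_nonneg fun k => abs_nonneg _), norm_mul, norm_inv, norm_norm,
    Real.norm_eq_abs] at h1
  refine (norm_le_sum_norm_apply_single _).trans ?_
  calc ∑ k : Fin d, ‖fderiv ℝ q x (EuclideanSpace.single k 1)‖
      ≤ ∑ _k : Fin d, C * (‖x‖⁻¹ * |q x|) := Finset.sum_le_sum fun k _ =>
        (le_ciSup (f := fun k : Fin d => |fderiv ℝ q x (EuclideanSpace.single k 1)|)
          (Set.finite_range _).bddAbove k).trans h1
    _ = _ := by
        rw [Finset.sum_const, Finset.card_univ, Fintype.card_fin, nsmul_eq_mul, mul_assoc]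

/-- The case of a spectral density. The kernel is `q`, the white noise lives on `ℝ^d`, and the two
asymptotic regimes differ only in the slowly varying factor of the profile of `q`. -/
theorem hasLocalGlobalDecomposition_of_whiteNoiseKernelCondition {Ω : Type*} [MeasurableSpace Ω]
    {P : Measure Ω} {f : EuclideanSpace ℝ (Fin d) → Ω → ℝ} {K : ℝ → ℝ} {α γ : ℝ} {ℓ : ℝ → ℝ}
    (hf : RegularlyVaryingField f K P α γ ℓ) (h : WhiteNoiseKernelCondition d K α γ ℓ) :
    HasLocalGlobalDecomposition f K P := by
  obtain ⟨ρ, q, hρ, hρ0, hν, ⟨hL2, hqF⟩, hq3, hpart, ⟨c, hc, hqpos, hqzero⟩, hder⟩ := h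
  have hd2 := hf.two_le_dim
  have hd : 0 < d := by omega
  have hq2 : ContDiff ℝ 2 q := hq3.of_le (by norm_num)
  have m0 : MemLp q 2 volume := by
    have h0 := hpart 0 (by norm_num) Fin.elim0
    have e : partialDeriv q (Fin.elim0 : Fin 0 → Fin d) = q := by
      ext1 x
      rw [partialDeriv, iteratedFDeriv_zero_apply]
    rwa [e] at h0
  have m1 := memLp_norm_fderiv hq2 (hpart 1 (by norm_num))
  have m2 := memLp_norm_fderiv_fderiv hq2 (hpart 2 (by norm_num))
  have hrad : ∀ y y', ‖y‖ = ‖y'‖ → q y = q y' := fun y y' hy =>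
    radial_of_fourierInv hρ hρ0 hν hL2 hqF hq2.continuous hy
  have hK := integral_mul_shift_of_fourierInv hρ hρ0 hν hL2 hqF
  rcases hf.index_nonneg.eq_or_lt with hα | hα
  · -- for `α = 0` the profile involves the explicit slowly varying function `(log r) ^ (-γ - 1)`
    have hα0 : α = 0 := hα.symm
    subst hα0
    have hlogpos : ∀ r : ℝ, 2 ≤ r → 0 < Real.log r := fun r hr => Real.log_pos (by linarith)
    have hequiv : q ~[cocompact _] fun x : EuclideanSpace ℝ (Fin d) =>
        c * ‖x‖ ^ (-((d + 0) / 2 : ℝ)) * √(Real.log ‖x‖ ^ (-γ - 1)) := by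
      refine (hqzero rfl).congr_right ?_
      filter_upwards [(tendsto_norm_cocompact_atTop (E := EuclideanSpace ℝ (Fin d))).eventually_ge_atTop
        2] with x hx
      rw [add_zero, Real.sqrt_eq_rpow, ← Real.rpow_mul (hlogpos _ hx).le]
      congr 2
      ring
    obtain ⟨R, A, hT⟩ := exists_hasRegularTail (m := fun r => Real.log r ^ (-γ - 1)) (R₀ := 2) hc
      le_rfl hf.index_lt_dim ((Real.continuousOn_log.mono fun r hr => by
          have : (2 : ℝ) ≤ r := hr
          simp only [mem_compl_iff, mem_singleton_iff]
          linarith).rpow_const fun r hr => Or.inl (hlogpos r hr).ne') two_pos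
      (fun r hr => Real.rpow_pos_of_pos (hlogpos r hr) _)
      (fun a ha => tendsto_log_rpow_ratio _ ha) hequiv
    refine hasLocalGlobalDecomposition_of_hasRegularTail hf.field hd hf.slowlyVarying
      hf.covariance_equiv hq2 m0 m1 m2 hrad hK hT (isBigO_profile_sq ?_ ?_)
      fun _ => exists_norm_fderiv_le (hder rfl)
    · filter_upwards [eventually_ge_atTop 2] with r hr
      exact Real.rpow_nonneg (hlogpos r hr).le _
    · have h1 : (fun r : ℝ => r ^ (-(0 : ℝ)) * Real.log r ^ (-γ - 1)) =O[atTop]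
          fun r => Real.log r ^ (-γ) := by
        refine IsBigO.of_bound 1 ?_
        filter_upwards [Real.tendsto_log_atTop.eventually_ge_atTop 1] with r hr
        rw [neg_zero, Real.rpow_zero, one_mul, one_mul, Real.norm_of_nonneg (by positivity),
          Real.norm_of_nonneg (by positivity)]
        exact Real.rpow_le_rpow_of_exponent_le hr (by linarith)
      have h2 : (fun r : ℝ => r ^ (-(0 : ℝ)) * ℓ r) = ℓ := by
        ext1 r
        rw [neg_zero, Real.rpow_zero, one_mul]
      have h3 := hf.covariance_equiv
      rw [h2] at h3
      exact (h1.trans (hf.log_equiv (Or.inl rfl)).symm.isBigO).trans h3.symm.isBigO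
  · obtain ⟨R, A, hT⟩ := exists_hasRegularTail (m := ℓ) (R₀ := 1) hc hα.le hf.index_lt_dim
      (hf.slowlyVarying.continuousOn.mono fun x hx => (zero_lt_one' ℝ).trans_le hx) zero_lt_one
      (fun r hr => hf.slowlyVarying.pos r (zero_lt_one.trans_le hr))
      hf.slowlyVarying.tendsto_ratio (hqpos hα)
    refine hasLocalGlobalDecomposition_of_hasRegularTail hf.field hd hf.slowlyVarying
      hf.covariance_equiv hq2 m0 m1 m2 hrad hK hT
      (isBigO_profile_sq ?_ hf.covariance_equiv.symm.isBigO)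
      fun hu => (not_subpolynomial hα hf.slowlyVarying hf.covariance_equiv hu).elim
    filter_upwards [eventually_gt_atTop 0] with r hr
    exact (hf.slowlyVarying.pos r hr).le

end WhiteNoise

end

theorem proposition3p4 {d : ℕ} {Ω : Type*} [MeasurableSpace Ω] (P : Measure Ω)
    [IsProbabilityMeasure P] (f : EuclideanSpace ℝ (Fin d) → Ω → ℝ) (K : ℝ → ℝ)
    (α γ : ℝ) (ℓ : ℝ → ℝ)
    (hf : RegularlyVaryingField f K P α γ ℓ)
    (h : LaplaceCondition d K α γ ℓ ∨ WhiteNoiseKernelCondition d K α γ ℓ) :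
    HasLocalGlobalDecomposition f K P := by
  rcases h with h | h
  · exact hasLocalGlobalDecomposition_of_laplaceCondition hf h
  · exact hasLocalGlobalDecomposition_of_whiteNoiseKernelCondition hf h
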